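/- **Setting.** For $\Re a>-1$ let $\langle\,\cdot\,\rangle_{{\rm LUE}_N}$ be the average with respect to the normalised density proportional to $\prod_{l=1}^N\lambda_l^ae^{-\lambda_l}\prod_{1\le j<k\le N}(\lambda_k-\lambda_j)^2$ on $[0,\infty)^N$, let $C_{N,a}=\prod_{j=0}^{N-1}\Gamma(j+1)\Gamma(j+a+1)$, and for $s>0$ put $$\tilde E_{2,N}((0,s);a,\mu;\xi)=\frac{C_{N,a}}{C_{N,a+\mu}}\Big\langle\prod_{l=1}^N\big(1-\xi\chi_{(0,s)}(\lambda_l)\big)(\lambda_l-s)^\mu\Big\rangle_{{\rm LUE}_N},$$ where $(\lambda-s)^\mu$ is the principal power, equal to $e^{\pi i\mu}(s-\lambda)^\mu$ for $\lambda<s$. Define (where the limit exists) $$\tilde E_2^{\rm hard}(t;a,\mu;\xi)=\lim_{N\to\infty}\tilde E_{2,N}\big((0,\tfrac{t}{4N});a,\mu;\xi\big),$$ and define $\sigma_{\rm III'}$ by $s\frac{d}{ds}\log\tilde E_2^{\rm hard}(s;a,\mu;\xi)=-\big(\sigma_{\rm III'}(s)+\tfrac{\mu(\mu+a)}{2}\big)$.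 **Corollary.** Let $a,\mu,\xi\in\mathbb C$ with $\Re\mu>-1$, $\Re a>-1$, $\Re(\mu+a)>-1$ and $\mu+a\notin\mathbb Z_{\ge0}$. Assume that the hard edge limit can be taken term by term in the small $s$ expansion of $\tilde E_{2,N}$, in the following sense: whenever coefficients $c_N(\rho)$ are such that, for every $N\ge1$, $\tilde E_{2,N}((0,s);a,\mu;\xi)=\sum_\rho c_N(\rho)s^\rho$ for all sufficiently small $s>0$ (an absolutely convergent sum over the distinct exponents $\rho=m+k(\mu+a+1)$, $m,k\in\mathbb Z_{\ge0}$), then $h(\rho)=\lim_{N\to\infty}c_N(\rho)(4N)^{-\rho}$ exists for every $\rho$, and for all sufficiently small $t>0$ the sum $\sum_\rho h(\rho)t^\rho$ converges absolutely and $\lim_{N\to\infty}\tilde E_{2,N}((0,\frac t{4N});a,\mu;\xi)=\sum_\rho h(\rho)t^\rho$. Then for all sufficiently small $t>0$ the limit $\tilde E_2^{\rm hard}(t)=\tilde E_2^{\rm hard}(t;a,\mu;\xi)$ exists, is differentiable and non-zero, and $\tilde E_2^{\rm hard}(t)=\exp\Big(-\int_0^t\big(\sigma_{\rm III'}(s)+\tfrac{\mu(\mu+a)}2\big)\frac{ds}{s}\Big)$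 with a convergent integral. Moreover, as $s\to0^+$, $$\tilde E_2^{\rm hard}(s)=1-\frac{\mu}{4(a+\mu)}s+{\rm O}(s^2)+\frac{\Gamma(\mu+1)\Gamma(a+1)}{\Gamma^2(\mu+a+2)\Gamma(\mu+a+1)}\Big((1-\xi)e^{\pi i\mu}-\frac{\sin\pi a}{\sin\pi(\mu+a)}\Big)\Big(\frac s4\Big)^{\mu+a+1}\{1+{\rm O}(s)\}+{\rm O}(s^{2(\mu+a+1)}),$$ and consequently $$\sigma_{\rm III'}(s)=-\frac{\mu(\mu+a)}2+\frac{\mu}{4(\mu+a)}s+{\rm O}(s^2)-\frac{\Gamma(\mu+1)\Gamma(a+1)}{\Gamma(\mu+a+2)\Gamma^2(\mu+a+1)}\Big((1-\xi)e^{\pi i\mu}-\frac{\sin\pi a}{\sin\pi(\mu+a)}\Big)\Big(\frac s4\Big)^{\mu+a+1}\{1+{\rm O}(s)\}+{\rm O}(s^{2(\mu+a+1)}),$$ which is the boundary condition at $s=0$ for $\sigma_{\rm III'}$ as a solution of the $\sigma$-form of Painlevé III$'$. In both expansions the part (constant) + (linear term) + ${\rm O}(s^2)$ and the factor $1+{\rm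 O}(s)$ are analytic functions of $s$ at $s=0$. -/

import Mathlib

open Filter Topology MeasureTheory Asymptotics

noncomputable section

namespace HardEdge

/-- Lebesgue measure on `[0, ∞)ᴺ` (up to a null set). -/
def orthantMeasure (N : ℕ) : Measure (Fin N → ℝ) :=
  Measure.pi fun _ => volume.restrict (Set.Ioi 0)

/-- The unnormalised eigenvalue density
`∏ₗ λₗᵃ e^{-λₗ} ∏_{j<k} (λₖ - λⱼ)²` of the Laguerre unitary ensemble. -/
def lueWeight (N : ℕ) (a : ℂ) (x : Fin N → ℝ) : ℂ :=
  (∏ l, (x l : ℂ) ^ a * Complex.exp (-(x l : ℂ))) *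
    ∏ j, ∏ k ∈ Finset.Ioi j, ((x k : ℂ) - (x j : ℂ)) ^ 2

/-- The average `⟨f⟩` over the Laguerre unitary ensemble (so that `⟨1⟩ = 1`). -/
def lueAverage (N : ℕ) (a : ℂ) (f : (Fin N → ℝ) → ℂ) : ℂ :=
  (∫ x, f x * lueWeight N a x ∂orthantMeasure N) / ∫ x, lueWeight N a x ∂orthantMeasure N

/-- `C_{N,a} = ∏_{j=0}^{N-1} Γ(j+1) Γ(j+a+1)`. -/
def lueNorm (N : ℕ) (a : ℂ) : ℂ :=
  ∏ j ∈ Finset.range N, Complex.Gamma (j + 1) * Complex.Gamma (j + a + 1)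

/-- `Ẽ_{2,N}((0,s);a,μ;ξ)`. The power `(λ - s) ^ μ` is the principal one, `-π < arg ≤ π`, that is
`e^{πiμ} (s - λ)^μ` for `λ < s`. -/
def ETilde (N : ℕ) (a μ ξ : ℂ) (s : ℝ) : ℂ :=
  lueNorm N a / lueNorm N (a + μ) *
    lueAverage N a fun x =>
      ∏ l, (1 - ξ * (Set.Ioo 0 s).indicator (fun _ => (1 : ℂ)) (x l)) * ((x l : ℂ) - (s : ℂ)) ^ μ

/-- The hard edge scaling `Ẽ_{2,N}((0, t/(4N));a,μ;ξ)`. -/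
def scaledE (N : ℕ) (a μ ξ : ℂ) (t : ℝ) : ℂ :=
  ETilde N a μ ξ (t / (4 * N))

/-- The hard edge limit `Ẽ₂^hard(t;a,μ;ξ) = lim_{N → ∞} Ẽ_{2,N}((0, t/(4N));a,μ;ξ)`. -/
def EHard (a μ ξ : ℂ) (t : ℝ) : ℂ :=
  limUnder atTop fun N : ℕ => scaledE N a μ ξ t

/-- `σ_{III'}`, determined by `s d/ds log Ẽ₂^hard(s) = -(σ_{III'}(s) + μ(μ+a)/2)`. -/
def sigmaIII (a μ ξ : ℂ) (s : ℝ) : ℂ :=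
  -((s : ℂ) * logDeriv (EHard a μ ξ) s) - μ * (μ + a) / 2

/-- The exponents `m + k(α+1)`, `m, k ∈ ℕ`, of a power series in `s` and `s^{α+1}`. -/
def exponents (α : ℂ) : Set ℂ :=
  {ρ | ∃ m k : ℕ, ρ = m + k * (α + 1)}

/-- `f(s) = ∑_ρ c(ρ) s^ρ` for all sufficiently small `s > 0`, the (absolutely convergent) sum
running over the distinct exponents `ρ = m + k(α+1)`. -/
def HasSmallExpansion (α : ℂ) (f : ℝ → ℂ) (c : ℂ → ℂ) : Prop :=
  ∀ᶠ s : ℝ in 𝓝[>] 0, HasSum (fun ρ : exponents α => c ρ * (s : ℂ) ^ (ρ : ℂ)) (f s)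

/-- The hard edge limit can be taken term by term in the small `s` expansions of the
`Ẽ_{2,N}((0,s);a,μ;ξ)`: if `Ẽ_{2,N}((0,s)) = ∑_ρ c_N(ρ) s^ρ`, then every term of
`Ẽ_{2,N}((0,t/(4N))) = ∑_ρ c_N(ρ) (4N)^{-ρ} t^ρ` converges as `N → ∞`, and for all small `t > 0`
the sum of the limits of the terms is the limit of the sums. That the `Ẽ_{2,N}` do have such
expansions is not part of this condition. -/
def LimitTermByTerm (a μ ξ : ℂ) : Prop :=
  ∀ c : ℕ → ℂ → ℂ,
    (∀ N : ℕ, 1 ≤ N → HasSmallExpansion (μ + a) (ETilde N a μ ξ) (c N)) →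
    ∃ h : ℂ → ℂ,
      (∀ ρ ∈ exponents (μ + a),
        Tendsto (fun N : ℕ => c N ρ / (4 * (N : ℂ)) ^ ρ) atTop (𝓝 (h ρ))) ∧
      ∀ᶠ t : ℝ in 𝓝[>] 0, ∃ L : ℂ,
        HasSum (fun ρ : exponents (μ + a) => h ρ * (t : ℂ) ^ (ρ : ℂ)) L ∧
        Tendsto (fun N : ℕ => scaledE N a μ ξ t) atTop (𝓝 L)

/-- `f(s) = c₀ + c₁ s + O(s²) + d (s/4)^{α+1} {1 + O(s)} + O(s^{2(α+1)})` as `s → 0⁺`, where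
`c₀ + c₁ s + O(s²)` and `1 + O(s)` are analytic functions of `s` at `0`. -/
def HasEdgeExpansion (α : ℂ) (f : ℝ → ℂ) (c₀ c₁ d : ℂ) : Prop :=
  ∃ A B : ℂ → ℂ, AnalyticAt ℂ A 0 ∧ AnalyticAt ℂ B 0 ∧
    A 0 = c₀ ∧ deriv A 0 = c₁ ∧ B 0 = 1 ∧
    (fun s : ℝ => f s - (A s + d * ((s : ℂ) / 4) ^ (α + 1) * B s))
      =O[𝓝[>] 0] fun s : ℝ => (s : ℂ) ^ (2 * (α + 1))

end HardEdge

end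

noncomputable section

namespace HardEdge

/-! ### Andréief's identity -/

/-! Write α = μ + a and w = s^{α+1}. Andréief's identity (`integral_prod_mul_vandermonde_sq`) turns
the average into the Hankel determinant of the moments of the deformed weight, so everything rests
on the small s behaviour of one-dimensional integrals.

Each moment is a power series in s plus w times a power series in s (`moment_deformedWeight`). To
see this, cut the half line at s and 2s. On the two bounded pieces expand the exponential. Beyond 2s
expand (1 - s/x)^μ, which produces incomplete Gamma functions: their complete parts Γ(a + n + μ + 1
- k) form the regular series, their lower parts all carry w. The non-analytic contributions from x >
s assemble into the continuation of ∫₁^∞ y^{γ-μ-1}(y-1)^μ dy, a Beta value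
(`innerBeta_sub_outerBeta`). The reflection formula reduces it to -sin πa / sin π(μ+a) times the
Beta integral coming from (0, s), so one amplitude `edgeConst` factors out of all moments.

Hence Ẽ_{2,N} is det(P(s) + w Q(s)) over a constant, a polynomial in w with coefficients analytic in
s (`exists_ETilde_eq_sum`). Its leading data are explicit. P(0) is a Hankel matrix of Gamma values.
In the derivative of det P at 0 every column but the first contributes zero, which leaves a solvable
linear system and the value -μN/α. Q(0) has only its corner entry, so the coefficient of w is a Beta
integral times a smaller Gamma Hankel determinant. After division by (4N)^ρ the linear coefficient
no longer depends on N, and the coefficient of w converges because Γ(N+α+1) ~ Γ(N) N^{α+1}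
(`exists_hardEdge_coefficients`).

The hypothesis on the limit now gives Ẽ₂^hard as an absolutely convergent sum of h(ρ) s^ρ. Grouping
exponents by k = 0, k = 1 and k ≥ 2 yields the stated shape (`exists_isEdge`). Distinct pairs (m, k)
may give the same exponent; whatever coincides with k ≥ 2 is put into the error term. Termwise
differentiation gives s d/ds Ẽ₂^hard the same shape, and `IsEdge.div` transfers it to the quotient,
hence to σ. Since Ẽ₂^hard tends to 1, integrating its logarithmic derivative from 0 recovers it. -/

theorem det_vandermonde_eq_sum {N : ℕ} (v : Fin N → ℂ) :
    (Matrix.vandermonde v).det =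
      ∑ σ : Equiv.Perm (Fin N), ((Equiv.Perm.sign σ : ℤ) : ℂ) * ∏ i, v i ^ (σ i : ℕ) := by
  rw [← Matrix.det_transpose, Matrix.det_apply']
  rfl

theorem prod_mul_vandermonde_sq {N : ℕ} (f : ℝ → ℂ) (x : Fin N → ℝ) :
    (∏ l, f (x l)) * ∏ j, ∏ k ∈ Finset.Ioi j, ((x k : ℂ) - (x j : ℂ)) ^ 2 =
      ∑ σ : Equiv.Perm (Fin N), ∑ τ : Equiv.Perm (Fin N),
        (((Equiv.Perm.sign σ : ℤ) : ℂ) * ((Equiv.Perm.sign τ : ℤ) : ℂ)) *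
          ∏ i, ((x i : ℂ) ^ ((σ i : ℕ) + (τ i : ℕ)) * f (x i)) := by
  have h : ∏ j, ∏ k ∈ Finset.Ioi j, ((x k : ℂ) - (x j : ℂ)) ^ 2 =
      (Matrix.vandermonde fun i => (x i : ℂ)).det ^ 2 := by
    rw [Matrix.det_vandermonde, ← Finset.prod_pow]
    exact Finset.prod_congr rfl fun j _ => by rw [← Finset.prod_pow]
  rw [h, det_vandermonde_eq_sum, sq, Finset.sum_mul_sum, Finset.mul_sum]
  refine Finset.sum_congr rfl fun σ _ => ?_
  rw [Finset.mul_sum]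
  refine Finset.sum_congr rfl fun τ _ => ?_
  simp_rw [Finset.prod_mul_distrib, pow_add, Finset.prod_mul_distrib]
  ring

/-- Permuting the rows by σ costs sign σ, which cancels the explicit sign; each of the N! choices of
σ thus contributes the same determinant. -/
theorem sum_sign_mul_sign_prod {N : ℕ} (H : Matrix (Fin N) (Fin N) ℂ) :
    ∑ σ : Equiv.Perm (Fin N), ∑ τ : Equiv.Perm (Fin N),
        (((Equiv.Perm.sign σ : ℤ) : ℂ) * ((Equiv.Perm.sign τ : ℤ) : ℂ)) *
          ∏ i, H (σ i) (τ i) = (N.factorial : ℂ) * H.det := by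
  have h : ∀ σ : Equiv.Perm (Fin N), ∑ τ : Equiv.Perm (Fin N),
        (((Equiv.Perm.sign σ : ℤ) : ℂ) * ((Equiv.Perm.sign τ : ℤ) : ℂ)) *
          ∏ i, H (σ i) (τ i) = H.det := by
    intro σ
    have h1 := Matrix.det_permute σ H
    rw [← Matrix.det_transpose, Matrix.det_apply'] at h1
    simp_rw [mul_assoc, ← Finset.mul_sum]
    have h2 : ∑ τ : Equiv.Perm (Fin N), ((Equiv.Perm.sign τ : ℤ) : ℂ) * ∏ i, H (σ i) (τ i) =
      ((Equiv.Perm.sign σ : ℤ) : ℂ) * H.det := h1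
    rw [h2, ← mul_assoc, ← Int.cast_mul, Int.units_coe_mul_self]
    simp
  simp [h, Fintype.card_perm]

/-- Andréief: expand both Vandermonde factors over permutations, so that every term is a product of
functions of one variable, and integrate by Fubini. -/
theorem integral_prod_mul_vandermonde_sq (N : ℕ) (f : ℝ → ℂ)
    (hf : ∀ n : ℕ, IntegrableOn (fun x : ℝ => (x : ℂ) ^ n * f x) (Set.Ioi 0)) :
    ∫ x, (∏ l, f (x l)) * ∏ j, ∏ k ∈ Finset.Ioi j, ((x k : ℂ) - (x j : ℂ)) ^ 2
        ∂orthantMeasure N =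
      (N.factorial : ℂ) * (Matrix.of fun j k : Fin N =>
        ∫ x in Set.Ioi (0 : ℝ), (x : ℂ) ^ ((j : ℕ) + k) * f x).det := by
  have hint : ∀ σ τ : Equiv.Perm (Fin N), Integrable (fun x : Fin N → ℝ =>
      (((Equiv.Perm.sign σ : ℤ) : ℂ) * ((Equiv.Perm.sign τ : ℤ) : ℂ)) *
          ∏ i, ((x i : ℂ) ^ ((σ i : ℕ) + (τ i : ℕ)) * f (x i))) (orthantMeasure N) := by
    intro σ τ
    refine Integrable.const_mul ?_ _
    exact Integrable.fintype_prod
      (f := fun i (y : ℝ) => (y : ℂ) ^ ((σ i : ℕ) + (τ i : ℕ)) * f y) fun i => hf _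
  simp_rw [prod_mul_vandermonde_sq]
  rw [integral_finsetSum _ fun σ _ => integrable_finsetSum _ fun τ _ => hint σ τ,
    ← sum_sign_mul_sign_prod]
  refine Finset.sum_congr rfl fun σ _ => ?_
  rw [integral_finsetSum _ fun τ _ => hint σ τ]
  refine Finset.sum_congr rfl fun τ _ => ?_
  rw [integral_const_mul]
  congr 1
  exact integral_fintype_prod_eq_prod
    (fun i (y : ℝ) => (y : ℂ) ^ ((σ i : ℕ) + (τ i : ℕ)) * f y)

/-! ### Hankel determinants of Gamma values -/

/-- The Hankel matrix of the moments `Γ(n + β)` of the weight `x^{β-1} e^{-x}`. -/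
def gammaHankel (N : ℕ) (β : ℂ) : Matrix (Fin N) (Fin N) ℂ :=
  Matrix.of fun j k => Complex.Gamma (((j : ℕ) + (k : ℕ) : ℕ) + β)

theorem Gamma_add_natCast {z : ℂ} (hz : ∀ m : ℕ, z ≠ -m) (n : ℕ) :
    Complex.Gamma (z + n) = Complex.Gamma z * (ascPochhammer ℂ n).eval z := by
  induction n with
  | zero => simp
  | succ n ih =>
    have h : z + n ≠ 0 := fun h => hz n (eq_neg_of_add_eq_zero_left h)
    rw [Nat.cast_succ, ← add_assoc, Complex.Gamma_add_one _ h, ih, ascPochhammer_succ_right]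
    simp
    ring

theorem ne_neg_natCast_of_re_pos {z : ℂ} (hz : 0 < z.re) (m : ℕ) : z ≠ -m := by
  intro h
  rw [h] at hz
  simp at hz
  have : (0 : ℝ) ≤ m := m.cast_nonneg
  linarith

/-- With Γ(j+β) taken out of row j, the entries become rising factorials (j+β)_k, monic of degree k
in the node j+β. The rest is the Vandermonde determinant of consecutive nodes, a superfactorial. -/
theorem det_gammaHankel (N : ℕ) {β : ℂ} (hβ : 0 < β.re) :
    (gammaHankel N β).det =
      ∏ j ∈ Finset.range N, Complex.Gamma (j + 1) * Complex.Gamma (j + β) := by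
  have h1 : gammaHankel N β = Matrix.of fun j k : Fin N =>
      Complex.Gamma ((j : ℕ) + β) *
        (Matrix.of fun i k : Fin N => (ascPochhammer ℂ (k : ℕ)).eval ((i : ℕ) + β)) j k := by
    ext j k
    have : 0 < (((j : ℕ) : ℂ) + β).re := by
      simp only [Complex.add_re, Complex.natCast_re]; positivity
    simp only [gammaHankel, Matrix.of_apply]
    rw [← Gamma_add_natCast (ne_neg_natCast_of_re_pos this)]
    push_cast
    ring_nf
  rw [h1, Matrix.det_mul_column, ← Matrix.det_eval_matrixOfPolynomials_eq_det_vandermonde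
    (fun i : Fin N => ((i : ℕ) : ℂ) + β) (fun k : Fin N => ascPochhammer ℂ (k : ℕ))
    (fun i => ascPochhammer_natDegree _ _) (fun i => monic_ascPochhammer _ _),
    Matrix.det_vandermonde_add (fun i : Fin N => ((i : ℕ) : ℂ)), Finset.prod_mul_distrib,
    Fin.prod_univ_eq_prod_range (fun i => Complex.Gamma ((i : ℂ) + β)), mul_comm]
  congr 1
  cases N with
  | zero => simp
  | succ n =>
    rw [Matrix.det_vandermonde_id_eq_superFactorial, ← Nat.prod_range_succ_factorial]
    simp only [Complex.Gamma_nat_eq_factorial]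
    push_cast
    rfl

/-- The Gamma quotient is the rising factorial (α+k)_j, of degree j < N in k, so its N-th finite
difference vanishes. -/
theorem sum_choose_mul_Gamma {N j : ℕ} (hj : j < N) {α : ℂ} (hα : ∀ m : ℕ, α ≠ -m) :
    ∑ k ∈ Finset.range (N + 1),
      (-1 : ℂ) ^ k * (N.choose k : ℂ) * (Complex.Gamma (α + k + j) / Complex.Gamma (α + k)) = 0 := by
  have hk : ∀ k : ℕ, ∀ m : ℕ, α + k ≠ -m := fun k m h => hα (m + k) (by
    push_cast; linear_combination h)
  have h := congrFun (Polynomial.fwdDiff_iter_eq_zero_of_degree_lt (P := ascPochhammer ℂ j)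
    (n := N) (by simpa using hj)) α
  rw [fwdDiff_iter_eq_sum_shift] at h
  have h2 : ∀ k ∈ Finset.range (N + 1),
      (-1 : ℂ) ^ k * (N.choose k : ℂ) * (Complex.Gamma (α + k + j) / Complex.Gamma (α + k)) =
      (-1 : ℂ) ^ N * (((-1 : ℤ) ^ (N - k) * (N.choose k : ℤ)) •
        (ascPochhammer ℂ j).eval (α + k • (1 : ℂ))) := by
    intro k hkN
    rw [Gamma_add_natCast (hk k), mul_div_cancel_left₀ _ (Complex.Gamma_ne_zero (hk k))]
    have hN : (-1 : ℂ) ^ N = (-1) ^ k * (-1) ^ (N - k) := by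
      rw [← pow_add, Nat.add_sub_cancel' (Nat.lt_succ_iff.1 (Finset.mem_range.1 hkN))]
    have h1 : ((-1 : ℂ) ^ (N - k)) * (-1) ^ (N - k) = 1 := by
      rw [← mul_pow]; simp
    simp only [zsmul_eq_mul, nsmul_eq_mul, mul_one]
    push_cast
    rw [hN]
    linear_combination (-((-1 : ℂ) ^ k * (N.choose k) *
      (ascPochhammer ℂ j).eval (α + k))) * h1
  rw [Finset.sum_congr rfl h2, ← Finset.mul_sum]
  simp only [Pi.zero_apply] at h
  rw [h, mul_zero]

/-- Solving `∑ₖ Γ(j+k+α+1) vₖ = Γ(j+α)` gives `v₀ = N / α`. -/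
theorem det_gammaHankel_updateCol_zero (n : ℕ) {α : ℂ} (hα : ∀ m : ℕ, α ≠ -m) :
    ((gammaHankel (n + 1) (α + 1)).updateCol 0
      fun j => Complex.Gamma ((j : ℕ) + α)).det =
      ((n + 1 : ℕ) : ℂ) / α * (gammaHankel (n + 1) (α + 1)).det := by
  have hα0 : α ≠ 0 := by simpa using hα 0
  have hΓ : Complex.Gamma α ≠ 0 := Complex.Gamma_ne_zero hα
  -- The vanishing difference of order n + 1, solved for its k = 0 term, writes the new column as a
  -- combination of the old ones; only the coefficient of column 0 survives in the determinant.
  set c : Fin (n + 1) → ℂ := fun k => (-1 : ℂ) ^ (k : ℕ) * ((n + 1).choose (k + 1) : ℂ) *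
    (Complex.Gamma α / Complex.Gamma (α + 1 + (k : ℕ))) with hc
  have hcol : (fun j : Fin (n + 1) => Complex.Gamma ((j : ℕ) + α)) =
      fun j => ∑ k, c k • gammaHankel (n + 1) (α + 1) j k := by
    funext j
    have h := sum_choose_mul_Gamma j.2 hα
    rw [Finset.sum_range_succ', ← Fin.sum_univ_eq_sum_range
      (fun k => (-1 : ℂ) ^ (k + 1) * ((n + 1).choose (k + 1) : ℂ) *
        (Complex.Gamma (α + (k + 1 : ℕ) + (j : ℕ)) / Complex.Gamma (α + (k + 1 : ℕ))))] at h
    have hsum : ∑ k, c k • gammaHankel (n + 1) (α + 1) j k = - Complex.Gamma α *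
        ∑ k : Fin (n + 1), (-1 : ℂ) ^ ((k : ℕ) + 1) * ((n + 1).choose (k + 1) : ℂ) *
        (Complex.Gamma (α + ((k : ℕ) + 1 : ℕ) + (j : ℕ)) /
          Complex.Gamma (α + ((k : ℕ) + 1 : ℕ))) := by
      rw [Finset.mul_sum]
      refine Finset.sum_congr rfl fun k _ => ?_
      simp only [hc, gammaHankel, Matrix.of_apply, smul_eq_mul]
      push_cast
      rw [show (j : ℂ) + (k : ℂ) + (α + 1) = α + (k + 1) + j by ring,
        show α + 1 + (k : ℂ) = α + (k + 1) by ring]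
      ring
    rw [hsum, eq_neg_of_add_eq_zero_left h]
    simp only [pow_zero, Nat.choose_zero_right, Nat.cast_one, one_mul, Nat.cast_zero, add_zero,
      mul_neg, neg_mul, neg_neg]
    rw [mul_div_cancel₀ _ hΓ, add_comm]
  rw [hcol, Matrix.det_updateCol_sum, smul_eq_mul]
  congr 1
  simp only [hc, Fin.val_zero, pow_zero, zero_add, Nat.choose_one_right, one_mul, Nat.cast_zero,
    add_zero]
  rw [Complex.Gamma_add_one _ hα0]
  field_simp

/-! ### Determinants of matrices depending on a parameter -/

/-- Product rule in the Leibniz expansion, regrouped by the differentiated column. -/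
theorem hasDerivAt_det {n : Type*} [Fintype n] [DecidableEq n] {P : ℂ → Matrix n n ℂ}
    {P' : Matrix n n ℂ} {z : ℂ} (h : ∀ i j, HasDerivAt (fun s => P s i j) (P' i j) z) :
    HasDerivAt (fun s => (P s).det) (∑ k, ((P z).updateCol k fun j => P' j k).det) z := by
  have h1 : (fun s => (P s).det) = fun s => ∑ σ : Equiv.Perm n,
      ((Equiv.Perm.sign σ : ℤ) : ℂ) * ∏ i, P s (σ i) i := by
    funext s; rw [Matrix.det_apply']
  have h2 : ∑ k, ((P z).updateCol k fun j => P' j k).det = ∑ σ : Equiv.Perm n,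
      ((Equiv.Perm.sign σ : ℤ) : ℂ) *
        ∑ k, (∏ i ∈ Finset.univ.erase k, P z (σ i) i) • P' (σ k) k := by
    simp_rw [Matrix.det_apply', Finset.mul_sum]
    rw [Finset.sum_comm]
    refine Finset.sum_congr rfl fun σ _ => Finset.sum_congr rfl fun k _ => ?_
    congr 1
    rw [← Finset.prod_erase_mul _ _ (Finset.mem_univ k), smul_eq_mul, Matrix.updateCol_self]
    congr 1
    refine Finset.prod_congr rfl fun i hi => ?_
    rw [Matrix.updateCol_ne (Finset.ne_of_mem_erase hi)]
  rw [h1, h2]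
  refine HasDerivAt.fun_sum fun σ _ => HasDerivAt.const_mul _ ?_
  exact HasDerivAt.fun_finsetProd fun i _ => h (σ i) i

/-- The coefficient of `wᵏ` in `det (P + w Q)`. -/
def detCoeff {N : ℕ} (P Q : Matrix (Fin N) (Fin N) ℂ) (k : ℕ) : ℂ :=
  ((Polynomial.X : Polynomial ℂ) • Q.map Polynomial.C + P.map Polynomial.C).det.coeff k

theorem det_add_smul_eq_sum {N : ℕ} (P Q : Matrix (Fin N) (Fin N) ℂ) (w : ℂ) :
    (P + w • Q).det = ∑ k ∈ Finset.range (N + 1), detCoeff P Q k * w ^ k := by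
  have h1 := Polynomial.natDegree_det_X_add_C_le Q P
  rw [Fintype.card_fin] at h1
  simp only [detCoeff]
  rw [← Polynomial.eval_eq_sum_range' (Nat.lt_succ_of_le h1) w, ← Polynomial.coe_evalRingHom,
    RingHom.map_det]
  congr 1
  ext i j
  simp
  ring

theorem detCoeff_zero {N : ℕ} (P Q : Matrix (Fin N) (Fin N) ℂ) : detCoeff P Q 0 = P.det :=
  Polynomial.coeff_det_X_add_C_zero Q P

theorem detCoeff_zero_right {N : ℕ} (P : Matrix (Fin N) (Fin N) ℂ) {k : ℕ} (hk : k ≠ 0) :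
    detCoeff P 0 k = 0 := by
  have : (Polynomial.X : Polynomial ℂ) • (0 : Matrix (Fin N) (Fin N) ℂ).map Polynomial.C +
      P.map Polynomial.C = Polynomial.C.mapMatrix P := by
    ext i j; simp
  rw [detCoeff, this, ← RingHom.map_det, Polynomial.coeff_C_of_ne_zero hk]

/-- The perturbation changes row 0 by a multiple of the first unit vector, so linearity in that row
leaves the corner minor. -/
theorem detCoeff_one_of_single {n : ℕ} (P Q : Matrix (Fin (n + 1)) (Fin (n + 1)) ℂ)
    (hQ : ∀ i j, (i ≠ 0 ∨ j ≠ 0) → Q i j = 0) :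
    detCoeff P Q 1 = Q 0 0 * (P.submatrix Fin.succ Fin.succ).det := by
  have h1 : (Polynomial.X : Polynomial ℂ) • Q.map Polynomial.C + P.map Polynomial.C =
      (P.map Polynomial.C).updateRow 0 ((P.map Polynomial.C) 0 +
        ((Polynomial.X : Polynomial ℂ) * Polynomial.C (Q 0 0)) • Pi.single 0 1) := by
    ext1 i j
    by_cases hi : i = 0
    · subst hi
      by_cases hj : j = 0
      · subst hj; simp [add_comm]
      · simp [hj, hQ 0 j (Or.inr hj)]
    · simp [hi, hQ i j (Or.inl hi)]
  have h2 : ((P.map Polynomial.C).updateRow 0 (Pi.single 0 1)).det =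
      Polynomial.C (P.submatrix Fin.succ Fin.succ).det := by
    rw [← Matrix.adjugate_apply, Matrix.adjugate_fin_succ_eq_det_submatrix, RingHom.map_det]
    simp
    rfl
  have h3 : (P.map Polynomial.C).det = Polynomial.C P.det := by
    rw [RingHom.map_det]; rfl
  rw [detCoeff, h1, Matrix.det_updateRow_add, Matrix.updateRow_eq_self, Matrix.det_updateRow_smul,
    h2, h3, mul_assoc, ← Polynomial.C_mul, Polynomial.coeff_add, Polynomial.coeff_C_of_ne_zero one_ne_zero,
    zero_add]
  exact (Polynomial.coeff_X_mul _ 0).trans Polynomial.coeff_C_zero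

theorem analyticAt_coeff_prod {ι : Type*} (s : Finset ι) {p : ι → ℂ → Polynomial ℂ} {z : ℂ}
    (h : ∀ i ∈ s, ∀ k, AnalyticAt ℂ (fun x => (p i x).coeff k) z) (k : ℕ) :
    AnalyticAt ℂ (fun x => (∏ i ∈ s, p i x).coeff k) z := by
  classical
  induction s using Finset.induction_on generalizing k with
  | empty => simp only [Finset.prod_empty]; exact analyticAt_const
  | insert i s hi ih =>
    simp only [Finset.prod_insert hi, Polynomial.coeff_mul]
    exact Finset.analyticAt_fun_sum _ fun m _ => (h i (Finset.mem_insert_self _ _) _).mul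
      (ih (fun j hj => h j (Finset.mem_insert_of_mem hj)) _)

theorem analyticAt_detCoeff {N : ℕ} {P Q : ℂ → Matrix (Fin N) (Fin N) ℂ} {z : ℂ}
    (hP : ∀ i j, AnalyticAt ℂ (fun s => P s i j) z)
    (hQ : ∀ i j, AnalyticAt ℂ (fun s => Q s i j) z) (k : ℕ) :
    AnalyticAt ℂ (fun s => detCoeff (P s) (Q s) k) z := by
  simp only [detCoeff, Matrix.det_apply, Polynomial.finsetSum_coeff]
  refine Finset.analyticAt_fun_sum _ fun σ _ => ?_
  have h : AnalyticAt ℂ (fun s => (∏ i, ((Polynomial.X : Polynomial ℂ) • (Q s).map Polynomial.C +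
      (P s).map Polynomial.C) (σ i) i).coeff k) z := by
    refine analyticAt_coeff_prod _ (fun i _ m => ?_) k
    have : (fun s => (((Polynomial.X : Polynomial ℂ) • (Q s).map Polynomial.C +
      (P s).map Polynomial.C) (σ i) i).coeff m) = fun s =>
        (if 1 = m then Q s (σ i) i else 0) + if m = 0 then P s (σ i) i else 0 := by
      funext s
      simp [Polynomial.coeff_C, Polynomial.coeff_X]
    rw [this]
    refine AnalyticAt.fun_add ?_ ?_
    · split_ifs
      · exact hQ _ _
      · exact analyticAt_const
    · split_ifs
      · exact hP _ _
      · exact analyticAt_const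
  simp only [Units.smul_def, Polynomial.coeff_smul]
  rcases Int.units_eq_one_or (Equiv.Perm.sign σ) with hs | hs
  · simpa [hs] using h
  · simpa [hs] using h.fun_neg

/-! ### Power series -/

theorem hasFPowerSeriesAt_tsum {c : ℕ → ℂ} {r : ℝ} (hr : 0 < r)
    (hc : Summable fun k => c k * (r : ℂ) ^ k) :
    HasFPowerSeriesAt (fun z : ℂ => ∑' k, c k * z ^ k) (FormalMultilinearSeries.ofScalars ℂ c) 0 := by
  rw [hasFPowerSeriesAt_iff]
  filter_upwards [Metric.ball_mem_nhds (0 : ℂ) hr] with z hz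
  have hz' : ‖z‖ ≤ r := by simpa using (Metric.mem_ball.1 hz).le
  have hs : Summable fun k => c k * z ^ k := by
    refine Summable.of_norm_bounded hc.norm fun k => ?_
    rw [norm_mul, norm_mul, norm_pow, norm_pow, Complex.norm_real, Real.norm_of_nonneg hr.le]
    gcongr
  simpa [FormalMultilinearSeries.coeff_ofScalars, mul_comm] using hs.hasSum

theorem analyticAt_tsum {c : ℕ → ℂ} {r : ℝ} (hr : 0 < r)
    (hc : Summable fun k => c k * (r : ℂ) ^ k) :
    AnalyticAt ℂ (fun z : ℂ => ∑' k, c k * z ^ k) 0 :=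
  (hasFPowerSeriesAt_tsum hr hc).analyticAt

theorem tsum_mul_zero_pow (c : ℕ → ℂ) : ∑' k, c k * (0 : ℂ) ^ k = c 0 := by
  rw [tsum_eq_single 0 fun k hk => by simp [hk]]
  simp

theorem deriv_tsum_zero {c : ℕ → ℂ} {r : ℝ} (hr : 0 < r)
    (hc : Summable fun k => c k * (r : ℂ) ^ k) :
    deriv (fun z : ℂ => ∑' k, c k * z ^ k) 0 = c 1 := by
  rw [(hasFPowerSeriesAt_tsum hr hc).deriv]
  simp

/-! ### The binomial series -/

/-- The Taylor coefficients of `(1 - u)^μ`. -/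
def binomCoeff (μ : ℂ) (k : ℕ) : ℂ := (-1) ^ k * Ring.choose μ k

theorem hasSum_binomCoeff (μ : ℂ) {u : ℂ} (hu : ‖u‖ < 1) :
    HasSum (fun k => binomCoeff μ k * u ^ k) ((1 - u) ^ μ) := by
  have h := (Complex.one_add_cpow_hasFPowerSeriesOnBall_zero (a := μ)).hasSum (y := -u) (by
    rw [← ENNReal.ofReal_one, Metric.eball_ofReal]
    simpa using hu)
  have e : (fun n => (binomialSeries ℂ μ n fun _ => -u)) = fun k => binomCoeff μ k * u ^ k := by
    funext k
    rw [binomialSeries_apply]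
    simp only [List.ofFn_const, List.prod_replicate, smul_eq_mul, binomCoeff]
    rw [neg_pow]
    ring
  rw [e] at h
  simpa [sub_eq_add_neg] using h

theorem summable_norm_binomCoeff (μ : ℂ) {r : ℝ} (hr0 : 0 ≤ r) (hr : r < 1) :
    Summable fun k => ‖binomCoeff μ k‖ * r ^ k := by
  have h := (hasSum_binomCoeff μ (u := (r : ℂ))
    (by rwa [Complex.norm_real, Real.norm_of_nonneg hr0])).summable.norm
  simpa [norm_mul, norm_pow, abs_of_nonneg hr0] using h

theorem binomCoeff_zero (μ : ℂ) : binomCoeff μ 0 = 1 := by simp [binomCoeff]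

/-- This recurrence is what makes the series `outerBeta` satisfy a first-order difference equation
in γ. -/
theorem binomCoeff_succ (μ : ℂ) (k : ℕ) :
    ((k : ℂ) + 1) * binomCoeff μ (k + 1) = (k - μ) * binomCoeff μ k := by
  have h1 := Ring.descPochhammer_eq_factorial_smul_choose μ k
  have h2 := Ring.descPochhammer_eq_factorial_smul_choose μ (k + 1)
  rw [descPochhammer_succ_right, Polynomial.smeval_mul, h1] at h2
  simp only [Polynomial.smeval_sub, Polynomial.smeval_X, Polynomial.smeval_natCast, pow_one,
    pow_zero, nsmul_eq_mul, mul_one, Nat.factorial_succ] at h2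
  push_cast at h2
  have hk : (k.factorial : ℂ) ≠ 0 := Nat.cast_ne_zero.2 k.factorial_ne_zero
  have h3 : Ring.choose μ k * (μ - k) = (k + 1) * Ring.choose μ (k + 1) :=
    mul_left_cancel₀ hk (by linear_combination h2)
  simp only [binomCoeff, pow_succ]
  linear_combination (-1 : ℂ) ^ k * h3

theorem binomCoeff_one (μ : ℂ) : binomCoeff μ 1 = -μ := by
  have := binomCoeff_succ μ 0
  simpa [binomCoeff_zero] using this

/-! ### Non-integers -/

/-- The integers are closed in ℂ. The uniform bound controls all denominators β + n of the single
and double series below. -/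
theorem exists_pos_le_norm_add_int {β : ℂ} (hβ : ∀ n : ℤ, β ≠ n) :
    ∃ δ : ℝ, 0 < δ ∧ ∀ n : ℤ, δ ≤ ‖β + n‖ := by
  have hcl : IsClosed (Set.range fun n : ℤ => ((n : ℝ) : ℂ)) :=
    (Complex.isometry_ofReal.isClosedEmbedding.comp Int.isClosedEmbedding_coe_real).isClosed_range
  have hne : β ∉ Set.range fun n : ℤ => ((n : ℝ) : ℂ) := by
    rintro ⟨n, hn⟩
    exact hβ n (by rw [← hn]; simp)
  obtain ⟨δ, hδ, hb⟩ := Metric.isOpen_iff.1 hcl.isOpen_compl β hne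
  refine ⟨δ, hδ, fun n => ?_⟩
  by_contra h
  push Not at h
  refine hb (show ((-n : ℤ) : ℂ) ∈ Metric.ball β δ from ?_) ⟨-n, by simp⟩
  rw [Metric.mem_ball, dist_comm, dist_eq_norm]
  simpa using h

/-! ### Termwise integration -/

theorem hasSum_integral_mul_exp {g : ℝ → ℂ} {S : Set ℝ} {R : ℝ} (hS : MeasurableSet S)
    (hR : ∀ x ∈ S, |x| ≤ R) (hg : IntegrableOn g S) :
    HasSum (fun m : ℕ => (-1 : ℂ) ^ m / (m.factorial : ℂ) * ∫ x in S, (x : ℂ) ^ m * g x)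
      (∫ x in S, g x * Complex.exp (-(x : ℂ))) := by
  set F : ℕ → ℝ → ℂ := fun m x => (-1 : ℂ) ^ m / (m.factorial : ℂ) * ((x : ℂ) ^ m * g x) with hF
  have hFn : ∀ m : ℕ, ∀ x ∈ S, ‖F m x‖ ≤ R ^ m / m.factorial * ‖g x‖ := by
    intro m x hx
    simp only [hF, norm_mul, norm_div, norm_pow, norm_neg, norm_one, one_pow, Complex.norm_real,
      Complex.norm_natCast, Real.norm_eq_abs]
    have : |x| ^ m ≤ R ^ m := pow_le_pow_left₀ (abs_nonneg x) (hR x hx) m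
    calc 1 / (m.factorial : ℝ) * (|x| ^ m * ‖g x‖) = |x| ^ m / m.factorial * ‖g x‖ := by ring
      _ ≤ _ := by gcongr
  have hmeas : ∀ m, AEStronglyMeasurable (F m) (volume.restrict S) := fun m =>
    (((Complex.continuous_ofReal.pow m).aestronglyMeasurable).mul hg.aestronglyMeasurable).const_mul _
  have hFi : ∀ m, IntegrableOn (F m) S := fun m =>
    Integrable.mono' (hg.norm.const_mul (R ^ m / m.factorial)) (hmeas m)
      ((ae_restrict_iff' hS).2 (ae_of_all _ (hFn m)))
  have hsum : Summable fun m => ∫ x in S, ‖F m x‖ := by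
    refine Summable.of_nonneg_of_le (fun m => integral_nonneg fun x => norm_nonneg _) (fun m => ?_)
      ((Real.summable_pow_div_factorial R).mul_right (∫ x in S, ‖g x‖))
    rw [← integral_const_mul]
    exact setIntegral_mono_on (hFi m).norm (hg.norm.const_mul _) hS (hFn m)
  have h := hasSum_integral_of_summable_integral_norm hFi hsum
  convert! h using 1
  · funext m
    simp only [hF, integral_const_mul]
  · refine setIntegral_congr_fun hS fun x _ => ?_
    have he : HasSum (fun m : ℕ => (-(x : ℂ)) ^ m / (m.factorial : ℂ)) (Complex.exp (-(x : ℂ))) := by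
      rw [Complex.exp_eq_exp_ℂ]
      exact NormedSpace.expSeries_div_hasSum_exp _
    have h3 := (he.mul_left (g x)).tsum_eq
    rw [← h3]
    refine tsum_congr fun m => ?_
    simp only [hF]
    rw [neg_pow]
    ring

/-- Cutting at 2s rather than s keeps |s/x| ≤ 1/2, so the binomial series is dominated geometrically
and no estimate at the singularity x = s is needed. -/
theorem hasSum_integral_mul_one_sub_div_cpow {W : ℝ → ℂ} {s : ℝ} (hs : 0 < s) (μ : ℂ)
    (hW : IntegrableOn W (Set.Ioi (2 * s))) :
    HasSum (fun k : ℕ => binomCoeff μ k * (s : ℂ) ^ k *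
        ∫ x in Set.Ioi (2 * s), (x : ℂ) ^ (-(k : ℂ)) * W x)
      (∫ x in Set.Ioi (2 * s), W x * (1 - (s : ℂ) / x) ^ μ) ∧
    IntegrableOn (fun x : ℝ => W x * (1 - (s : ℂ) / x) ^ μ) (Set.Ioi (2 * s)) := by
  set F : ℕ → ℝ → ℂ := fun k x => binomCoeff μ k * (s : ℂ) ^ k * ((x : ℂ) ^ (-(k : ℂ)) * W x) with hF
  have hFe : ∀ k : ℕ, ∀ x : ℝ, F k x = W x * (binomCoeff μ k * ((s : ℂ) / x) ^ k) := by
    intro k x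
    simp only [hF, Complex.cpow_neg, Complex.cpow_natCast, div_pow]
    ring
  have hb : ∀ x ∈ Set.Ioi (2 * s), ‖(s : ℂ) / x‖ ≤ 1 / 2 := by
    intro x hx
    have hx' : 2 * s < x := hx
    have hx0 : 0 < x := by linarith
    rw [norm_div, Complex.norm_real, Complex.norm_real, Real.norm_of_nonneg hs.le,
      Real.norm_of_nonneg hx0.le, div_le_iff₀ hx0]
    linarith
  have hFn : ∀ k : ℕ, ∀ x ∈ Set.Ioi (2 * s), ‖F k x‖ ≤ ‖binomCoeff μ k‖ * (1 / 2) ^ k * ‖W x‖ := by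
    intro k x hx
    rw [hFe, norm_mul, norm_mul, norm_pow, mul_comm]
    gcongr
    exact hb x hx
  have hmeas : ∀ k, AEStronglyMeasurable (F k) (volume.restrict (Set.Ioi (2 * s))) := fun k => by
    have : F k = fun x => W x * (binomCoeff μ k * ((s : ℂ) / x) ^ k) := funext (hFe k)
    rw [this]
    refine hW.aestronglyMeasurable.mul (Measurable.aestronglyMeasurable ?_)
    fun_prop
  have hFi : ∀ k, IntegrableOn (F k) (Set.Ioi (2 * s)) := fun k =>
    Integrable.mono' (hW.norm.const_mul _) (hmeas k)
      ((ae_restrict_iff' measurableSet_Ioi).2 (ae_of_all _ (hFn k)))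
  have hsum : Summable fun k => ∫ x in Set.Ioi (2 * s), ‖F k x‖ := by
    refine Summable.of_nonneg_of_le (fun m => integral_nonneg fun x => norm_nonneg _) (fun k => ?_)
      ((summable_norm_binomCoeff μ (by norm_num : (0 : ℝ) ≤ 1 / 2) (by norm_num)).mul_right
        (∫ x in Set.Ioi (2 * s), ‖W x‖))
    rw [← integral_const_mul]
    exact setIntegral_mono_on (hFi k).norm (hW.norm.const_mul _) measurableSet_Ioi (hFn k)
  have hpt : ∀ x ∈ Set.Ioi (2 * s), HasSum (fun k => F k x) (W x * (1 - (s : ℂ) / x) ^ μ) := by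
    intro x hx
    simp only [hFe]
    exact (hasSum_binomCoeff μ ((hb x hx).trans_lt (by norm_num))).mul_left _
  constructor
  · have h := hasSum_integral_of_summable_integral_norm hFi hsum
    convert! h using 1
    · funext k
      simp only [hF, integral_const_mul]
    · exact setIntegral_congr_fun measurableSet_Ioi fun x hx => (hpt x hx).tsum_eq.symm
  · have hm : AEStronglyMeasurable (fun x : ℝ => W x * (1 - (s : ℂ) / x) ^ μ)
        (volume.restrict (Set.Ioi (2 * s))) := by
      refine hW.aestronglyMeasurable.mul (Measurable.aestronglyMeasurable ?_)
      fun_prop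
    refine Integrable.mono' (hW.norm.const_mul (∑' k, ‖binomCoeff μ k‖ * (1 / 2) ^ k)) hm
      ((ae_restrict_iff' measurableSet_Ioi).2 (ae_of_all _ fun x hx => ?_))
    rw [← (hpt x hx).tsum_eq, ← tsum_mul_right]
    have hsm := (summable_norm_binomCoeff μ (by norm_num : (0 : ℝ) ≤ 1 / 2)
      (by norm_num)).mul_right ‖W x‖
    exact tsum_of_norm_bounded hsm.hasSum fun k => hFn k x hx

/-! ### The incomplete Gamma function -/

theorem integrableOn_Ioi_cpow_mul_exp (w : ℂ) {t : ℝ} (ht : 0 < t) :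
    IntegrableOn (fun x : ℝ => (x : ℂ) ^ w * Complex.exp (-(x : ℂ))) (Set.Ioi t) := by
  have h : IntegrableOn (fun x : ℝ => Real.exp (-x) * x ^ w.re) (Set.Ioi t) := by
    refine integrable_of_isBigO_exp_neg (b := 1 / 2) (by norm_num) ?_
      (Real.Gamma_integrand_isLittleO w.re).isBigO
    refine ContinuousOn.mul (by fun_prop) fun x hx => ?_
    exact (Real.continuousAt_rpow_const x _
      (Or.inl (ht.trans_le hx).ne')).continuousWithinAt
  refine Integrable.mono' h (Measurable.aestronglyMeasurable (by fun_prop)) ?_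
  refine (ae_restrict_iff' measurableSet_Ioi).2 (ae_of_all _ fun x hx => ?_)
  rw [norm_mul, Complex.norm_cpow_eq_rpow_re_of_pos (ht.trans hx), Complex.norm_exp]
  simp [mul_comm]

theorem tendsto_cpow_mul_exp_atTop (w : ℂ) :
    Tendsto (fun x : ℝ => (x : ℂ) ^ w * Complex.exp (-(x : ℂ))) atTop (𝓝 0) := by
  rw [tendsto_zero_iff_norm_tendsto_zero]
  have h1 : Tendsto (fun x : ℝ => Real.exp (-(1 / 2) * x)) atTop (𝓝 0) :=
    Real.tendsto_exp_atBot.comp (tendsto_id.const_mul_atTop_of_neg (by norm_num))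
  refine ((Real.Gamma_integrand_isLittleO w.re).isBigO.trans_tendsto h1).congr' ?_
  filter_upwards [eventually_gt_atTop 0] with x hx
  rw [norm_mul, Complex.norm_cpow_eq_rpow_re_of_pos hx, Complex.norm_exp]
  simp [mul_comm]

/-- Integration by parts; since t > 0 there is no restriction on Re z. -/
theorem integral_Ioi_cpow_mul_exp_succ (z : ℂ) {t : ℝ} (ht : 0 < t) (hz : z ≠ 0) :
    ∫ x in Set.Ioi t, (x : ℂ) ^ z * Complex.exp (-(x : ℂ)) =
      (t : ℂ) ^ z * Complex.exp (-(t : ℂ)) +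
        z * ∫ x in Set.Ioi t, (x : ℂ) ^ (z - 1) * Complex.exp (-(x : ℂ)) := by
  have hd : ∀ x ∈ Set.Ici t, HasDerivAt (fun x : ℝ => -((x : ℂ) ^ z * Complex.exp (-(x : ℂ))))
      ((x : ℂ) ^ z * Complex.exp (-(x : ℂ)) -
        z * ((x : ℂ) ^ (z - 1) * Complex.exp (-(x : ℂ)))) x := by
    intro x hx
    have hx0 : x ≠ 0 := (ht.trans_le hx).ne'
    have h1 := hasDerivAt_ofReal_cpow_const hx0 hz
    have h2 : HasDerivAt (fun y : ℝ => Complex.exp (-(y : ℂ))) (-Complex.exp (-(x : ℂ))) x := by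
      have := (Complex.ofRealCLM.hasDerivAt (x := x)).neg.cexp
      simpa using this
    convert! (h1.mul h2).neg using 1
    ring
  have hi1 := integrableOn_Ioi_cpow_mul_exp z ht
  have hi2 := (integrableOn_Ioi_cpow_mul_exp (z - 1) ht).const_mul z
  have h := integral_Ioi_of_hasDerivAt_of_tendsto
    (hd t Set.self_mem_Ici).continuousAt.continuousWithinAt
    (fun x hx => hd x (Set.mem_Ici_of_Ioi hx)) (hi1.sub hi2) (by simpa using (tendsto_cpow_mul_exp_atTop z).neg)
  rw [integral_sub hi1 hi2, integral_const_mul] at h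
  linear_combination h

/-- The entire function `t^{-z} γ(z, t) = ∑ⱼ (-t)ʲ / (j! (z + j))`. -/
def lowerSeries (z t : ℂ) : ℂ :=
  ∑' j : ℕ, (-1) ^ j / (j.factorial : ℂ) * t ^ j / (z + j)

theorem norm_lowerSeries_term_le {z : ℂ} {δ : ℝ} (hδ : 0 < δ) (hz : ∀ j : ℕ, δ ≤ ‖z + j‖)
    (t : ℂ) (j : ℕ) :
    ‖(-1) ^ j / (j.factorial : ℂ) * t ^ j / (z + j)‖ ≤ ‖t‖ ^ j / j.factorial * δ⁻¹ := by
  simp only [norm_mul, norm_div, norm_pow, norm_neg, norm_one, one_pow, Complex.norm_natCast]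
  calc 1 / (j.factorial : ℝ) * ‖t‖ ^ j / ‖z + j‖ = ‖t‖ ^ j / j.factorial * ‖z + j‖⁻¹ := by ring
    _ ≤ _ := by
      gcongr
      exact hz j

theorem exists_pos_le_norm_add_nat {z : ℂ} (hz : ∀ n : ℤ, z ≠ n) :
    ∃ δ : ℝ, 0 < δ ∧ ∀ j : ℕ, δ ≤ ‖z + j‖ := by
  obtain ⟨δ, hδ, h⟩ := exists_pos_le_norm_add_int hz
  exact ⟨δ, hδ, fun j => by simpa using h j⟩

theorem hasSum_lowerSeries {z : ℂ} (hz : ∀ n : ℤ, z ≠ n) (t : ℂ) :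
    HasSum (fun j : ℕ => (-1) ^ j / (j.factorial : ℂ) * t ^ j / (z + j)) (lowerSeries z t) := by
  obtain ⟨δ, hδ, h⟩ := exists_pos_le_norm_add_nat hz
  exact (Summable.of_norm_bounded ((Real.summable_pow_div_factorial ‖t‖).mul_right δ⁻¹)
    (norm_lowerSeries_term_le hδ h t)).hasSum

/-- Obtained by an index shift against the exponential series; it is the counterpart of integration
by parts for the upper incomplete Gamma integral. -/
theorem mul_lowerSeries_add_one {z : ℂ} (hz : ∀ n : ℤ, z ≠ n) (t : ℂ) :
    t * lowerSeries (z + 1) t = z * lowerSeries z t - Complex.exp (-t) := by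
  have hz1 : ∀ n : ℤ, z + 1 ≠ n := fun n h => hz (n - 1) (by push_cast; linear_combination h)
  have he : HasSum (fun m : ℕ => (-t) ^ m / (m.factorial : ℂ)) (Complex.exp (-t)) := by
    rw [Complex.exp_eq_exp_ℂ]
    exact NormedSpace.expSeries_div_hasSum_exp _
  have h1 := ((hasSum_lowerSeries hz t).mul_left z).sub he
  have h2 := (hasSum_nat_add_iff' 1).2 h1
  simp only [Finset.range_one, Finset.sum_singleton] at h2
  have hz0 : z ≠ 0 := by simpa using hz 0
  have h3 : z * ((-1) ^ 0 / ((Nat.factorial 0 : ℕ) : ℂ) * t ^ 0 / (z + (0 : ℕ))) -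
      (-t) ^ 0 / ((Nat.factorial 0 : ℕ) : ℂ) = 0 := by
    simp [hz0]
  rw [h3, sub_zero] at h2
  refine HasSum.unique ((hasSum_lowerSeries hz1 t).mul_left t) ?_
  convert! h2 using 1
  funext j
  have hj : z + 1 + j ≠ 0 := fun h => hz1 (-j) (by push_cast; linear_combination h)
  have hj' : z + ((j + 1 : ℕ) : ℂ) ≠ 0 := by
    push_cast; rwa [add_comm (j : ℂ), ← add_assoc]
  have hf : (j.factorial : ℂ) ≠ 0 := Nat.cast_ne_zero.2 j.factorial_ne_zero
  have hj1 : (j : ℂ) + 1 ≠ 0 := Nat.cast_add_one_ne_zero j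
  rw [neg_pow t, Nat.factorial_succ]
  push_cast at hj' ⊢
  field_simp
  ring

theorem setIntegral_Ioc_cpow {q : ℂ} (hq : -1 < q.re) {t : ℝ} (ht : 0 < t) :
    ∫ x in Set.Ioc 0 t, (x : ℂ) ^ q = (t : ℂ) ^ (q + 1) / (q + 1) := by
  have hq1 : q + 1 ≠ 0 := fun h => by
    have := congrArg Complex.re h
    simp at this
    linarith
  rw [← intervalIntegral.integral_of_le ht.le, integral_cpow (Or.inl hq), Complex.ofReal_zero,
    Complex.zero_cpow hq1, sub_zero]

theorem integral_Ioi_cpow_mul_exp_of_re_pos {z : ℂ} (hz : ∀ n : ℤ, z ≠ n) (hre : 0 < z.re)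
    {t : ℝ} (ht : 0 < t) :
    ∫ x in Set.Ioi t, (x : ℂ) ^ (z - 1) * Complex.exp (-(x : ℂ)) =
      Complex.Gamma z - (t : ℂ) ^ z * lowerSeries z t := by
  have hg : IntegrableOn (fun x : ℝ => (x : ℂ) ^ (z - 1)) (Set.Ioc 0 t) := by
    rw [← intervalIntegrable_iff_integrableOn_Ioc_of_le ht.le]
    exact intervalIntegral.intervalIntegrable_cpow' (by simpa using hre)
  have h1 := hasSum_integral_mul_exp (R := t) measurableSet_Ioc
    (fun x hx => by rw [abs_of_pos hx.1]; exact hx.2) hg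
  have h2 := (hasSum_lowerSeries hz t).mul_left ((t : ℂ) ^ z)
  have h3 : ∫ x in Set.Ioc 0 t, (x : ℂ) ^ (z - 1) * Complex.exp (-(x : ℂ)) =
      (t : ℂ) ^ z * lowerSeries z t := by
    refine h1.unique ?_
    convert! h2 using 1
    funext m
    have h4 : ∫ x in Set.Ioc 0 t, (x : ℂ) ^ m * (x : ℂ) ^ (z - 1) =
        (t : ℂ) ^ (z + m) / (z + m) := by
      have : ∫ x in Set.Ioc 0 t, (x : ℂ) ^ m * (x : ℂ) ^ (z - 1) =
          ∫ x in Set.Ioc 0 t, (x : ℂ) ^ (z + m - 1) := by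
        refine setIntegral_congr_fun measurableSet_Ioc fun x hx => ?_
        have hx0 : (x : ℂ) ≠ 0 := Complex.ofReal_ne_zero.2 hx.1.ne'
        rw [show z + m - 1 = m + (z - 1) by ring, Complex.cpow_add _ _ hx0, Complex.cpow_natCast]
      rw [this, setIntegral_Ioc_cpow _ ht, sub_add_cancel]
      simp only [Complex.sub_re, Complex.add_re, Complex.natCast_re, Complex.one_re]
      have : (0 : ℝ) ≤ m := m.cast_nonneg
      linarith
    rw [h4, Complex.cpow_add _ _ (Complex.ofReal_ne_zero.2 ht.ne'), Complex.cpow_natCast]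
    ring
  have h5 : Complex.Gamma z = ∫ x in Set.Ioi (0 : ℝ),
      (x : ℂ) ^ (z - 1) * Complex.exp (-(x : ℂ)) := by
    rw [Complex.Gamma_eq_integral hre, Complex.GammaIntegral]
    refine setIntegral_congr_fun measurableSet_Ioi fun x _ => ?_
    simp [mul_comm]
  have hint : IntegrableOn (fun x : ℝ => (x : ℂ) ^ (z - 1) * Complex.exp (-(x : ℂ)))
      (Set.Ioi 0) := by
    refine (Complex.GammaIntegral_convergent hre).congr_fun (fun x _ => ?_) measurableSet_Ioi
    simp [mul_comm]
  have h6 := setIntegral_union (μ := volume) (Set.Ioc_disjoint_Ioi_same (a := (0 : ℝ)) (b := t))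
    measurableSet_Ioi (hint.mono_set Set.Ioc_subset_Ioi_self)
    (hint.mono_set (Set.Ioi_subset_Ioi ht.le))
  rw [Set.Ioc_union_Ioi_eq_Ioi ht.le, ← h5, h3] at h6
  rw [h6]
  ring

/-- For Re z > 0 this is the Gamma integral cut at t. Both sides obey the same recurrence in z,
which carries the identity to the left through all non-integers; this is needed because the binomial
expansion lowers z by arbitrary k. -/
theorem integral_Ioi_cpow_mul_exp {z : ℂ} (hz : ∀ n : ℤ, z ≠ n) {t : ℝ} (ht : 0 < t) :
    ∫ x in Set.Ioi t, (x : ℂ) ^ (z - 1) * Complex.exp (-(x : ℂ)) =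
      Complex.Gamma z - (t : ℂ) ^ z * lowerSeries z t := by
  obtain ⟨n, hn⟩ := exists_nat_gt (-z.re)
  have hn' : 0 < z.re + n := by linarith
  clear hn
  induction n generalizing z with
  | zero => exact integral_Ioi_cpow_mul_exp_of_re_pos hz (by simpa using hn') ht
  | succ n ih =>
    have hz1 : ∀ n : ℤ, z + 1 ≠ n := fun n h => hz (n - 1) (by push_cast; linear_combination h)
    have hz0 : z ≠ 0 := by simpa using hz 0
    have ht0 : (t : ℂ) ≠ 0 := Complex.ofReal_ne_zero.2 ht.ne'
    have h := ih hz1 (by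
      simp only [Complex.add_re, Complex.one_re]; push_cast at hn'; linarith)
    rw [add_sub_cancel_right, integral_Ioi_cpow_mul_exp_succ z ht hz0, Complex.Gamma_add_one _ hz0,
      Complex.cpow_add _ _ ht0, Complex.cpow_one, mul_assoc, mul_lowerSeries_add_one hz] at h
    refine mul_left_cancel₀ hz0 ?_
    linear_combination h

/-! ### The Beta integral over `(1, ∞)` and its analytic continuation -/

theorem hasDerivAt_ofReal_cpow_of_pos {x : ℝ} (hx : 0 < x) (r : ℂ) :
    HasDerivAt (fun y : ℝ => (y : ℂ) ^ r) (r * (x : ℂ) ^ (r - 1)) x := by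
  have h := ((hasDerivAt_id (x : ℂ)).cpow_const (c := r)
    (Complex.ofReal_mem_slitPlane.2 hx)).comp_ofReal
  simpa using h

theorem cpow_mul_one_sub_div_cpow {x s : ℝ} (hs : 0 ≤ s) (hx : s < x) (q μ : ℂ) :
    (x : ℂ) ^ (q + μ) * (1 - (s : ℂ) / x) ^ μ = (x : ℂ) ^ q * ((x : ℂ) - s) ^ μ := by
  have hx0 : 0 < x := hs.trans_lt hx
  have hxc : (x : ℂ) ≠ 0 := Complex.ofReal_ne_zero.2 hx0.ne'
  have h1 : 0 ≤ 1 - s / x := by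
    rw [sub_nonneg, div_le_one hx0]; exact hx.le
  have h2 : (x : ℂ) - s = (x : ℂ) * ((1 - s / x : ℝ) : ℂ) := by
    push_cast; field_simp
  rw [h2, Complex.mul_cpow_ofReal_nonneg hx0.le h1, Complex.cpow_add _ _ hxc]
  push_cast
  ring

theorem integrableOn_cpow_mul_sub_cpow (q : ℂ) {μ : ℂ} (hμ : -1 < μ.re) {s t : ℝ} (hs : 0 < s)
    (hst : s ≤ t) :
    IntegrableOn (fun x : ℝ => (x : ℂ) ^ q * ((x : ℂ) - s) ^ μ) (Set.Ioc s t) := by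
  rw [← intervalIntegrable_iff_integrableOn_Ioc_of_le hst]
  have h1 : IntervalIntegrable (fun x : ℝ => ((x : ℂ) - s) ^ μ) volume s t := by
    have := (intervalIntegral.intervalIntegrable_cpow' (a := 0) (b := t - s) hμ).comp_sub_right s
    simpa using this
  refine h1.continuousOn_mul fun x hx => ?_
  rw [Set.uIcc_of_le hst] at hx
  exact (Complex.continuousAt_ofReal_cpow_const x q
    (Or.inr (hs.trans_le hx.1).ne')).continuousWithinAt

/-- `∫₁² y^{γ-μ-1} (y-1)^μ dy`. -/
def innerBeta (μ γ : ℂ) : ℂ :=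
  ∫ y in Set.Ioc (1 : ℝ) 2, (y : ℂ) ^ (γ - μ - 1) * ((y : ℂ) - (1 : ℝ)) ^ μ

/-- `-∫₂^∞ y^{γ-μ-1} (y-1)^μ dy`, analytically continued in `γ`. -/
def outerBeta (μ γ : ℂ) : ℂ :=
  ∑' k : ℕ, binomCoeff μ k * ((2 : ℂ) ^ (γ - k) / (γ - k))

theorem sub_natCast_ne_zero {γ : ℂ} (hγ : ∀ n : ℤ, γ ≠ n) (k : ℕ) : γ - k ≠ 0 :=
  fun h => hγ k (by push_cast; exact sub_eq_zero.1 h)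

theorem exists_pos_le_norm_sub_add_nat {γ : ℂ} (hγ : ∀ n : ℤ, γ ≠ n) :
    ∃ δ : ℝ, 0 < δ ∧ ∀ k j : ℕ, δ ≤ ‖γ - k + j‖ := by
  obtain ⟨δ, hδ, h⟩ := exists_pos_le_norm_add_int hγ
  refine ⟨δ, hδ, fun k j => ?_⟩
  have := h (j - k)
  push_cast at this
  rwa [show γ - k + (j : ℂ) = γ + (j - k) by ring]

theorem norm_outerBeta_term_le {γ : ℂ} {δ : ℝ} (hδ : 0 < δ) (h : ∀ k : ℕ, δ ≤ ‖γ - k‖) (μ : ℂ)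
    (k : ℕ) : ‖binomCoeff μ k * ((2 : ℂ) ^ (γ - k) / (γ - k))‖ ≤
      ‖binomCoeff μ k‖ * (1 / 2) ^ k * (2 ^ γ.re * δ⁻¹) := by
  have h2 : ‖(2 : ℂ) ^ (γ - k)‖ = 2 ^ γ.re * (1 / 2) ^ k := by
    have := Complex.norm_cpow_eq_rpow_re_of_pos (x := 2) (by norm_num) (γ - k)
    rw [Complex.ofReal_ofNat] at this
    rw [this, Complex.sub_re, Complex.natCast_re, Real.rpow_sub (by norm_num), Real.rpow_natCast]
    simp [div_eq_mul_inv]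
  rw [norm_mul, norm_div, h2]
  calc ‖binomCoeff μ k‖ * (2 ^ γ.re * (1 / 2) ^ k / ‖γ - k‖)
      = ‖binomCoeff μ k‖ * (1 / 2) ^ k * (2 ^ γ.re * ‖γ - k‖⁻¹) := by ring
    _ ≤ _ := by gcongr; exact h k

theorem hasSum_outerBeta (μ : ℂ) {γ : ℂ} (hγ : ∀ n : ℤ, γ ≠ n) :
    HasSum (fun k : ℕ => binomCoeff μ k * ((2 : ℂ) ^ (γ - k) / (γ - k))) (outerBeta μ γ) := by
  obtain ⟨δ, hδ, h⟩ := exists_pos_le_norm_sub_add_nat hγ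
  exact (Summable.of_norm_bounded ((summable_norm_binomCoeff μ (r := 1 / 2) (by norm_num)
    (by norm_num)).mul_right _) (norm_outerBeta_term_le hδ (fun k => by simpa using h k 0) μ)).hasSum

/-- Integrate the derivative of y^{γ-μ}(y-1)^{μ+1} over [1, 2]; the boundary term at 1 vanishes
because Re μ > -1. -/
theorem innerBeta_add_one {μ : ℂ} (hμ : -1 < μ.re) (γ : ℂ) :
    (γ + 1) * innerBeta μ (γ + 1) = (γ - μ) * innerBeta μ γ + (2 : ℂ) ^ (γ - μ) := by
  have hμ1 : μ + 1 ≠ 0 := fun h => by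
    have := congrArg Complex.re h
    simp at this
    linarith
  have hμre : 0 < (μ + 1).re := by simp; linarith
  have hi1 := (integrableOn_cpow_mul_sub_cpow (γ + 1 - μ - 1) hμ one_pos one_le_two).const_mul (γ + 1)
  have hi2 := (integrableOn_cpow_mul_sub_cpow (γ - μ - 1) hμ one_pos one_le_two).const_mul (γ - μ)
  have h := intervalIntegral.integral_eq_sub_of_hasDerivAt_of_le (a := 1) (b := 2) one_le_two
    (f := fun y : ℝ => (y : ℂ) ^ (γ - μ) * ((y : ℂ) - (1 : ℝ)) ^ (μ + 1))
    (f' := fun y : ℝ => (γ + 1) * ((y : ℂ) ^ (γ + 1 - μ - 1) * ((y : ℂ) - (1 : ℝ)) ^ μ) -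
      (γ - μ) * ((y : ℂ) ^ (γ - μ - 1) * ((y : ℂ) - (1 : ℝ)) ^ μ)) ?_ ?_ ?_
  · rw [intervalIntegral.integral_of_le one_le_two, integral_sub hi1 hi2, integral_const_mul,
      integral_const_mul] at h
    simp only [Complex.ofReal_one, sub_self, Complex.zero_cpow hμ1, mul_zero, sub_zero] at h
    norm_num at h
    simp only [innerBeta]
    norm_num
    linear_combination h
  · refine ContinuousOn.mul (fun y hy => ?_) (fun y hy => ?_)
    · exact (Complex.continuousAt_ofReal_cpow_const y _
        (Or.inr (one_pos.trans_le hy.1).ne')).continuousWithinAt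
    · have := Complex.continuousAt_ofReal_cpow_const (y - 1) (μ + 1) (Or.inl hμre)
      have h2 : ContinuousAt (fun y : ℝ => ((y - 1 : ℝ) : ℂ) ^ (μ + 1)) y :=
        ContinuousAt.comp (f := fun y : ℝ => y - 1) this (by fun_prop)
      simpa using h2.continuousWithinAt
  · intro y hy
    have hy0 : 0 < y := one_pos.trans hy.1
    have hy1 : 0 < y - 1 := sub_pos.2 hy.1
    have h1 := hasDerivAt_ofReal_cpow_of_pos hy0 (γ - μ)
    have h2 : HasDerivAt (fun y : ℝ => ((y : ℂ) - (1 : ℝ)) ^ (μ + 1))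
        ((μ + 1) * ((y : ℂ) - (1 : ℝ)) ^ μ) y := by
      have := (hasDerivAt_ofReal_cpow_of_pos hy1 (μ + 1)).comp_sub_const y 1
      simpa using this
    convert! h1.mul h2 using 1
    have hyc : (y : ℂ) ≠ 0 := Complex.ofReal_ne_zero.2 hy0.ne'
    have hyc1 : (y : ℂ) - (1 : ℝ) ≠ 0 := by
      rw [← Complex.ofReal_sub]; exact Complex.ofReal_ne_zero.2 hy1.ne'
    rw [Complex.cpow_add _ _ hyc1, Complex.cpow_one, show γ + 1 - μ - 1 = γ - μ by ring]
    have h3 : (y : ℂ) ^ (γ - μ) = (y : ℂ) ^ (γ - μ - 1) * y := by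
      rw [← sub_add_cancel (γ - μ) 1, Complex.cpow_add _ _ hyc, Complex.cpow_one, sub_add_cancel]
    rw [h3]
    push_cast
    ring
  · rw [intervalIntegrable_iff_integrableOn_Ioc_of_le one_le_two]
    exact hi1.sub hi2

/-- The inhomogeneous term is the same as for `innerBeta`, so the difference of the two obeys a
homogeneous recurrence. Here that term comes from the binomial series at u = 1/2. -/
theorem outerBeta_add_one (μ : ℂ) {γ : ℂ} (hγ : ∀ n : ℤ, γ ≠ n) :
    (γ + 1) * outerBeta μ (γ + 1) = (γ - μ) * outerBeta μ γ + (2 : ℂ) ^ (γ - μ) := by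
  have hγ1 : ∀ n : ℤ, γ + 1 ≠ n := fun n h => hγ (n - 1) (by push_cast; linear_combination h)
  have h20 : (2 : ℂ) ≠ 0 := two_ne_zero
  have hb := hasSum_binomCoeff μ (u := 1 / 2) (by norm_num)
  have hb1 := (hasSum_nat_add_iff' 1).2 hb
  have h1 := (hasSum_nat_add_iff' 1).2 ((hasSum_outerBeta μ hγ1).mul_left (γ + 1))
  have h2 := (hasSum_outerBeta μ hγ).mul_left (γ - μ)
  have h3 := h2.add ((hb1.mul_left ((2 : ℂ) ^ (γ + 1))).sub (hb.mul_left ((2 : ℂ) ^ γ)))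
  have e : (fun k : ℕ => (γ + 1) * (binomCoeff μ (k + 1) *
      ((2 : ℂ) ^ (γ + 1 - (k + 1 : ℕ)) / (γ + 1 - (k + 1 : ℕ))))) = fun k : ℕ =>
      (γ - μ) * (binomCoeff μ k * ((2 : ℂ) ^ (γ - k) / (γ - k))) +
      ((2 : ℂ) ^ (γ + 1) * (binomCoeff μ (k + 1) * (1 / 2) ^ (k + 1)) -
        (2 : ℂ) ^ γ * (binomCoeff μ k * (1 / 2) ^ k)) := by
    funext k
    have hk := sub_natCast_ne_zero hγ k
    have hs := binomCoeff_succ μ k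
    have e1 : γ + 1 - ((k + 1 : ℕ) : ℂ) = γ - k := by push_cast; ring
    have e2 : (2 : ℂ) ^ (γ - k) = (2 : ℂ) ^ γ * (1 / 2) ^ k := by
      rw [Complex.cpow_sub _ _ h20, Complex.cpow_natCast, div_pow, one_pow]; ring
    rw [e1, e2, Complex.cpow_add _ _ h20, Complex.cpow_one, pow_succ]
    field_simp
    linear_combination hs
  rw [e] at h1
  have h4 := h1.unique h3
  simp only [Finset.range_one, Finset.sum_singleton, binomCoeff_zero] at h4
  have hγ10 : γ + 1 ≠ 0 := by simpa using hγ1 0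
  have e3 : (2 : ℂ) ^ (γ - μ) = 2 ^ γ * (1 - 1 / 2) ^ μ := by
    rw [show (1 : ℂ) - 1 / 2 = 2⁻¹ by norm_num, Complex.inv_cpow _ _ (by
      rw [show (2 : ℂ) = ((2 : ℝ) : ℂ) by norm_num, Complex.arg_ofReal_of_nonneg (by norm_num)]
      exact Real.pi_ne_zero.symm), Complex.cpow_sub _ _ h20]
    rfl
  rw [e3]
  have e4 : (2 : ℂ) ^ (γ + 1) = 2 ^ γ * 2 := by rw [Complex.cpow_add _ _ h20, Complex.cpow_one]
  simp only [Nat.cast_zero, sub_zero, one_mul, pow_zero, mul_one, e4] at h4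
  field_simp at h4
  norm_num at h4 ⊢
  linear_combination h4

/-- Substitute y = 1/x. -/
theorem integral_Ioi_one_eq_betaIntegral (μ γ : ℂ) :
    ∫ y in Set.Ioi (1 : ℝ), (y : ℂ) ^ (γ - μ - 1) * ((y : ℂ) - (1 : ℝ)) ^ μ =
      Complex.betaIntegral (-γ) (μ + 1) := by
  set G : ℝ → ℂ := (Set.Ioi (1 : ℝ)).indicator
    fun y => (y : ℂ) ^ (γ - μ - 1) * ((y : ℂ) - (1 : ℝ)) ^ μ with hG
  have h := integral_comp_rpow_Ioi G (p := -1) (by norm_num)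
  have h1 : ∫ y in Set.Ioi (0 : ℝ), G y =
      ∫ y in Set.Ioi (1 : ℝ), (y : ℂ) ^ (γ - μ - 1) * ((y : ℂ) - (1 : ℝ)) ^ μ := by
    rw [hG, setIntegral_indicator measurableSet_Ioi, Set.inter_eq_right.2
      (Set.Ioi_subset_Ioi zero_le_one)]
  have h2 : ∫ x in Set.Ioi (0 : ℝ), (|(-1 : ℝ)| * x ^ ((-1 : ℝ) - 1)) • G (x ^ (-1 : ℝ)) =
      ∫ x in Set.Ioi (0 : ℝ), (Set.Ioo (0 : ℝ) 1).indicator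
        (fun x => (x : ℂ) ^ (-γ - 1) * (1 - (x : ℂ)) ^ (μ + 1 - 1)) x := by
    refine setIntegral_congr_fun measurableSet_Ioi fun x hx => ?_
    have hx0 : 0 < x := hx
    have hxc : (x : ℂ) ≠ 0 := Complex.ofReal_ne_zero.2 hx0.ne'
    by_cases hx1 : x < 1
    · have hmem : x ^ (-1 : ℝ) ∈ Set.Ioi (1 : ℝ) := by
        rw [Real.rpow_neg_one]; exact (one_lt_inv₀ hx0).2 hx1
      have hmem2 : x ∈ Set.Ioo (0 : ℝ) 1 := ⟨hx0, hx1⟩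
      have e1 : ((x⁻¹ : ℝ) : ℂ) - (1 : ℝ) = ((x⁻¹ : ℝ) : ℂ) * ((1 - x : ℝ) : ℂ) := by
        push_cast; field_simp
      have e2 : ∀ w : ℂ, ((x⁻¹ : ℝ) : ℂ) ^ w = (x : ℂ) ^ (-w) := by
        intro w
        rw [Complex.ofReal_inv, Complex.inv_cpow _ _ (by
          rw [Complex.arg_ofReal_of_nonneg hx0.le]; exact Real.pi_ne_zero.symm), Complex.cpow_neg]
      have e3 : ((x ^ ((-1 : ℝ) - 1) : ℝ) : ℂ) = (x : ℂ) ^ (-2 : ℂ) := by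
        rw [Complex.ofReal_cpow hx0.le]; norm_num
      simp only [hG, Set.indicator_of_mem hmem, Set.indicator_of_mem hmem2]
      rw [Real.rpow_neg_one, e1, Complex.mul_cpow_ofReal_nonneg (inv_pos.2 hx0).le
        (sub_nonneg.2 hx1.le), e2, e2, abs_neg, abs_one, one_mul, Complex.real_smul, e3,
        show -γ - 1 = -2 + (-(γ - μ - 1) + -μ) by ring, Complex.cpow_add _ _ hxc,
        Complex.cpow_add _ _ hxc, add_sub_cancel_right]
      push_cast
      ring
    · have hmem : x ^ (-1 : ℝ) ∉ Set.Ioi (1 : ℝ) := by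
        rw [Real.rpow_neg_one, Set.mem_Ioi, not_lt]
        exact inv_le_one_of_one_le₀ (not_lt.1 hx1)
      have hmem2 : x ∉ Set.Ioo (0 : ℝ) 1 := fun h => hx1 h.2
      simp only [hG, Set.indicator_of_notMem hmem, Set.indicator_of_notMem hmem2, smul_zero]
  rw [← h1, ← h, h2, setIntegral_indicator measurableSet_Ioo,
    Set.inter_eq_right.2 Set.Ioo_subset_Ioi_self, Complex.betaIntegral,
    intervalIntegral.integral_of_le zero_le_one, integral_Ioc_eq_integral_Ioo]

theorem innerBeta_sub_outerBeta_of_re_neg {μ : ℂ} (hμ : -1 < μ.re) {γ : ℂ} (hγ : ∀ n : ℤ, γ ≠ n)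
    (hre : γ.re < 0) :
    innerBeta μ γ - outerBeta μ γ =
      Complex.Gamma (-γ) * Complex.Gamma (μ + 1) / Complex.Gamma (μ + 1 - γ) := by
  have hW : IntegrableOn (fun y : ℝ => (y : ℂ) ^ (γ - 1)) (Set.Ioi (2 * 1)) :=
    integrableOn_Ioi_cpow_of_lt (by simp; linarith) (by norm_num)
  obtain ⟨h1, h2⟩ := hasSum_integral_mul_one_sub_div_cpow one_pos μ hW
  have e : ∀ y ∈ Set.Ioi (2 * 1 : ℝ), (y : ℂ) ^ (γ - 1) * (1 - ((1 : ℝ) : ℂ) / y) ^ μ =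
      (y : ℂ) ^ (γ - μ - 1) * ((y : ℂ) - (1 : ℝ)) ^ μ := by
    intro y hy
    have hy' : 2 * 1 < y := hy
    rw [← cpow_mul_one_sub_div_cpow zero_le_one (by linarith)]
    ring_nf
  have h3 : ∫ y in Set.Ioi (2 : ℝ), (y : ℂ) ^ (γ - μ - 1) * ((y : ℂ) - (1 : ℝ)) ^ μ =
      -outerBeta μ γ := by
    rw [← mul_one (2 : ℝ), ← setIntegral_congr_fun measurableSet_Ioi e]
    refine h1.unique ?_
    convert! (hasSum_outerBeta μ hγ).neg using 1
    funext k
    have : ∫ y in Set.Ioi (2 * 1 : ℝ), (y : ℂ) ^ (-(k : ℂ)) * (y : ℂ) ^ (γ - 1) =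
        ∫ y in Set.Ioi (2 * 1 : ℝ), (y : ℂ) ^ (γ - k - 1) := by
      refine setIntegral_congr_fun measurableSet_Ioi fun y hy => ?_
      have hy' : 2 * 1 < y := hy
      have hy0 : (y : ℂ) ≠ 0 := Complex.ofReal_ne_zero.2 (by linarith)
      rw [← Complex.cpow_add _ _ hy0]
      ring_nf
    rw [this, integral_Ioi_cpow_of_lt (by
      simp only [Complex.sub_re, Complex.natCast_re, Complex.one_re]
      have : (0 : ℝ) ≤ k := k.cast_nonneg
      linarith) (by norm_num)]
    simp
    ring
  have h4 : IntegrableOn (fun y : ℝ => (y : ℂ) ^ (γ - μ - 1) * ((y : ℂ) - (1 : ℝ)) ^ μ)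
      (Set.Ioi 2) := by
    rw [← mul_one (2 : ℝ)]
    exact h2.congr_fun e measurableSet_Ioi
  have h5 := setIntegral_union (μ := volume) (Set.Ioc_disjoint_Ioi_same (a := (1 : ℝ)) (b := 2))
    measurableSet_Ioi (integrableOn_cpow_mul_sub_cpow (γ - μ - 1) hμ one_pos one_le_two) h4
  rw [Set.Ioc_union_Ioi_eq_Ioi one_le_two, h3, integral_Ioi_one_eq_betaIntegral] at h5
  have h6 := Complex.Gamma_mul_Gamma_eq_betaIntegral (s := -γ) (t := μ + 1)
    (by simpa using hre) (by simp; linarith)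
  have h7 : Complex.Gamma (μ + 1 - γ) ≠ 0 := by
    refine Complex.Gamma_ne_zero_of_re_pos ?_
    simp
    linarith
  rw [eq_div_iff h7, h6, show -γ + (μ + 1) = μ + 1 - γ by ring, h5, innerBeta]
  ring

/-- For Re γ < 0 the left side is the convergent Beta integral over (1, ∞). The homogeneous
recurrence shared by both sides moves the identity to the right in unit steps. -/
theorem innerBeta_sub_outerBeta {μ : ℂ} (hμ : -1 < μ.re) {γ : ℂ} (hγ : ∀ n : ℤ, γ ≠ n) :
    innerBeta μ γ - outerBeta μ γ =
      Complex.Gamma (-γ) * Complex.Gamma (μ + 1) / Complex.Gamma (μ + 1 - γ) := by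
  obtain ⟨n, hn⟩ := exists_nat_gt γ.re
  have hn' : γ.re - n < 0 := by linarith
  clear hn
  induction n generalizing γ with
  | zero => exact innerBeta_sub_outerBeta_of_re_neg hμ hγ (by simpa using hn')
  | succ n ih =>
    have hγ1 : ∀ n : ℤ, γ - 1 ≠ n := fun n h => hγ (n + 1) (by push_cast; linear_combination h)
    have hγ0 : γ ≠ 0 := by simpa using hγ 0
    have h := ih hγ1 (by
      simp only [Complex.sub_re, Complex.one_re]; push_cast at hn'; linarith)
    have h1 := innerBeta_add_one hμ (γ - 1)
    have h2 := outerBeta_add_one μ hγ1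
    rw [sub_add_cancel] at h1 h2
    have h3 : γ * (innerBeta μ γ - outerBeta μ γ) = (γ - 1 - μ) *
        (innerBeta μ (γ - 1) - outerBeta μ (γ - 1)) := by linear_combination h1 - h2
    refine mul_left_cancel₀ hγ0 ?_
    have h4 : Complex.Gamma (-(γ - 1)) = -γ * Complex.Gamma (-γ) := by
      rw [← Complex.Gamma_add_one _ (neg_ne_zero.2 hγ0)]
      ring_nf
    -- The reciprocal recurrence has no exceptional points, which matters because μ + 1 - γ may be a
    -- pole of Γ.
    have h5 := Complex.one_div_Gamma_eq_self_mul_one_div_Gamma_add_one (μ + 1 - γ)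
    rw [h3, h, h4, div_eq_mul_inv, div_eq_mul_inv, h5,
      show μ + 1 - (γ - 1) = μ + 1 - γ + 1 by ring]
    ring

/-! ### Small `s` expansion of the moments of the deformed weight -/

theorem re_add_one_pos {z : ℂ} (hz : -1 < z.re) : 0 < (z + 1).re := by
  simp; linarith

theorem ofReal_sub_cpow_of_lt {x s : ℝ} (h : x < s) (μ : ℂ) :
    ((x : ℂ) - s) ^ μ = Complex.exp (Real.pi * Complex.I * μ) * ((s : ℂ) - x) ^ μ := by
  rw [← Complex.ofReal_sub, Complex.ofReal_cpow_of_nonpos (sub_nonpos.2 h.le), mul_comm]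
  push_cast
  rw [neg_sub]

theorem setIntegral_Ioo_cpow_mul_sub_cpow (p μ : ℂ) {s : ℝ} (hs : 0 < s) :
    ∫ x in Set.Ioo 0 s, (x : ℂ) ^ p * ((x : ℂ) - s) ^ μ =
      Complex.exp (Real.pi * Complex.I * μ) *
        ((s : ℂ) ^ (p + μ + 1) * Complex.betaIntegral (p + 1) (μ + 1)) := by
  have h := Complex.betaIntegral_scaled (p + 1) (μ + 1) hs
  rw [intervalIntegral.integral_of_le hs.le, integral_Ioc_eq_integral_Ioo, add_sub_cancel_right,
    add_sub_cancel_right, show p + 1 + (μ + 1) - 1 = p + μ + 1 by ring] at h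
  rw [← h, ← integral_const_mul]
  refine setIntegral_congr_fun measurableSet_Ioo fun x hx => ?_
  simp only [ofReal_sub_cpow_of_lt hx.2]
  ring

theorem betaIntegral_ne_zero {u v : ℂ} (hu : 0 < u.re) (hv : 0 < v.re) :
    Complex.betaIntegral u v ≠ 0 := by
  intro h
  have h1 := Complex.Gamma_mul_Gamma_eq_betaIntegral hu hv
  rw [h, mul_zero] at h1
  exact mul_ne_zero (Complex.Gamma_ne_zero_of_re_pos hu) (Complex.Gamma_ne_zero_of_re_pos hv) h1

/-- A Bochner integral with non-zero value forces integrability, and the value is a non-vanishing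
multiple of a Beta integral. -/
theorem integrableOn_Ioo_cpow_mul_sub_cpow {p μ : ℂ} (hp : -1 < p.re) (hμ : -1 < μ.re) {s : ℝ}
    (hs : 0 < s) :
    IntegrableOn (fun x : ℝ => (x : ℂ) ^ p * ((x : ℂ) - s) ^ μ) (Set.Ioo 0 s) := by
  refine Integrable.of_integral_ne_zero ?_
  rw [setIntegral_Ioo_cpow_mul_sub_cpow p μ hs]
  refine mul_ne_zero (Complex.exp_ne_zero _) (mul_ne_zero ?_
    (betaIntegral_ne_zero (re_add_one_pos hp) (re_add_one_pos hμ)))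
  rw [Ne, Complex.cpow_eq_zero_iff]
  exact fun h => hs.ne' (Complex.ofReal_eq_zero.1 h.1)

theorem setIntegral_Ioc_cpow_mul_sub_cpow (p μ : ℂ) {s : ℝ} (hs : 0 < s) :
    ∫ x in Set.Ioc s (2 * s), (x : ℂ) ^ p * ((x : ℂ) - s) ^ μ =
      (s : ℂ) ^ (p + μ + 1) * innerBeta μ (p + μ + 1) := by
  have hsc : (s : ℂ) ≠ 0 := Complex.ofReal_ne_zero.2 hs.ne'
  have h := intervalIntegral.integral_comp_mul_left (a := 1) (b := 2)
    (fun x : ℝ => (x : ℂ) ^ p * ((x : ℂ) - s) ^ μ) hs.ne'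
  rw [mul_one, intervalIntegral.integral_of_le one_le_two,
    intervalIntegral.integral_of_le (by linarith), mul_comm s 2] at h
  have h1 : ∫ y in Set.Ioc (1 : ℝ) 2, ((s * y : ℝ) : ℂ) ^ p * (((s * y : ℝ) : ℂ) - s) ^ μ =
      (s : ℂ) ^ (p + μ) * innerBeta μ (p + μ + 1) := by
    rw [innerBeta, ← integral_const_mul]
    refine setIntegral_congr_fun measurableSet_Ioc fun y hy => ?_
    have hy0 : 0 ≤ y := zero_le_one.trans hy.1.le
    have e : ((s * y : ℝ) : ℂ) - s = (s : ℂ) * ((y - 1 : ℝ) : ℂ) := by push_cast; ring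
    rw [e, Complex.ofReal_mul, Complex.mul_cpow_ofReal_nonneg hs.le hy0,
      Complex.mul_cpow_ofReal_nonneg hs.le (sub_nonneg.2 hy.1.le), Complex.cpow_add _ _ hsc,
      show p + μ + 1 - μ - 1 = p by ring, Complex.ofReal_sub]
    ring
  rw [h1, Complex.real_smul] at h
  rw [Complex.cpow_add _ _ hsc, Complex.cpow_one]
  push_cast at h
  field_simp at h
  linear_combination -h

theorem pow_mul_cpow {x : ℝ} (hx : 0 < x) (m : ℕ) (p : ℂ) :
    (x : ℂ) ^ m * (x : ℂ) ^ p = (x : ℂ) ^ (p + m) := by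
  rw [Complex.cpow_add _ _ (Complex.ofReal_ne_zero.2 hx.ne'), Complex.cpow_natCast, mul_comm]

theorem hasSum_integral_Ioo {p μ : ℂ} (hp : -1 < p.re) (hμ : -1 < μ.re) {s : ℝ} (hs : 0 < s) :
    HasSum (fun m : ℕ => (-1) ^ m / (m.factorial : ℂ) *
        (Complex.exp (Real.pi * Complex.I * μ) *
          Complex.betaIntegral (p + m + 1) (μ + 1)) * (s : ℂ) ^ m * (s : ℂ) ^ (p + μ + 1))
      (∫ x in Set.Ioo 0 s, (x : ℂ) ^ p * ((x : ℂ) - s) ^ μ * Complex.exp (-(x : ℂ))) := by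
  have h := hasSum_integral_mul_exp (R := s) measurableSet_Ioo
    (fun x hx => by rw [abs_of_pos hx.1]; exact hx.2.le)
    (integrableOn_Ioo_cpow_mul_sub_cpow hp hμ hs)
  convert! h using 1
  funext m
  have e : ∫ x in Set.Ioo 0 s, (x : ℂ) ^ m * ((x : ℂ) ^ p * ((x : ℂ) - s) ^ μ) =
      ∫ x in Set.Ioo 0 s, (x : ℂ) ^ (p + m) * ((x : ℂ) - s) ^ μ := by
    refine setIntegral_congr_fun measurableSet_Ioo fun x hx => ?_
    simp only [← mul_assoc, pow_mul_cpow hx.1]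
  rw [e, setIntegral_Ioo_cpow_mul_sub_cpow _ _ hs,
    show p + (m : ℂ) + μ + 1 = p + μ + 1 + m by ring, ← pow_mul_cpow hs m]
  ring

theorem hasSum_integral_Ioc {p μ : ℂ} (hμ : -1 < μ.re) {s : ℝ} (hs : 0 < s) :
    HasSum (fun m : ℕ => (-1) ^ m / (m.factorial : ℂ) * innerBeta μ (p + μ + 1 + m) *
        (s : ℂ) ^ m * (s : ℂ) ^ (p + μ + 1))
      (∫ x in Set.Ioc s (2 * s), (x : ℂ) ^ p * ((x : ℂ) - s) ^ μ * Complex.exp (-(x : ℂ))) := by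
  have h := hasSum_integral_mul_exp (R := 2 * s) measurableSet_Ioc
    (fun x hx => by rw [abs_of_pos (hs.trans hx.1)]; exact hx.2)
    (integrableOn_cpow_mul_sub_cpow p hμ hs (by linarith))
  convert! h using 1
  funext m
  have e : ∫ x in Set.Ioc s (2 * s), (x : ℂ) ^ m * ((x : ℂ) ^ p * ((x : ℂ) - s) ^ μ) =
      ∫ x in Set.Ioc s (2 * s), (x : ℂ) ^ (p + m) * ((x : ℂ) - s) ^ μ := by
    refine setIntegral_congr_fun measurableSet_Ioc fun x hx => ?_
    simp only [← mul_assoc, pow_mul_cpow (hs.trans hx.1)]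
  rw [e, setIntegral_Ioc_cpow_mul_sub_cpow _ _ hs,
    show p + (m : ℂ) + μ + 1 = p + μ + 1 + m by ring, ← pow_mul_cpow hs m]
  ring

/-- Two orders of summation of one absolutely convergent double series, over the binomial index and
the exponential index. -/
theorem exists_hasSum_lowerSeries_outerBeta (μ : ℂ) {β : ℂ} (hβ : ∀ n : ℤ, β ≠ n) (s : ℂ) :
    ∃ V : ℂ, HasSum (fun k : ℕ => binomCoeff μ k * 2 ^ (β - k) * lowerSeries (β - k) (2 * s)) V ∧
      HasSum (fun m : ℕ => (-1) ^ m / (m.factorial : ℂ) * outerBeta μ (β + m) * s ^ m) V := by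
  obtain ⟨δ, hδ, h⟩ := exists_pos_le_norm_sub_add_nat hβ
  obtain ⟨T, hT⟩ : ∃ T : ℕ × ℕ → ℂ, ∀ k j, T (k, j) = binomCoeff μ k * 2 ^ (β - k) *
    ((-1) ^ j / (j.factorial : ℂ) * (2 * s) ^ j / (β - k + j)) := 
    ⟨fun q => binomCoeff μ q.1 * 2 ^ (β - q.1) *
      ((-1) ^ q.2 / (q.2.factorial : ℂ) * (2 * s) ^ q.2 / (β - q.1 + q.2)), fun _ _ => rfl⟩
  have h2 : ∀ k : ℕ, ‖(2 : ℂ) ^ (β - k)‖ = 2 ^ β.re * (1 / 2) ^ k := by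
    intro k
    have := Complex.norm_cpow_eq_rpow_re_of_pos (x := 2) (by norm_num) (β - k)
    rw [Complex.ofReal_ofNat] at this
    rw [this, Complex.sub_re, Complex.natCast_re, Real.rpow_sub (by norm_num), Real.rpow_natCast]
    simp [div_eq_mul_inv]
  have hsum : Summable T := by
    have hs1 : Summable fun k => ‖binomCoeff μ k‖ * (1 / 2) ^ k * (2 : ℝ) ^ β.re :=
      (summable_norm_binomCoeff μ (r := 1 / 2) (by norm_num) (by norm_num)).mul_right _
    have hs2 : Summable fun m : ℕ => ‖2 * s‖ ^ m / m.factorial * δ⁻¹ :=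
      (Real.summable_pow_div_factorial ‖2 * s‖).mul_right δ⁻¹
    have hs3 : Summable fun q : ℕ × ℕ => (‖binomCoeff μ q.1‖ * (1 / 2) ^ q.1 * (2 : ℝ) ^ β.re) *
        (‖2 * s‖ ^ q.2 / q.2.factorial * δ⁻¹) :=
      Summable.mul_of_nonneg hs1 hs2 (fun k => by positivity) (fun m => by positivity)
    refine Summable.of_norm_bounded hs3 fun q => ?_
    obtain ⟨k, j⟩ := q
    have h3 := norm_lowerSeries_term_le hδ (h k) (2 * s) j
    rw [hT, norm_mul, norm_mul, h2]
    calc _ = ‖binomCoeff μ k‖ * (1 / 2) ^ k * 2 ^ β.re *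
          ‖(-1) ^ j / (j.factorial : ℂ) * (2 * s) ^ j / (β - k + j)‖ := by ring
      _ ≤ _ := by gcongr
  have hsum' : HasSum (fun q : ℕ × ℕ => T (q.2, q.1)) (∑' q, T q) :=
    (Equiv.prodComm ℕ ℕ).hasSum_iff.2 hsum.hasSum
  have hrow : ∀ k : ℕ, HasSum (fun j : ℕ => T (k, j))
      (binomCoeff μ k * 2 ^ (β - k) * lowerSeries (β - k) (2 * s)) := by
    intro k
    simp only [hT]
    refine (hasSum_lowerSeries (fun n hn => hβ (n + k) ?_) (2 * s)).mul_left _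
    push_cast
    linear_combination hn
  have hcol : ∀ m : ℕ, HasSum (fun k : ℕ => T (k, m))
      ((-1) ^ m / (m.factorial : ℂ) * outerBeta μ (β + m) * s ^ m) := by
    intro m
    have hβm : ∀ n : ℤ, β + m ≠ n := fun n hn => hβ (n - m) (by
      push_cast; linear_combination hn)
    have h3 := (hasSum_outerBeta μ hβm).mul_left ((-1) ^ m / (m.factorial : ℂ) * s ^ m)
    have e1 : (fun k : ℕ => (-1) ^ m / (m.factorial : ℂ) * s ^ m *
        (binomCoeff μ k * ((2 : ℂ) ^ (β + m - k) / (β + m - k)))) = fun k => T (k, m) := by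
      funext k
      have e : (2 : ℂ) ^ (β + m - k) = 2 ^ (β - k) * 2 ^ m := by
        rw [show β + m - (k : ℂ) = β - k + m by ring, Complex.cpow_add _ _ two_ne_zero,
          Complex.cpow_natCast]
      simp only [hT]
      rw [e, show β + m - (k : ℂ) = β - k + m by ring, mul_pow]
      ring
    rw [e1] at h3
    rwa [show (-1) ^ m / (m.factorial : ℂ) * outerBeta μ (β + m) * s ^ m =
      (-1) ^ m / (m.factorial : ℂ) * s ^ m * outerBeta μ (β + m) by ring]
  exact ⟨∑' q, T q, HasSum.prod_fiberwise hsum.hasSum hrow, HasSum.prod_fiberwise hsum' hcol⟩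

/-- The k-th binomial term is an upper incomplete Gamma function at 2s. Its lower part carries
(2s)^{β-k} s^k = 2^{β-k} s^β with β = p + μ + 1, so a single power of s factors out of all
corrections. -/
theorem integral_Ioi_two_mul {p μ : ℂ} (hβ : ∀ n : ℤ, p + μ + 1 ≠ n) {s : ℝ} (hs : 0 < s) :
    ∃ V : ℂ,
      HasSum (fun m : ℕ => (-1) ^ m / (m.factorial : ℂ) * outerBeta μ (p + μ + 1 + m) *
        (s : ℂ) ^ m) V ∧
      HasSum (fun k : ℕ => binomCoeff μ k * Complex.Gamma (p + μ + 1 - k) * (s : ℂ) ^ k)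
        ((∫ x in Set.Ioi (2 * s), (x : ℂ) ^ p * ((x : ℂ) - s) ^ μ * Complex.exp (-(x : ℂ))) +
          (s : ℂ) ^ (p + μ + 1) * V) ∧
      IntegrableOn (fun x : ℝ => (x : ℂ) ^ p * ((x : ℂ) - s) ^ μ * Complex.exp (-(x : ℂ)))
        (Set.Ioi (2 * s)) := by
  have h2s : 0 < 2 * s := by linarith
  have hsc : (s : ℂ) ≠ 0 := Complex.ofReal_ne_zero.2 hs.ne'
  obtain ⟨V, hV1, hV2⟩ := exists_hasSum_lowerSeries_outerBeta μ hβ s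
  obtain ⟨h1, h2⟩ := hasSum_integral_mul_one_sub_div_cpow hs μ
    (integrableOn_Ioi_cpow_mul_exp (p + μ) h2s)
  have e : ∀ x ∈ Set.Ioi (2 * s), (x : ℂ) ^ (p + μ) * Complex.exp (-(x : ℂ)) *
      (1 - (s : ℂ) / x) ^ μ = (x : ℂ) ^ p * ((x : ℂ) - s) ^ μ * Complex.exp (-(x : ℂ)) := by
    intro x hx
    have hx' : 2 * s < x := hx
    rw [← cpow_mul_one_sub_div_cpow hs.le (by linarith)]
    ring
  refine ⟨V, hV2, ?_, h2.congr_fun e measurableSet_Ioi⟩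
  rw [← setIntegral_congr_fun measurableSet_Ioi e]
  convert! h1.add (hV1.mul_left ((s : ℂ) ^ (p + μ + 1))) using 1
  funext k
  have hz : ∀ n : ℤ, p + μ + 1 - k ≠ n := fun n hn => hβ (n + k) (by
    push_cast; linear_combination hn)
  have e1 : ∫ x in Set.Ioi (2 * s), (x : ℂ) ^ (-(k : ℂ)) *
      ((x : ℂ) ^ (p + μ) * Complex.exp (-(x : ℂ))) =
      ∫ x in Set.Ioi (2 * s), (x : ℂ) ^ (p + μ + 1 - k - 1) * Complex.exp (-(x : ℂ)) := by
    refine setIntegral_congr_fun measurableSet_Ioi fun x hx => ?_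
    have hx0 : (x : ℂ) ≠ 0 := Complex.ofReal_ne_zero.2 (h2s.trans hx).ne'
    rw [← mul_assoc, ← Complex.cpow_add _ _ hx0]
    ring_nf
  have e2 : ((2 * s : ℝ) : ℂ) ^ (p + μ + 1 - k) * (s : ℂ) ^ k =
      2 ^ (p + μ + 1 - k) * (s : ℂ) ^ (p + μ + 1) := by
    rw [Complex.ofReal_mul, Complex.mul_cpow_ofReal_nonneg zero_le_two hs.le, mul_assoc,
      mul_comm _ ((s : ℂ) ^ k), pow_mul_cpow hs, sub_add_cancel]
    simp
  rw [e1, integral_Ioi_cpow_mul_exp hz h2s]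
  have e3 : ((2 * s : ℝ) : ℂ) = 2 * (s : ℂ) := by push_cast; ring
  rw [e3] at e2 ⊢
  linear_combination binomCoeff μ k * lowerSeries (p + μ + 1 - k) (2 * s) * e2

/-- The deformed Laguerre weight `(1 - ξ χ_{(0,s)}(x)) (x - s)^μ x^p e^{-x}`. -/
def deformedWeight (p μ ξ : ℂ) (s x : ℝ) : ℂ :=
  ((1 - ξ * (Set.Ioo 0 s).indicator (fun _ => (1 : ℂ)) x) * ((x : ℂ) - (s : ℂ)) ^ μ) *
    ((x : ℂ) ^ p * Complex.exp (-(x : ℂ)))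

/-- Sum of the contributions of (0, s), (s, 2s) and (2s, ∞). Only the first sees ξ and the phase
e^{πiμ}; the regular series comes entirely from the last. -/
theorem integral_deformedWeight {p μ : ℂ} (ξ : ℂ) (hp : -1 < p.re) (hμ : -1 < μ.re)
    (hβ : ∀ n : ℤ, p + μ + 1 ≠ n) {s : ℝ} (hs : 0 < s) :
    IntegrableOn (deformedWeight p μ ξ s) (Set.Ioi 0) ∧
    ∃ A B : ℂ,
      HasSum (fun k : ℕ => binomCoeff μ k * Complex.Gamma (p + μ + 1 - k) * (s : ℂ) ^ k) A ∧
      HasSum (fun m : ℕ => (-1) ^ m / (m.factorial : ℂ) *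
        ((1 - ξ) * Complex.exp (Real.pi * Complex.I * μ) *
            Complex.betaIntegral (p + m + 1) (μ + 1) +
          (innerBeta μ (p + μ + 1 + m) - outerBeta μ (p + μ + 1 + m))) * (s : ℂ) ^ m) B ∧
      ∫ x in Set.Ioi 0, deformedWeight p μ ξ s x = A + (s : ℂ) ^ (p + μ + 1) * B := by
  have hsc : (s : ℂ) ^ (p + μ + 1) ≠ 0 := by
    rw [Ne, Complex.cpow_eq_zero_iff]
    exact fun h => hs.ne' (Complex.ofReal_eq_zero.1 h.1)
  set g : ℝ → ℂ := fun x => (x : ℂ) ^ p * ((x : ℂ) - s) ^ μ * Complex.exp (-(x : ℂ)) with hg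
  obtain ⟨V, hV, hA, hi3⟩ := integral_Ioi_two_mul hβ hs
  have h1 := hasSum_integral_Ioo hp hμ hs
  have h2 := hasSum_integral_Ioc (p := p) hμ hs
  have hexp : ∀ {t : ℝ} {S : Set ℝ}, (∀ x ∈ S, x ∈ Set.Icc 0 t) → MeasurableSet S →
      IntegrableOn (fun x : ℝ => (x : ℂ) ^ p * ((x : ℂ) - s) ^ μ) S → IntegrableOn g S := by
    intro t S hS hSm hi
    refine Integrable.mono' hi.norm
      (hi.aestronglyMeasurable.mul (Measurable.aestronglyMeasurable (by fun_prop)))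
      ((ae_restrict_iff' hSm).2 (ae_of_all _ fun x hx => ?_))
    have : ‖Complex.exp (-(x : ℂ))‖ ≤ 1 := by
      rw [Complex.norm_exp]
      simpa using (hS x hx).1
    simp only [hg]
    rw [norm_mul _ (Complex.exp _)]
    exact mul_le_of_le_one_right (norm_nonneg _) this
  have hi1 : IntegrableOn g (Set.Ioo 0 s) := hexp (t := s) (fun x hx => ⟨hx.1.le, hx.2.le⟩)
    measurableSet_Ioo (integrableOn_Ioo_cpow_mul_sub_cpow hp hμ hs)
  have hi2 : IntegrableOn g (Set.Ioc s (2 * s)) :=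
    hexp (t := 2 * s) (fun x hx => ⟨(hs.trans hx.1).le, hx.2⟩)
      measurableSet_Ioc (integrableOn_cpow_mul_sub_cpow p hμ hs (by linarith))
  have hle : s ≤ 2 * s := by linarith
  have hi23 : IntegrableOn g (Set.Ioi s) := by
    rw [← Set.Ioc_union_Ioi_eq_Ioi hle]
    exact hi2.union hi3
  have hw1 : ∀ x ∈ Set.Ioo 0 s, (1 - ξ) * g x = deformedWeight p μ ξ s x := by
    intro x hx
    simp only [deformedWeight, Set.indicator_of_mem hx, hg]
    ring
  have hw2 : ∀ x ∈ Set.Ioi s, g x = deformedWeight p μ ξ s x := by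
    intro x hx
    have : x ∉ Set.Ioo 0 s := fun h => lt_asymm h.2 hx
    simp only [deformedWeight, Set.indicator_of_notMem this, hg]
    ring
  have hj1 : IntegrableOn (deformedWeight p μ ξ s) (Set.Ioo 0 s) :=
    IntegrableOn.congr_fun (hi1.const_mul (1 - ξ)) hw1 measurableSet_Ioo
  have hj1' : IntegrableOn (deformedWeight p μ ξ s) (Set.Ioc 0 s) := by
    rwa [integrableOn_Ioc_iff_integrableOn_Ioo]
  have hj2 : IntegrableOn (deformedWeight p μ ξ s) (Set.Ioi s) :=
    hi23.congr_fun hw2 measurableSet_Ioi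
  have hsplit : ∫ x in Set.Ioi 0, deformedWeight p μ ξ s x =
      (1 - ξ) * (∫ x in Set.Ioo 0 s, g x) +
        ((∫ x in Set.Ioc s (2 * s), g x) + ∫ x in Set.Ioi (2 * s), g x) := by
    rw [← Set.Ioc_union_Ioi_eq_Ioi hs.le, setIntegral_union Set.Ioc_disjoint_Ioi_same
      measurableSet_Ioi hj1' hj2, integral_Ioc_eq_integral_Ioo,
      ← setIntegral_congr_fun measurableSet_Ioo hw1, integral_const_mul,
      ← setIntegral_congr_fun measurableSet_Ioi hw2, ← Set.Ioc_union_Ioi_eq_Ioi hle,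
      setIntegral_union Set.Ioc_disjoint_Ioi_same measurableSet_Ioi hi2 hi3]
  refine ⟨?_, _, ((s : ℂ) ^ (p + μ + 1))⁻¹ * ((1 - ξ) * (∫ x in Set.Ioo 0 s, g x) +
    ∫ x in Set.Ioc s (2 * s), g x) - V, hA, ?_, ?_⟩
  · rw [← Set.Ioc_union_Ioi_eq_Ioi hs.le]
    exact hj1'.union hj2
  · convert! (((h1.mul_left (1 - ξ)).add h2).mul_left ((s : ℂ) ^ (p + μ + 1))⁻¹).sub hV using 1
    funext m
    field_simp
    ring
  · rw [hsplit]
    field_simp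
    ring

/-! ### The moments and the finite `N` structure -/

/-- The amplitude of the non-analytic terms. -/
def edgeConst (a μ ξ : ℂ) : ℂ :=
  (1 - ξ) * Complex.exp (Real.pi * Complex.I * μ) -
    Complex.sin (Real.pi * a) / Complex.sin (Real.pi * (μ + a))

theorem sin_pi_mul_ne_zero {z : ℂ} (hz : ∀ n : ℤ, z ≠ n) : Complex.sin (Real.pi * z) ≠ 0 := by
  rw [Complex.sin_ne_zero_iff]
  intro n h
  refine hz n (mul_left_cancel₀ (Complex.ofReal_ne_zero.2 Real.pi_ne_zero) ?_)
  rw [h, mul_comm]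

theorem sin_pi_mul_add_nat (z : ℂ) (n : ℕ) :
    Complex.sin (Real.pi * (z + n)) = (-1) ^ n * Complex.sin (Real.pi * z) := by
  induction n with
  | zero => simp
  | succ n ih =>
    rw [show (Real.pi : ℂ) * (z + (n + 1 : ℕ)) = Real.pi * (z + n) + Real.pi by push_cast; ring,
      Complex.sin_add_pi, ih, pow_succ]
    ring

/-- The reflection formula in reciprocal form, so that q ∈ ℕ is included, where both sides are zero.
-/
theorem inv_Gamma_neg {q : ℂ} (hq : 0 < (q + 1).re) :
    (Complex.Gamma (-q))⁻¹ = -Complex.sin (Real.pi * q) * Complex.Gamma (q + 1) / Real.pi := by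
  have h := Complex.Gamma_mul_Gamma_one_sub (-q)
  have h1 : Complex.Gamma (q + 1) ≠ 0 := Complex.Gamma_ne_zero_of_re_pos hq
  rw [sub_neg_eq_add, add_comm 1 q] at h
  rw [eq_div_of_mul_eq h1 h, inv_div, mul_neg, Complex.sin_neg, div_div_eq_mul_div]
  ring

/-- Reflection turns both Gamma factors at negative arguments into sines. The signs (-1)^j and
(-1)^{j+1} from the integer shifts leave -1 for every j, so the ratio of sines is common to all
moments. -/
theorem innerBeta_sub_outerBeta_eq_betaIntegral {a μ : ℂ} (ha : -1 < a.re) (hμ : -1 < μ.re)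
    (hα : ∀ n : ℤ, μ + a ≠ n) (j : ℕ) :
    innerBeta μ (a + j + μ + 1) - outerBeta μ (a + j + μ + 1) =
      -(Complex.sin (Real.pi * a) / Complex.sin (Real.pi * (μ + a))) *
        Complex.betaIntegral (a + j + 1) (μ + 1) := by
  have hγ : ∀ n : ℤ, a + j + μ + 1 ≠ n := fun n h => hα (n - 1 - j) (by
    push_cast; linear_combination h)
  have hj0 : (0 : ℝ) ≤ j := j.cast_nonneg
  have hq : 0 < (a + j + 1).re := by simp; linarith
  have hγre : 0 < (a + j + μ + 1 + 1).re := by simp; linarith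
  have hs := sin_pi_mul_ne_zero hα
  rw [innerBeta_sub_outerBeta hμ hγ, show μ + 1 - (a + j + μ + 1) = -(a + j) by ring,
    div_eq_mul_inv, inv_Gamma_neg hq]
  have h1 := Complex.Gamma_mul_Gamma_eq_betaIntegral hq (re_add_one_pos hμ)
  have h2 := Complex.Gamma_mul_Gamma_one_sub (-(a + j + μ + 1))
  rw [show (1 : ℂ) - -(a + j + μ + 1) = a + j + μ + 1 + 1 by ring, mul_neg, Complex.sin_neg,
    show a + j + μ + 1 = (μ + a) + ((j + 1 : ℕ) : ℂ) by push_cast; ring, sin_pi_mul_add_nat] at h2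
  rw [show a + j + 1 + (μ + 1) = a + j + μ + 1 + 1 by ring] at h1
  rw [show a + j + μ + 1 + 1 = μ + a + ((j + 1 : ℕ) : ℂ) + 1 by push_cast; ring] at h1 hγre
  have h3 : Complex.Gamma (μ + a + ((j + 1 : ℕ) : ℂ) + 1) ≠ 0 :=
    Complex.Gamma_ne_zero_of_re_pos hγre
  have h4 : Complex.betaIntegral (a + j + 1) (μ + 1) = Complex.Gamma (a + j + 1) *
      Complex.Gamma (μ + 1) / Complex.Gamma (μ + a + ((j + 1 : ℕ) : ℂ) + 1) := by
    rw [h1]; field_simp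
  rw [h4, sin_pi_mul_add_nat, show a + j + μ + 1 = (μ + a) + ((j + 1 : ℕ) : ℂ) by push_cast; ring,
    eq_div_of_mul_eq h3 h2, pow_succ]
  have hpi : (Real.pi : ℂ) ≠ 0 := Complex.ofReal_ne_zero.2 Real.pi_ne_zero
  have hj1 : ((-1 : ℂ)) ^ j ≠ 0 := pow_ne_zero _ (by norm_num)
  field_simp

/-- The part of the `n`-th moment that is analytic at `s = 0`. -/
def regularMoment (a μ : ℂ) (n : ℕ) (z : ℂ) : ℂ :=
  ∑' k : ℕ, binomCoeff μ k * Complex.Gamma (a + n + μ + 1 - k) * z ^ k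

/-- The confluent hypergeometric factor `∫₀¹ v^{a+n} (1-v)^μ e^{-zv} dv` of the non-analytic part of
the `n`-th moment. -/
def singularMoment (a μ : ℂ) (n : ℕ) (z : ℂ) : ℂ :=
  ∑' m : ℕ, (-1) ^ m / (m.factorial : ℂ) * Complex.betaIntegral (a + n + m + 1) (μ + 1) * z ^ m

section

variable {a μ : ℂ}

theorem not_int_of_not_nat (hμa : -1 < (μ + a).re) (hgen : ∀ n : ℕ, μ + a ≠ n) (n : ℤ) :
    μ + a ≠ n := by
  intro h
  rw [h] at hμa
  simp only [Complex.intCast_re] at hμa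
  have h0 : (-1 : ℤ) < n := by exact_mod_cast hμa
  obtain ⟨m, rfl⟩ := Int.eq_ofNat_of_zero_le (by omega : 0 ≤ n)
  exact hgen m (by simpa using h)

theorem re_add_nat (ha : -1 < a.re) (n : ℕ) : -1 < (a + n).re := by
  have : (0 : ℝ) ≤ n := n.cast_nonneg
  simp; linarith

theorem not_int_shift (hα : ∀ n : ℤ, μ + a ≠ n) (j : ℕ) (n : ℤ) : a + j + μ + 1 ≠ n :=
  fun h => hα (n - 1 - j) (by push_cast; linear_combination h)

theorem summable_regularMoment (ha : -1 < a.re) (hμ : -1 < μ.re) (hα : ∀ n : ℤ, μ + a ≠ n)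
    (n : ℕ) {s : ℝ} (hs : 0 < s) : Summable fun k : ℕ =>
      binomCoeff μ k * Complex.Gamma (a + n + μ + 1 - k) * (s : ℂ) ^ k := by
  obtain ⟨-, A, -, hA, -⟩ := integral_deformedWeight 0 (re_add_nat ha n) hμ (not_int_shift hα n) hs
  exact hA.summable

theorem summable_singularMoment (ha : -1 < a.re) (hμ : -1 < μ.re) (n : ℕ) {s : ℝ} (hs : 0 < s) :
    Summable fun m : ℕ => (-1) ^ m / (m.factorial : ℂ) *
      Complex.betaIntegral (a + n + m + 1) (μ + 1) * (s : ℂ) ^ m := by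
  have h := (hasSum_integral_Ioo (re_add_nat ha n) hμ hs).summable
  have hsc : (s : ℂ) ^ (a + n + μ + 1) ≠ 0 := by
    rw [Ne, Complex.cpow_eq_zero_iff]
    exact fun h => hs.ne' (Complex.ofReal_eq_zero.1 h.1)
  have he := Complex.exp_ne_zero (Real.pi * Complex.I * μ)
  refine (h.mul_left (Complex.exp (Real.pi * Complex.I * μ) * (s : ℂ) ^ (a + n + μ + 1))⁻¹).congr
    fun m => ?_
  field_simp

/-- The factor x^n is absorbed into the exponent, p = a + n. The singular power then splits as
s^{μ+a+1} s^n, and the extra s^n is why only the corner of the singular matrix survives at s = 0. -/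
theorem moment_deformedWeight (ξ : ℂ) (ha : -1 < a.re) (hμ : -1 < μ.re)
    (hα : ∀ n : ℤ, μ + a ≠ n) (n : ℕ) {s : ℝ} (hs : 0 < s) :
    IntegrableOn (fun x : ℝ => (x : ℂ) ^ n * deformedWeight a μ ξ s x) (Set.Ioi 0) ∧
    ∫ x in Set.Ioi (0 : ℝ), (x : ℂ) ^ n * deformedWeight a μ ξ s x =
      regularMoment a μ n s + (s : ℂ) ^ (μ + a + 1) *
        (edgeConst a μ ξ * ((s : ℂ) ^ n * singularMoment a μ n s)) := by
  obtain ⟨hi, A, B, hA, hB, hAB⟩ := integral_deformedWeight ξ (re_add_nat ha n) hμ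
    (not_int_shift hα n) hs
  have e : ∀ x ∈ Set.Ioi (0 : ℝ), deformedWeight (a + n) μ ξ s x =
      (x : ℂ) ^ n * deformedWeight a μ ξ s x := by
    intro x hx
    simp only [deformedWeight]
    rw [← pow_mul_cpow hx]
    ring
  refine ⟨hi.congr_fun e measurableSet_Ioi, ?_⟩
  have hA' : A = regularMoment a μ n s := hA.tsum_eq.symm
  rw [← setIntegral_congr_fun measurableSet_Ioi e, hAB, hA']
  have hB' : HasSum (fun m : ℕ => edgeConst a μ ξ * ((-1) ^ m / (m.factorial : ℂ) *
      Complex.betaIntegral (a + n + m + 1) (μ + 1) * (s : ℂ) ^ m)) B := by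
    convert! hB using 1
    funext m
    have h := innerBeta_sub_outerBeta_eq_betaIntegral ha hμ hα (n + m)
    rw [show a + ((n + m : ℕ) : ℂ) = a + n + m by push_cast; ring] at h
    rw [show a + n + μ + 1 + (m : ℂ) = a + n + m + μ + 1 by ring, h, edgeConst]
    ring
  rw [hB'.unique ((summable_singularMoment ha hμ n hs).hasSum.mul_left (edgeConst a μ ξ)),
    show a + n + μ + 1 = μ + a + 1 + (n : ℂ) by ring, ← pow_mul_cpow hs n]
  simp only [singularMoment]
  ring

theorem analyticAt_regularMoment (ha : -1 < a.re) (hμ : -1 < μ.re) (hα : ∀ n : ℤ, μ + a ≠ n)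
    (n : ℕ) : AnalyticAt ℂ (regularMoment a μ n) 0 :=
  analyticAt_tsum one_pos (summable_regularMoment ha hμ hα n one_pos)

theorem analyticAt_singularMoment (ha : -1 < a.re) (hμ : -1 < μ.re) (n : ℕ) :
    AnalyticAt ℂ (singularMoment a μ n) 0 :=
  analyticAt_tsum one_pos (summable_singularMoment ha hμ n one_pos)

theorem regularMoment_zero (n : ℕ) :
    regularMoment a μ n 0 = Complex.Gamma (n + (μ + a + 1)) := by
  rw [regularMoment, tsum_mul_zero_pow, binomCoeff_zero, Nat.cast_zero]
  ring_nf

theorem deriv_regularMoment_zero (ha : -1 < a.re) (hμ : -1 < μ.re) (hα : ∀ n : ℤ, μ + a ≠ n)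
    (n : ℕ) : deriv (regularMoment a μ n) 0 = -μ * Complex.Gamma (n + (μ + a)) := by
  have h := deriv_tsum_zero one_pos (summable_regularMoment ha hμ hα n one_pos)
  rw [binomCoeff_one, Nat.cast_one, show a + n + μ + 1 - 1 = n + (μ + a) by ring] at h
  exact h

theorem singularMoment_zero (n : ℕ) :
    singularMoment a μ n 0 = Complex.betaIntegral (a + n + 1) (μ + 1) := by
  rw [singularMoment, tsum_mul_zero_pow]
  simp

/-- The Hankel matrix of the analytic parts of the moments. -/
def regularMatrix (N : ℕ) (a μ z : ℂ) : Matrix (Fin N) (Fin N) ℂ :=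
  Matrix.of fun j k => regularMoment a μ ((j : ℕ) + k) z

/-- The Hankel matrix of the non-analytic parts of the moments, divided by `s^{μ+a+1}`. -/
def singularMatrix (N : ℕ) (a μ ξ z : ℂ) : Matrix (Fin N) (Fin N) ℂ :=
  Matrix.of fun j k => edgeConst a μ ξ *
    (z ^ ((j : ℕ) + (k : ℕ)) * singularMoment a μ ((j : ℕ) + k) z)

theorem lueNorm_ne_zero {b : ℂ} (hb : -1 < b.re) (N : ℕ) : lueNorm N b ≠ 0 := by
  refine Finset.prod_ne_zero_iff.2 fun j _ => mul_ne_zero ?_ ?_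
  · refine Complex.Gamma_ne_zero_of_re_pos ?_
    simp; positivity
  · refine Complex.Gamma_ne_zero_of_re_pos ?_
    have : (0 : ℝ) ≤ j := j.cast_nonneg
    simp; linarith

theorem det_gammaHankel_add_one {b : ℂ} (hb : -1 < b.re) (N : ℕ) :
    (gammaHankel N (b + 1)).det = lueNorm N b := by
  rw [det_gammaHankel N (re_add_one_pos hb), lueNorm]
  simp only [add_assoc]

theorem integral_lueWeight (ha : -1 < a.re) (N : ℕ) :
    ∫ x, lueWeight N a x ∂orthantMeasure N = (N.factorial : ℂ) * lueNorm N a := by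
  have hΓ : ∀ n : ℕ, IntegrableOn (fun x : ℝ => (x : ℂ) ^ n *
      ((x : ℂ) ^ a * Complex.exp (-(x : ℂ)))) (Set.Ioi 0) ∧
      ∫ x in Set.Ioi (0 : ℝ), (x : ℂ) ^ n * ((x : ℂ) ^ a * Complex.exp (-(x : ℂ))) =
        Complex.Gamma (n + (a + 1)) := by
    intro n
    have hre := re_add_one_pos (re_add_nat ha n)
    have e : ∀ x ∈ Set.Ioi (0 : ℝ), ((Real.exp (-x) : ℝ) : ℂ) * (x : ℂ) ^ (a + n + 1 - 1) =
        (x : ℂ) ^ n * ((x : ℂ) ^ a * Complex.exp (-(x : ℂ))) := by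
      intro x hx
      rw [← mul_assoc, pow_mul_cpow hx, add_sub_cancel_right]
      push_cast
      ring
    refine ⟨(Complex.GammaIntegral_convergent hre).congr_fun e measurableSet_Ioi, ?_⟩
    rw [← setIntegral_congr_fun measurableSet_Ioi e, show (n : ℂ) + (a + 1) = a + n + 1 by ring,
      Complex.Gamma_eq_integral hre, Complex.GammaIntegral]
  have h := integral_prod_mul_vandermonde_sq N
    (fun x : ℝ => (x : ℂ) ^ a * Complex.exp (-(x : ℂ))) fun n => (hΓ n).1
  simp only [lueWeight]
  rw [h, ← det_gammaHankel_add_one ha]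
  congr 2
  ext j k
  simp only [Matrix.of_apply, gammaHankel, (hΓ _).2]

theorem ETilde_eq_det (ξ : ℂ) (ha : -1 < a.re) (hμ : -1 < μ.re)
    (hα : ∀ n : ℤ, μ + a ≠ n) (N : ℕ) {s : ℝ} (hs : 0 < s) :
    ETilde N a μ ξ s = (lueNorm N (μ + a))⁻¹ *
      (regularMatrix N a μ s + (s : ℂ) ^ (μ + a + 1) • singularMatrix N a μ ξ s).det := by
  have h := integral_prod_mul_vandermonde_sq N (deformedWeight a μ ξ s)
    fun n => (moment_deformedWeight ξ ha hμ hα n hs).1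
  have hM : (Matrix.of fun j k : Fin N => ∫ x in Set.Ioi (0 : ℝ), (x : ℂ) ^ ((j : ℕ) + k) *
      deformedWeight a μ ξ s x) =
      regularMatrix N a μ s + (s : ℂ) ^ (μ + a + 1) • singularMatrix N a μ ξ s := by
    ext j k
    simp only [Matrix.of_apply, (moment_deformedWeight ξ ha hμ hα _ hs).2, Matrix.add_apply,
      Matrix.smul_apply, regularMatrix, singularMatrix, smul_eq_mul]
  rw [hM] at h
  have hN : (N.factorial : ℂ) ≠ 0 := Nat.cast_ne_zero.2 N.factorial_ne_zero
  have hn := lueNorm_ne_zero ha N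
  have e : ∀ x : Fin N → ℝ, (∏ l, (1 - ξ * (Set.Ioo 0 s).indicator (fun _ => (1 : ℂ)) (x l)) *
      ((x l : ℂ) - (s : ℂ)) ^ μ) * lueWeight N a x =
      (∏ l, deformedWeight a μ ξ s (x l)) *
        ∏ j, ∏ k ∈ Finset.Ioi j, ((x k : ℂ) - (x j : ℂ)) ^ 2 := by
    intro x
    simp only [lueWeight, deformedWeight]
    rw [← mul_assoc, ← Finset.prod_mul_distrib]
  rw [ETilde, lueAverage, integral_lueWeight ha]
  simp only [e]
  rw [h, add_comm a μ]
  field_simp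

theorem regularMatrix_zero (N : ℕ) : regularMatrix N a μ 0 = gammaHankel N (μ + a + 1) := by
  ext j k
  simp [regularMatrix, gammaHankel, regularMoment_zero]

/-- At 0 the derivative of column k ≥ 1 is -μ times column k - 1, so replacing column k by it gives
two proportional columns. Only column 0 contributes, through `det_gammaHankel_updateCol_zero`. -/
theorem hasDerivAt_det_regularMatrix (ha : -1 < a.re) (hμ : -1 < μ.re)
    (hμa : -1 < (μ + a).re) (hα : ∀ n : ℤ, μ + a ≠ n) (n : ℕ) :
    HasDerivAt (fun z => (regularMatrix (n + 1) a μ z).det)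
      (-(μ * (n + 1 : ℕ) / (μ + a)) * lueNorm (n + 1) (μ + a)) 0 := by
  have h := hasDerivAt_det (P := regularMatrix (n + 1) a μ) (z := 0)
    (P' := Matrix.of fun j k : Fin (n + 1) =>
      -μ * Complex.Gamma (((j : ℕ) + (k : ℕ) : ℕ) + (μ + a))) fun j k => by
    have h1 := (analyticAt_regularMoment ha hμ hα ((j : ℕ) + k)).differentiableAt.hasDerivAt
    rw [deriv_regularMoment_zero ha hμ hα] at h1
    exact h1
  convert! h using 1
  rw [Fin.sum_univ_succ, regularMatrix_zero, Finset.sum_eq_zero, add_zero]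
  · have e : (fun j : Fin (n + 1) => (Matrix.of fun j k : Fin (n + 1) =>
        -μ * Complex.Gamma (((j : ℕ) + (k : ℕ) : ℕ) + (μ + a))) j 0) =
        (-μ) • fun j : Fin (n + 1) => Complex.Gamma ((j : ℕ) + (μ + a)) := by
      funext j
      simp
    rw [e, Matrix.det_updateCol_smul, det_gammaHankel_updateCol_zero n
      (fun m hm => hα (-m) (by rw [hm]; simp)), det_gammaHankel_add_one hμa]
    ring
  · intro i _
    have e : (fun j : Fin (n + 1) => (Matrix.of fun j k : Fin (n + 1) =>
        -μ * Complex.Gamma (((j : ℕ) + (k : ℕ) : ℕ) + (μ + a))) j i.succ) =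
        (-μ) • fun j : Fin (n + 1) => gammaHankel (n + 1) (μ + a + 1) j i.castSucc := by
      funext j
      simp [gammaHankel]
      ring_nf
      tauto
    rw [e, Matrix.det_updateCol_smul, Matrix.det_zero_of_column_eq
      (i := i.succ) (j := i.castSucc) (Fin.castSucc_lt_succ).ne', mul_zero]
    intro j
    rw [Matrix.updateCol_self, Matrix.updateCol_ne (Fin.castSucc_lt_succ).ne]

/-- Evaluates the corner minor of the Gamma Hankel matrix, which has size n and parameter raised by
2, relative to the full determinant. -/
theorem lueNorm_shift (b : ℂ) (n : ℕ) :
    lueNorm n (b + 2) * (Complex.Gamma (n + 1) * Complex.Gamma (b + 1) * Complex.Gamma (b + 2)) =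
      lueNorm (n + 1) b * Complex.Gamma (n + b + 2) := by
  induction n with
  | zero => simp [lueNorm]
  | succ n ih =>
    have hn : (0 : ℝ) ≤ n := n.cast_nonneg
    have h1 : lueNorm (n + 1) (b + 2) = lueNorm n (b + 2) *
        (Complex.Gamma (n + 1) * Complex.Gamma (n + (b + 2) + 1)) := Finset.prod_range_succ _ _
    have h2 : lueNorm (n + 1 + 1) b = lueNorm (n + 1) b *
        (Complex.Gamma ((n + 1 : ℕ) + 1) * Complex.Gamma ((n + 1 : ℕ) + b + 1)) :=
      Finset.prod_range_succ _ _
    rw [h1, h2]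
    push_cast
    rw [show (n : ℂ) + (b + 2) + 1 = n + 1 + b + 2 by ring,
      show (n : ℂ) + 1 + b + 1 = n + b + 2 by ring]
    linear_combination Complex.Gamma (n + 1 + b + 2) * Complex.Gamma ((n : ℂ) + 1 + 1) * ih

/-- The structure of `Ẽ_{2,N}` in the variables `s` and `s^{μ+a+1}`. -/
theorem exists_ETilde_eq_sum (ξ : ℂ) (ha : -1 < a.re) (hμ : -1 < μ.re) (hμa : -1 < (μ + a).re)
    (hα : ∀ n : ℤ, μ + a ≠ n) (n : ℕ) :
    ∃ D : ℕ → ℂ → ℂ, (∀ k, AnalyticAt ℂ (D k) 0) ∧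
      (∀ s : ℝ, 0 < s → ETilde (n + 1) a μ ξ s =
        ∑ k ∈ Finset.range (n + 2), D k s * ((s : ℂ) ^ (μ + a + 1)) ^ k) ∧
      D 0 0 = 1 ∧ deriv (D 0) 0 = -(μ * (n + 1 : ℕ) / (μ + a)) ∧
      D 1 0 = edgeConst a μ ξ * (Complex.Gamma (a + 1) * Complex.Gamma (μ + 1) *
        Complex.Gamma (n + (μ + a) + 2) /
        (Complex.Gamma (n + 1) * Complex.Gamma (μ + a + 1) * Complex.Gamma (μ + a + 2) ^ 2)) ∧
      (edgeConst a μ ξ = 0 → ∀ k, k ≠ 0 → ∀ z, D k z = 0) := by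
  have hC := lueNorm_ne_zero hμa (n + 1)
  refine ⟨fun k z => (lueNorm (n + 1) (μ + a))⁻¹ *
    detCoeff (regularMatrix (n + 1) a μ z) (singularMatrix (n + 1) a μ ξ z) k, ?_, ?_, ?_, ?_, ?_, ?_⟩
  · intro k
    refine analyticAt_const.mul (analyticAt_detCoeff (fun i j => ?_) (fun i j => ?_) k)
    · exact analyticAt_regularMoment ha hμ hα _
    · exact analyticAt_const.mul ((analyticAt_id.pow _).mul (analyticAt_singularMoment ha hμ _))
  · intro s hs
    rw [ETilde_eq_det ξ ha hμ hα _ hs, det_add_smul_eq_sum, Finset.mul_sum]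
    exact Finset.sum_congr rfl fun k _ => by ring
  · simp only []
    rw [detCoeff_zero, regularMatrix_zero, det_gammaHankel_add_one hμa, inv_mul_cancel₀ hC]
  · simp only [detCoeff_zero]
    rw [((hasDerivAt_det_regularMatrix ha hμ hμa hα n).const_mul _).deriv]
    field_simp
  · simp only []
    -- At s = 0 the factor z^{j+k} kills every entry of the singular matrix except the corner.
    rw [detCoeff_one_of_single]
    · have e : (regularMatrix (n + 1) a μ 0).submatrix Fin.succ Fin.succ =
          gammaHankel n (μ + a + 2 + 1) := by
        ext j k
        simp only [regularMatrix_zero, gammaHankel, Matrix.submatrix_apply, Matrix.of_apply,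
          Fin.val_succ]
        push_cast
        ring_nf
      have e2 : singularMatrix (n + 1) a μ ξ 0 0 0 = edgeConst a μ ξ *
          Complex.betaIntegral (a + 1) (μ + 1) := by
        simp [singularMatrix, singularMoment_zero]
      have hre2 : -1 < (μ + a + 2).re := by
        rw [Complex.add_re (μ + a)]
        norm_num
        linarith
      have h1 := Complex.Gamma_mul_Gamma_eq_betaIntegral (re_add_one_pos ha) (re_add_one_pos hμ)
      rw [show a + 1 + (μ + 1) = μ + a + 2 by ring] at h1
      have g1 : Complex.Gamma (μ + a + 2) ≠ 0 := Complex.Gamma_ne_zero_of_re_pos (by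
        rw [Complex.add_re (μ + a)]; norm_num; linarith)
      have g2 : Complex.Gamma (μ + a + 1) ≠ 0 :=
        Complex.Gamma_ne_zero_of_re_pos (re_add_one_pos hμa)
      have g3 : Complex.Gamma ((n : ℂ) + 1) ≠ 0 := Complex.Gamma_ne_zero_of_re_pos (by
        simp; positivity)
      have h2 := lueNorm_shift (μ + a) n
      rw [e, e2, det_gammaHankel_add_one hre2, h1]
      field_simp
      linear_combination edgeConst a μ ξ * Complex.betaIntegral (a + 1) (μ + 1) * h2
    · intro i j hij
      have : (i : ℕ) + (j : ℕ) ≠ 0 := by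
        rcases hij with h | h
        · have := Fin.val_ne_zero_iff.2 h; omega
        · have := Fin.val_ne_zero_iff.2 h; omega
      simp [singularMatrix, zero_pow this]
  · intro hX k hk z
    have : singularMatrix (n + 1) a μ ξ z = 0 := by
      ext i j
      simp [singularMatrix, hX]
    simp only []
    rw [this, detCoeff_zero_right _ hk, mul_zero]

end

/-! ### Expansions in powers of `s` and `s^{α+1}` -/

/-- The exponent `m + k(α+1)`. -/
def expo (α : ℂ) (k m : ℕ) : ℂ := m + k * (α + 1)

theorem expo_mem (α : ℂ) (k m : ℕ) : expo α k m ∈ exponents α := ⟨m, k, rfl⟩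

theorem expo_injective (α : ℂ) (k : ℕ) : Function.Injective (expo α k) := by
  intro m n h
  simpa [expo] using h

theorem ofReal_cpow_expo {s : ℝ} (hs : 0 < s) (α : ℂ) (k m : ℕ) :
    (s : ℂ) ^ expo α k m = (s : ℂ) ^ m * ((s : ℂ) ^ (α + 1)) ^ k := by
  rw [expo, Complex.cpow_add _ _ (Complex.ofReal_ne_zero.2 hs.ne'), Complex.cpow_natCast,
    Complex.cpow_nat_mul]

/-- Extension by zero turns the k-th power series into a family over distinct exponents. Series with
different k may meet at one exponent, and then their coefficients simply add. -/
theorem hasSum_exponents_extend {α : ℂ} {k : ℕ} {d : ℕ → ℂ} {s : ℝ} (hs : 0 < s) {x : ℂ}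
    (h : HasSum (fun m => d m * (s : ℂ) ^ m) x) :
    HasSum (fun ρ : exponents α => Function.extend (expo α k) d 0 ρ * (s : ℂ) ^ (ρ : ℂ))
      (x * ((s : ℂ) ^ (α + 1)) ^ k) := by
  have hi : Function.Injective fun m : ℕ => (⟨expo α k m, expo_mem α k m⟩ : exponents α) :=
    fun m n hmn => expo_injective α k (congrArg Subtype.val hmn)
  rw [← hi.hasSum_iff]
  · convert! h.mul_right (((s : ℂ) ^ (α + 1)) ^ k) using 1
    funext m
    simp only [Function.comp_apply, (expo_injective α k).extend_apply, ofReal_cpow_expo hs]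
    ring
  · intro ρ hρ
    rw [Function.extend_apply' _ _ _ (by
      rintro ⟨m, hm⟩
      exact hρ ⟨m, Subtype.ext hm⟩)]
    simp

theorem hasSum_taylor {F : ℂ → ℂ} (hF : AnalyticAt ℂ F 0) :
    ∀ᶠ s : ℝ in 𝓝[>] 0,
      HasSum (fun m => iteratedDeriv m F 0 / (m.factorial : ℂ) * (s : ℂ) ^ m) (F s) := by
  have h := hasFPowerSeriesAt_iff.1 hF.hasFPowerSeriesAt
  have ht : Tendsto (fun s : ℝ => (s : ℂ)) (𝓝[>] 0) (𝓝 0) :=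
    (Complex.continuous_ofReal.tendsto' 0 0 Complex.ofReal_zero).mono_left nhdsWithin_le_nhds
  filter_upwards [ht.eventually h] with s hs
  simpa [FormalMultilinearSeries.coeff_ofScalars, mul_comm] using hs

/-- A coefficient is read off from one Taylor series when no other pair (m, k) gives its exponent.
For 0 and α + 1 this follows from real parts and α ∉ ℤ. The exponent 1 may coincide with one having
k ≥ 2, for instance when α = -1/2, hence the proviso. -/
theorem exists_hasSmallExpansion {α : ℂ} (hα1 : -1 < α.re) (hα : ∀ n : ℤ, α ≠ n) {f : ℝ → ℂ}
    {D : ℕ → ℂ → ℂ} {K : ℕ} (hD : ∀ k, AnalyticAt ℂ (D k) 0)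
    (hf : ∀ s : ℝ, 0 < s →
      f s = ∑ k ∈ Finset.range (K + 2), D k s * ((s : ℂ) ^ (α + 1)) ^ k) :
    ∃ c : ℂ → ℂ, HasSmallExpansion α f c ∧ c 0 = D 0 0 ∧ c (α + 1) = D 1 0 ∧
      ((∀ k m : ℕ, 2 ≤ k → expo α k m ≠ 1) → c 1 = deriv (D 0) 0) ∧
      ((∀ k, k ≠ 0 → ∀ z, D k z = 0) → ∀ ρ : ℂ, (∀ m : ℕ, ρ ≠ m) → c ρ = 0) := by
  set d : ℕ → ℕ → ℂ := fun k m => iteratedDeriv m (D k) 0 / (m.factorial : ℂ) with hd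
  set c : ℂ → ℂ := fun ρ => ∑ k ∈ Finset.range (K + 2), Function.extend (expo α k) (d k) 0 ρ with hc
  have hval : ∀ k m : ℕ, k < K + 2 → (∀ k' m' : ℕ, k' ≠ k → expo α k' m' ≠ expo α k m) →
      c (expo α k m) = d k m := by
    intro k m hk h
    simp only [hc]
    rw [Finset.sum_eq_single_of_mem k (Finset.mem_range.2 hk), (expo_injective α k).extend_apply]
    intro k' _ hk'
    rw [Function.extend_apply' _ _ _ (by rintro ⟨m', hm'⟩; exact h k' m' hk' hm')]
    rfl
  have hre : ∀ k m : ℕ, (expo α k m).re = m + k * (α.re + 1) := by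
    intro k m; simp [expo]
  refine ⟨c, ?_, ?_, ?_, ?_, ?_⟩
  · have h1 : ∀ᶠ s : ℝ in 𝓝[>] 0, ∀ k ∈ Finset.range (K + 2),
        HasSum (fun m => d k m * (s : ℂ) ^ m) (D k s) :=
      (Filter.eventually_all_finset _).2 fun k _ => hasSum_taylor (hD k)
    filter_upwards [h1, self_mem_nhdsWithin] with s hs hs0
    rw [hf s hs0]
    convert! hasSum_sum fun k hk => hasSum_exponents_extend (α := α) (k := k) hs0 (hs k hk) using 1
    funext ρ
    simp only [hc, Finset.sum_mul]
  · have h := hval 0 0 (by omega) fun k' m' hk' h => by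
      have := congrArg Complex.re h
      rw [hre, hre] at this
      have h1 : (1 : ℝ) ≤ k' := by exact_mod_cast Nat.one_le_iff_ne_zero.2 hk'
      have h2 : (0 : ℝ) ≤ m' := m'.cast_nonneg
      simp only [Nat.cast_zero, zero_mul, add_zero] at this
      nlinarith
    simpa [expo, hd] using h
  · have h := hval 1 0 (by omega) fun k' m' hk' h => by
      rcases Nat.lt_or_ge k' 2 with hk2 | hk2
      · obtain rfl : k' = 0 := by omega
        refine hα (m' - 1) ?_
        simp only [expo, Nat.cast_zero, Nat.cast_one] at h
        push_cast
        linear_combination -h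
      · have := congrArg Complex.re h
        rw [hre, hre] at this
        have h1 : (2 : ℝ) ≤ k' := by exact_mod_cast hk2
        have h2 : (0 : ℝ) ≤ m' := m'.cast_nonneg
        simp only [Nat.cast_zero, Nat.cast_one, zero_add, one_mul] at this
        nlinarith
    simpa [expo, hd] using h
  · intro h1
    have h := hval 0 1 (by omega) fun k' m' hk' h => by
      rcases Nat.lt_or_ge k' 2 with hk2 | hk2
      · obtain rfl : k' = 1 := by omega
        refine hα (-m') ?_
        simp only [expo, Nat.cast_zero, Nat.cast_one] at h
        push_cast
        linear_combination h
      · exact h1 k' m' hk2 (h.trans (by simp [expo]))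
    simpa [expo, hd] using h
  · intro h0 ρ hρ
    refine Finset.sum_eq_zero fun k _ => ?_
    by_cases hk : k = 0
    · subst hk
      rw [Function.extend_apply' _ _ _ (by
        rintro ⟨m, hm⟩
        exact hρ m (hm.symm.trans (by simp [expo])))]
      rfl
    · have : d k = 0 := by
        funext m
        have hz : D k = fun _ => 0 := funext (h0 k hk)
        simp [hd, hz]
      rw [this]
      by_cases hm : ∃ m, expo α k m = ρ
      · obtain ⟨m, rfl⟩ := hm
        rw [(expo_injective α k).extend_apply]; rfl
      · rw [Function.extend_apply' _ _ _ hm]; rfl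

/-! ### The hard edge limit of the coefficients -/

/-- A rearrangement of Euler's limit formula for Γ(w), with the finite product written as a Gamma
quotient. -/
theorem tendsto_Gamma_ratio {w : ℂ} (hw : 0 < w.re) :
    Tendsto (fun N : ℕ => Complex.Gamma (N + w) / (Complex.Gamma N * (N : ℂ) ^ w)) atTop (𝓝 1) := by
  have hΓ : Complex.Gamma w ≠ 0 := Complex.Gamma_ne_zero_of_re_pos hw
  have h1 : Tendsto (fun N : ℕ => (N : ℂ) / (N + w)) atTop (𝓝 1) := by
    exact tendsto_natCast_div_add_atTop w
  have h2 := (h1.mul_const (Complex.Gamma w)).div (Complex.GammaSeq_tendsto_Gamma w) hΓ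
  rw [one_mul, div_self hΓ] at h2
  refine h2.congr' ?_
  filter_upwards [eventually_ge_atTop 1] with N hN
  have hN0 : (N : ℂ) ≠ 0 := Nat.cast_ne_zero.2 (by omega)
  have hre : 0 < (w + N).re := by simp; positivity
  have hwN : w + N ≠ 0 := fun h => by rw [h] at hre; simp at hre
  have hwN' : (N : ℂ) + w ≠ 0 := by rwa [add_comm]
  have hΓN : Complex.Gamma (N : ℂ) ≠ 0 := Complex.Gamma_ne_zero_of_re_pos (by simp; omega)
  have hcp : (N : ℂ) ^ w ≠ 0 := by
    rw [Ne, Complex.cpow_eq_zero_iff]; exact fun h => hN0 h.1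
  have h3 : Complex.Gamma (w + N) * (w + N) =
      Complex.Gamma w * ∏ j ∈ Finset.range (N + 1), (w + j) := by
    have h4 : ∀ n : ℕ, Complex.Gamma (w + n) = Complex.Gamma w * ∏ j ∈ Finset.range n, (w + j) := by
      intro n
      induction n with
      | zero => simp
      | succ n ih =>
        have h5 : w + n ≠ 0 := fun h => ne_neg_natCast_of_re_pos hw n (eq_neg_of_add_eq_zero_left h)
        rw [Finset.prod_range_succ, ← mul_assoc, ← ih, Nat.cast_succ, ← add_assoc,
          Complex.Gamma_add_one _ h5, mul_comm]
    rw [Finset.prod_range_succ, ← mul_assoc, ← h4]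
  have hprod : ∏ j ∈ Finset.range (N + 1), (w + (j : ℂ)) ≠ 0 := by
    refine Finset.prod_ne_zero_iff.2 fun j _ h => ?_
    exact ne_neg_natCast_of_re_pos hw j (eq_neg_of_add_eq_zero_left h)
  have h6 : (N.factorial : ℂ) = N * Complex.Gamma N := by
    rw [← Complex.Gamma_add_one _ hN0, Complex.Gamma_nat_eq_factorial]
  simp only [Pi.div_apply, Complex.GammaSeq]
  rw [h6, add_comm (N : ℂ) w]
  field_simp
  linear_combination -h3

theorem cpow_four_mul_natCast (N : ℕ) (w : ℂ) :
    (4 * (N : ℂ)) ^ w = 4 ^ w * (N : ℂ) ^ w := by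
  have := Complex.mul_cpow_ofReal_nonneg (a := 4) (b := N) (by norm_num) N.cast_nonneg w
  simpa using this

theorem exists_hardEdge_coefficients {a μ : ℂ} (ξ : ℂ) (hμ : -1 < μ.re) (ha : -1 < a.re)
    (hμa : -1 < (μ + a).re) (hα : ∀ n : ℤ, μ + a ≠ n) (hlim : LimitTermByTerm a μ ξ) :
    ∃ h : ℂ → ℂ, h 0 = 1 ∧
      h (μ + a + 1) = Complex.Gamma (μ + 1) * Complex.Gamma (a + 1) /
        (Complex.Gamma (μ + a + 2) ^ 2 * Complex.Gamma (μ + a + 1)) * edgeConst a μ ξ /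
          4 ^ (μ + a + 1) ∧
      ((∀ k m : ℕ, 2 ≤ k → expo (μ + a) k m ≠ 1) → h 1 = -(μ / (4 * (a + μ)))) ∧
      (edgeConst a μ ξ = 0 → ∀ ρ ∈ exponents (μ + a), (∀ m : ℕ, ρ ≠ m) → h ρ = 0) ∧
      ∀ᶠ t : ℝ in 𝓝[>] 0, ∃ L : ℂ,
        HasSum (fun ρ : exponents (μ + a) => h ρ * (t : ℂ) ^ (ρ : ℂ)) L ∧
        Tendsto (fun N : ℕ => scaledE N a μ ξ t) atTop (𝓝 L) := by
  choose D hD1 hD2 hD3 hD4 hD5 hD6 using exists_ETilde_eq_sum ξ ha hμ hμa hα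
  choose c hc1 hc2 hc3 hc4 hc5 using fun n =>
    exists_hasSmallExpansion hμa hα (hD1 n) (hD2 n)
  -- The coefficient families are indexed by n = N - 1; the truncated value at N = 0 is irrelevant.
  obtain ⟨h, hh1, hh2⟩ := hlim (fun N => c (N - 1)) fun N hN => by
    obtain ⟨n, rfl⟩ := Nat.exists_eq_add_of_le' hN
    exact hc1 n
  have hα0 : μ + a ≠ 0 := by simpa using hα 0
  have hmem0 : (0 : ℂ) ∈ exponents (μ + a) := ⟨0, 0, by simp⟩
  have hmem1 : (1 : ℂ) ∈ exponents (μ + a) := ⟨1, 0, by simp⟩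
  have hmemα : μ + a + 1 ∈ exponents (μ + a) := ⟨0, 1, by simp⟩
  refine ⟨h, ?_, ?_, ?_, ?_, hh2⟩
  · refine tendsto_nhds_unique (hh1 0 hmem0) ?_
    simp [hc2, hD3]
  · refine tendsto_nhds_unique (hh1 _ hmemα) ?_
    have h1 := ((tendsto_Gamma_ratio (re_add_one_pos hμa)).const_mul
      (Complex.Gamma (μ + 1) * Complex.Gamma (a + 1) /
        (Complex.Gamma (μ + a + 2) ^ 2 * Complex.Gamma (μ + a + 1)) * edgeConst a μ ξ /
          4 ^ (μ + a + 1)))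
    rw [mul_one] at h1
    refine h1.congr' ?_
    filter_upwards [eventually_ge_atTop 1] with N hN
    obtain ⟨n, rfl⟩ := Nat.exists_eq_add_of_le' hN
    rw [Nat.add_sub_cancel, hc3, hD5, cpow_four_mul_natCast]
    push_cast
    rw [show (n : ℂ) + 1 + (μ + a + 1) = n + (μ + a) + 2 by ring]
    ring
  · intro hk
    refine tendsto_nhds_unique (hh1 _ hmem1) ?_
    -- The factor N of the linear coefficient cancels against 4N, so the sequence is constant for N
    -- ≥ 1.
    refine tendsto_const_nhds.congr' ?_
    filter_upwards [eventually_ge_atTop 1] with N hN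
    obtain ⟨n, rfl⟩ := Nat.exists_eq_add_of_le' hN
    have hn : (n : ℂ) + 1 ≠ 0 := Nat.cast_add_one_ne_zero n
    rw [Nat.add_sub_cancel, hc4 n hk, hD4, Complex.cpow_one, add_comm a μ]
    push_cast
    field_simp
  · intro hX ρ hρ hm
    refine tendsto_nhds_unique (hh1 ρ hρ) ?_
    simp [hc5 _ (hD6 _ hX) ρ hm]

/-! ### Sums of powers with exponents `m + k(α+1)` -/

/-- The set of exponents `m + k(α+1)` with `k ≥ 2`. -/
def highExponents (α : ℂ) : Set ℂ := {ρ | ∃ k m : ℕ, 2 ≤ k ∧ expo α k m = ρ}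

theorem expo_re (α : ℂ) (k m : ℕ) : (expo α k m).re = m + k * (α.re + 1) := by
  simp [expo]

theorem norm_ofReal_cpow_le {s t : ℝ} (hs : 0 < s) (hst : s ≤ t) {κ : ℝ} {ρ : ℂ} (h : κ ≤ ρ.re) :
    ‖(s : ℂ) ^ ρ‖ ≤ (s / t) ^ κ * ‖(t : ℂ) ^ ρ‖ := by
  have ht : 0 < t := hs.trans_le hst
  rw [Complex.norm_cpow_eq_rpow_re_of_pos hs, Complex.norm_cpow_eq_rpow_re_of_pos ht]
  calc s ^ ρ.re = (s / t) ^ ρ.re * t ^ ρ.re := by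
        rw [← Real.mul_rpow (div_pos hs ht).le ht.le, div_mul_cancel₀ _ ht.ne']
    _ ≤ (s / t) ^ κ * t ^ ρ.re := by
        gcongr ?_ * _
        exact Real.rpow_le_rpow_of_exponent_ge (div_pos hs ht) ((div_le_one ht).2 hst) h

theorem exponents_re_nonneg {α : ℂ} (hα : -1 < α.re) {ρ : ℂ} (hρ : ρ ∈ exponents α) :
    0 ≤ ρ.re := by
  obtain ⟨m, k, rfl⟩ := hρ
  have := expo_re α k m
  rw [expo] at this
  rw [this]
  have : 0 < α.re + 1 := by linarith
  positivity

theorem summable_exponents_mono {α : ℂ} (hα : -1 < α.re) {c : ℂ → ℂ} {s t : ℝ} (hs : 0 < s)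
    (hst : s ≤ t) (hc : Summable fun ρ : exponents α => c ρ * (t : ℂ) ^ (ρ : ℂ)) :
    Summable fun ρ : exponents α => c ρ * (s : ℂ) ^ (ρ : ℂ) := by
  refine Summable.of_norm_bounded hc.norm fun ρ => ?_
  rw [norm_mul, norm_mul]
  have := norm_ofReal_cpow_le hs hst (exponents_re_nonneg hα ρ.2)
  rw [Real.rpow_zero, one_mul] at this
  gcongr

/-- Convergence at one point t controls any subsum over exponents with Re ρ ≥ κ: it is O(s^κ) with
an explicit constant. -/
theorem norm_tsum_exponents_le {α : ℂ} {c c' : ℂ → ℂ} {κ s t : ℝ} (hs : 0 < s) (hst : s ≤ t)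
    (hc : Summable fun ρ : exponents α => c ρ * (t : ℂ) ^ (ρ : ℂ))
    (hc' : ∀ ρ ∈ exponents α, c' ρ = 0 ∨ (c' ρ = c ρ ∧ κ ≤ ρ.re)) :
    ‖∑' ρ : exponents α, c' ρ * (s : ℂ) ^ (ρ : ℂ)‖ ≤
      (s / t) ^ κ * ∑' ρ : exponents α, ‖c ρ * (t : ℂ) ^ (ρ : ℂ)‖ := by
  have ht : 0 < t := hs.trans_le hst
  refine tsum_of_norm_bounded (hc.norm.hasSum.mul_left _) fun ρ => ?_
  rcases hc' ρ ρ.2 with h | ⟨h, hκ⟩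
  · rw [h, zero_mul, norm_zero]
    positivity
  · rw [h, norm_mul, norm_mul]
    calc ‖c ρ‖ * ‖(s : ℂ) ^ (ρ : ℂ)‖ ≤ ‖c ρ‖ * ((s / t) ^ κ * ‖(t : ℂ) ^ (ρ : ℂ)‖) := by
          gcongr
          exact norm_ofReal_cpow_le hs hst hκ
      _ = _ := by ring

/-- `f(s) = A(s) + s^{α+1} B(s) + O(s^{2(α+1)})` with `A` and `B` analytic at `0`. -/
structure IsEdge (α : ℂ) (f : ℝ → ℂ) (A B : ℂ → ℂ) : Prop where
  analytic_left : AnalyticAt ℂ A 0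
  analytic_right : AnalyticAt ℂ B 0
  isBigO : (fun s : ℝ => f s - (A s + (s : ℂ) ^ (α + 1) * B s)) =O[𝓝[>] 0]
    fun s : ℝ => (s : ℂ) ^ (2 * (α + 1))

theorem norm_ofReal_cpow_two_mul {s : ℝ} (hs : 0 < s) (α : ℂ) :
    ‖(s : ℂ) ^ (2 * (α + 1))‖ = s ^ (2 * (α.re + 1)) := by
  rw [Complex.norm_cpow_eq_rpow_re_of_pos hs]
  congr 1
  simp

theorem exists_isEdge {α : ℂ} (hα1 : -1 < α.re) (hα : ∀ n : ℤ, α ≠ n) {c : ℂ → ℂ} {c₁ : ℂ}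
    {t : ℝ} (ht : 0 < t) (hc : Summable fun ρ : exponents α => c ρ * (t : ℂ) ^ (ρ : ℂ))
    (hc₁ : (∀ k m : ℕ, 2 ≤ k → expo α k m ≠ 1) → c 1 = c₁) :
    ∃ A B : ℂ → ℂ,
      IsEdge α (fun s => ∑' ρ : exponents α, c ρ * (s : ℂ) ^ (ρ : ℂ)) A B ∧
      A 0 = c 0 ∧ deriv A 0 = c₁ ∧ B 0 = c (α + 1) ∧
      ((∀ ρ ∈ exponents α, (∀ m : ℕ, ρ ≠ m) → c ρ = 0) → ∀ z, B z = 0) := by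
  classical
  have hre1 : 0 < α.re + 1 := by linarith
  set low : ℕ → ℕ → ℂ := fun k m =>
    if expo α k m ∈ highExponents α then 0 else c (expo α k m) with hlow
  have hlow_sum : ∀ k, Summable fun m => low k m * (t : ℂ) ^ m := by
    intro k
    have hi : Function.Injective fun m : ℕ => (⟨expo α k m, expo_mem α k m⟩ : exponents α) :=
      fun m n hmn => expo_injective α k (congrArg Subtype.val hmn)
    have h1 := (hc.comp_injective hi).norm
    have htc : (t : ℂ) ^ (α + 1) ≠ 0 := by
      rw [Ne, Complex.cpow_eq_zero_iff]
      exact fun h => ht.ne' (Complex.ofReal_eq_zero.1 h.1)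
    refine Summable.of_norm_bounded (h1.mul_right ‖((t : ℂ) ^ (α + 1)) ^ k‖⁻¹) fun m => ?_
    simp only [Function.comp_apply, ofReal_cpow_expo ht]
    rw [← norm_inv, ← norm_mul, mul_assoc, mul_assoc, mul_inv_cancel₀ (pow_ne_zero _ htc), mul_one,
      norm_mul, norm_mul]
    gcongr
    simp only [hlow]
    split_ifs
    · simp
    · exact le_rfl
  have hpar : ∀ m m' : ℕ, expo α 0 m ≠ expo α 1 m' := by
    intro m m' h
    refine hα (m - m' - 1) ?_
    simp only [expo, Nat.cast_zero, Nat.cast_one] at h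
    push_cast
    linear_combination -h
  have hnot : ∀ k m : ℕ, k < 2 → m = 0 → expo α k m ∉ highExponents α := by
    rintro k m hk rfl ⟨k', m', hk', h⟩
    have h := congrArg Complex.re h
    rw [expo_re, expo_re] at h
    have h1 : (k : ℝ) + 1 ≤ k' := by exact_mod_cast (by omega : k + 1 ≤ k')
    have h2 : (0 : ℝ) ≤ m' := m'.cast_nonneg
    simp only [Nat.cast_zero, zero_add] at h
    nlinarith
  set high : ℂ → ℂ := (highExponents α).indicator c with hhigh
  have hdecomp : ∀ ρ ∈ exponents α, c ρ = Function.extend (expo α 0) (low 0) 0 ρ +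
      Function.extend (expo α 1) (low 1) 0 ρ + high ρ := by
    intro ρ hρ
    have hval : ∀ k m, Function.extend (expo α k) (low k) 0 (expo α k m) = low k m := fun k m =>
      (expo_injective α k).extend_apply _ _ _
    by_cases hh : ρ ∈ highExponents α
    · have hz : ∀ k, Function.extend (expo α k) (low k) 0 ρ = 0 := by
        intro k
        by_cases hm : ∃ m, expo α k m = ρ
        · obtain ⟨m, rfl⟩ := hm
          rw [hval, hlow]
          simp only [if_pos hh]
        · rw [Function.extend_apply' _ _ _ hm]; rfl
      rw [hz, hz, hhigh, Set.indicator_of_mem hh]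
      ring
    · obtain ⟨m, k, rfl⟩ := hρ
      change c (expo α k m) = _
      change expo α k m ∉ _ at hh
      change _ = Function.extend (expo α 0) (low 0) 0 (expo α k m) +
        Function.extend (expo α 1) (low 1) 0 (expo α k m) + high (expo α k m)
      have hk : k < 2 := by
        by_contra hk
        exact hh ⟨k, m, not_lt.1 hk, rfl⟩
      rw [hhigh, Set.indicator_of_notMem hh]
      interval_cases k
      · rw [hval, Function.extend_apply' _ _ _ (by rintro ⟨m', hm'⟩; exact hpar _ _ hm'.symm)]
        simp [hlow, hh]
      · rw [hval, Function.extend_apply' _ _ _ (by rintro ⟨m', hm'⟩; exact hpar _ _ hm')]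
        simp [hlow, hh]
  set A₀ : ℂ → ℂ := fun z => ∑' m, low 0 m * z ^ m with hA₀
  set B : ℂ → ℂ := fun z => ∑' m, low 1 m * z ^ m with hB
  -- Correction to the linear term, needed only when the exponent 1 was removed from the k = 0
  -- series.
  set e : ℂ := if (1 : ℂ) ∈ highExponents α then c₁ else 0 with he
  have hA₀an : AnalyticAt ℂ A₀ 0 := analyticAt_tsum ht (hlow_sum 0)
  have hlin : HasDerivAt (fun z : ℂ => e * z) e 0 := by
    simpa using (hasDerivAt_id (0 : ℂ)).const_mul e
  refine ⟨fun z => A₀ z + e * z, B, ⟨hA₀an.add (analyticAt_const.mul analyticAt_id),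
    analyticAt_tsum ht (hlow_sum 1), ?_⟩, ?_, ?_, ?_, ?_⟩
  · have hsplit : ∀ s : ℝ, 0 < s → s ≤ t → ∑' ρ : exponents α, c ρ * (s : ℂ) ^ (ρ : ℂ) =
        A₀ s + (s : ℂ) ^ (α + 1) * B s + ∑' ρ : exponents α, high ρ * (s : ℂ) ^ (ρ : ℂ) := by
      intro s hs hst
      have hlows : ∀ k, Summable fun m => low k m * (s : ℂ) ^ m := fun k => by
        refine Summable.of_norm_bounded (hlow_sum k).norm fun m => ?_
        rw [norm_mul, norm_mul, norm_pow, norm_pow, Complex.norm_real, Complex.norm_real,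
          Real.norm_of_nonneg hs.le, Real.norm_of_nonneg ht.le]
        gcongr
      have h0 := hasSum_exponents_extend (α := α) (k := 0) hs (hlows 0).hasSum
      have h1 := hasSum_exponents_extend (α := α) (k := 1) hs (hlows 1).hasSum
      have hsum := summable_exponents_mono hα1 hs hst hc
      have h2 : Summable fun ρ : exponents α => high ρ * (s : ℂ) ^ (ρ : ℂ) := by
        refine Summable.of_norm_bounded hsum.norm fun ρ => ?_
        rw [norm_mul, norm_mul]
        gcongr
        exact norm_indicator_le_norm_self _ _
      have h3 := (h0.add h1).add h2.hasSum
      rw [pow_zero, mul_one, pow_one] at h3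
      rw [hA₀, hB]
      simp only []
      rw [mul_comm ((s : ℂ) ^ (α + 1)), ← h3.tsum_eq]
      refine tsum_congr fun ρ => ?_
      rw [hdecomp ρ ρ.2]
      ring
    have hO1 : (fun s : ℝ => ∑' ρ : exponents α, high ρ * (s : ℂ) ^ (ρ : ℂ)) =O[𝓝[>] 0]
        fun s : ℝ => (s : ℂ) ^ (2 * (α + 1)) := by
      refine IsBigO.of_bound ((t ^ (2 * (α.re + 1)))⁻¹ *
        ∑' ρ : exponents α, ‖c ρ * (t : ℂ) ^ (ρ : ℂ)‖) ?_
      filter_upwards [Ioo_mem_nhdsGT ht] with s hs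
      have h := norm_tsum_exponents_le (c' := high) (κ := 2 * (α.re + 1)) hs.1 hs.2.le hc
        fun ρ _ => by
          by_cases hh : ρ ∈ highExponents α
          · refine Or.inr ⟨Set.indicator_of_mem hh _, ?_⟩
            obtain ⟨k, m, hk, rfl⟩ := hh
            rw [expo_re]
            have h1 : (2 : ℝ) ≤ k := by exact_mod_cast hk
            have h2 : (0 : ℝ) ≤ m := m.cast_nonneg
            nlinarith
          · exact Or.inl (Set.indicator_of_notMem hh _)
      refine h.trans_eq ?_
      rw [norm_ofReal_cpow_two_mul hs.1, Real.div_rpow hs.1.le ht.le]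
      ring
    have hO2 : (fun s : ℝ => e * (s : ℂ)) =O[𝓝[>] 0] fun s : ℝ => (s : ℂ) ^ (2 * (α + 1)) := by
      by_cases hh : (1 : ℂ) ∈ highExponents α
      · refine IsBigO.const_mul_left (IsBigO.of_bound 1 ?_) e
        filter_upwards [Ioo_mem_nhdsGT one_pos] with s hs
        obtain ⟨k, m, hk, h⟩ := hh
        have h := congrArg Complex.re h
        rw [expo_re, Complex.one_re] at h
        have h1 : (2 : ℝ) ≤ k := by exact_mod_cast hk
        have h2 : (0 : ℝ) ≤ m := m.cast_nonneg
        rw [norm_ofReal_cpow_two_mul hs.1, Complex.norm_real, Real.norm_of_nonneg hs.1.le, one_mul]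
        calc s = s ^ (1 : ℝ) := (Real.rpow_one s).symm
          _ ≤ s ^ (2 * (α.re + 1)) :=
            Real.rpow_le_rpow_of_exponent_ge hs.1 hs.2.le (by nlinarith)
      · have : e = 0 := by rw [he, if_neg hh]
        simp only [this, zero_mul]
        exact isBigO_zero _ _
    refine (hO1.sub hO2).congr' ?_ EventuallyEq.rfl
    filter_upwards [Ioo_mem_nhdsGT ht] with s hs
    rw [hsplit s hs.1 hs.2.le]
    ring
  · simp only [mul_zero, add_zero, hA₀]
    rw [tsum_mul_zero_pow]
    simp only [hlow]
    rw [if_neg (hnot 0 0 (by norm_num) rfl)]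
    simp [expo]
  · rw [(hA₀an.differentiableAt.hasDerivAt.fun_add hlin).deriv, hA₀, deriv_tsum_zero ht (hlow_sum 0)]
    have h1 : expo α 0 1 = 1 := by simp [expo]
    simp only [hlow, h1, he]
    by_cases hh : (1 : ℂ) ∈ highExponents α
    · simp [hh]
    · simp only [hh, if_false, add_zero]
      exact hc₁ fun k m hk h => hh ⟨k, m, hk, h⟩
  · simp only [hB]
    rw [tsum_mul_zero_pow]
    simp only [hlow]
    rw [if_neg (hnot 1 0 (by norm_num) rfl)]
    simp [expo]
  · intro h0 z
    simp only [hB]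
    have : ∀ m, low 1 m = 0 := by
      intro m
      simp only [hlow]
      split_ifs
      · rfl
      · refine h0 _ (expo_mem α 1 m) fun m' h => hpar m' m ?_
        rw [h]
        simp [expo]
    simp [this]

/-! ### Termwise differentiation and quotients of edge expansions -/

section

variable {α : ℂ}

/-- The exponents lie in the cone spanned by 1 and α + 1, both in the open right half plane. -/
theorem exists_norm_le_re (hα : -1 < α.re) :
    ∃ C : ℝ, 0 ≤ C ∧ ∀ ρ ∈ exponents α, ‖ρ‖ ≤ C * ρ.re := by
  have h1 : 0 < α.re + 1 := by linarith
  refine ⟨1 + ‖α + 1‖ / (α.re + 1), by positivity, ?_⟩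
  rintro ρ ⟨m, k, rfl⟩
  have h2 := expo_re α k m
  rw [expo] at h2
  rw [h2]
  calc ‖(m : ℂ) + k * (α + 1)‖ ≤ m + k * ‖α + 1‖ := by
        refine (norm_add_le _ _).trans ?_
        rw [norm_mul, Complex.norm_natCast, Complex.norm_natCast]
    _ ≤ m + k * ‖α + 1‖ + (k * (α.re + 1) + m * (‖α + 1‖ / (α.re + 1))) := by
        have : 0 ≤ k * (α.re + 1) + m * (‖α + 1‖ / (α.re + 1)) := by positivity
        linarith
    _ = (1 + ‖α + 1‖ / (α.re + 1)) * (m + k * (α.re + 1)) := by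
        field_simp
        ring

/-- Halving t gains 2^{-Re ρ}, which absorbs the factor ρ. -/
theorem summable_exponents_mul (hα : -1 < α.re) {c : ℂ → ℂ} {t : ℝ} (ht : 0 < t)
    (hc : Summable fun ρ : exponents α => c ρ * (t : ℂ) ^ (ρ : ℂ)) :
    Summable fun ρ : exponents α => (ρ : ℂ) * c ρ * ((t / 2 : ℝ) : ℂ) ^ (ρ : ℂ) := by
  obtain ⟨C, hC0, hC⟩ := exists_norm_le_re hα
  have ht2 : 0 < t / 2 := half_pos ht
  have hlog : 0 < Real.log 2 := Real.log_pos one_lt_two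
  refine Summable.of_norm_bounded (hc.norm.mul_left (C / Real.log 2)) fun ρ => ?_
  have hre := exponents_re_nonneg hα ρ.2
  have h1 : ‖(t : ℂ) ^ (ρ : ℂ)‖ = 2 ^ (ρ : ℂ).re * ‖((t / 2 : ℝ) : ℂ) ^ (ρ : ℂ)‖ := by
    rw [Complex.norm_cpow_eq_rpow_re_of_pos ht, Complex.norm_cpow_eq_rpow_re_of_pos ht2,
      ← Real.mul_rpow zero_le_two ht2.le]
    congr 1
    ring
  have h2 : (ρ : ℂ).re ≤ 2 ^ (ρ : ℂ).re / Real.log 2 := by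
    rw [le_div_iff₀ hlog, Real.rpow_def_of_pos zero_lt_two]
    have := Real.add_one_le_exp (Real.log 2 * (ρ : ℂ).re)
    linarith
  rw [norm_mul, norm_mul, norm_mul, h1]
  calc ‖(ρ : ℂ)‖ * ‖c ρ‖ * ‖((t / 2 : ℝ) : ℂ) ^ (ρ : ℂ)‖
      ≤ C * (2 ^ (ρ : ℂ).re / Real.log 2) * ‖c ρ‖ * ‖((t / 2 : ℝ) : ℂ) ^ (ρ : ℂ)‖ := by
        gcongr
        exact (hC ρ ρ.2).trans (mul_le_mul_of_nonneg_left h2 hC0)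
    _ = _ := by ring

theorem hasDerivAt_tsum_exponents (hα : -1 < α.re) {c : ℂ → ℂ} {t : ℝ} (ht : 0 < t)
    (hc : Summable fun ρ : exponents α => c ρ * (t : ℂ) ^ (ρ : ℂ)) {s : ℝ} (hs : 0 < s)
    (hst : s < t / 2) :
    HasDerivAt (fun s : ℝ => ∑' ρ : exponents α, c ρ * (s : ℂ) ^ (ρ : ℂ))
      ((∑' ρ : exponents α, (ρ : ℂ) * c ρ * (s : ℂ) ^ (ρ : ℂ)) / s) s := by
  have hd := summable_exponents_mul hα ht hc
  have hmem : s ∈ Set.Ioo (s / 2) (t / 2) := ⟨half_lt_self hs, hst⟩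
  have hs2 : 0 < s / 2 := half_pos hs
  have h := hasDerivAt_tsum_of_isPreconnected
    (g := fun (ρ : exponents α) (x : ℝ) => c ρ * (x : ℂ) ^ (ρ : ℂ))
    (g' := fun (ρ : exponents α) (x : ℝ) => (ρ : ℂ) * c ρ * (x : ℂ) ^ (ρ : ℂ) / x)
    (hd.norm.div_const (s / 2)) isOpen_Ioo isPreconnected_Ioo ?_ ?_ hmem
    (summable_exponents_mono hα hs (by linarith) hc) hmem
  · convert! h using 1
    rw [tsum_div_const]
  · intro ρ x hx
    have hx0 : 0 < x := hs2.trans hx.1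
    have hxc : (x : ℂ) ≠ 0 := Complex.ofReal_ne_zero.2 hx0.ne'
    convert! (hasDerivAt_ofReal_cpow_of_pos hx0 (ρ : ℂ)).const_mul (c ρ) using 1
    rw [Complex.cpow_sub _ _ hxc, Complex.cpow_one]
    ring
  · intro ρ x hx
    have hx0 : 0 < x := hs2.trans hx.1
    rw [norm_div, norm_mul, norm_mul _ ((_ : ℂ) ^ _), Complex.norm_real, Real.norm_of_nonneg hx0.le]
    have h1 := norm_ofReal_cpow_le hx0 hx.2.le (exponents_re_nonneg hα ρ.2)
    rw [Real.rpow_zero, one_mul] at h1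
    gcongr
    exact hx.1.le

theorem tendsto_ofReal_cpow_zero {z : ℂ} (hz : 0 < z.re) :
    Tendsto (fun s : ℝ => (s : ℂ) ^ z) (𝓝[>] 0) (𝓝 0) := by
  have h := (Complex.continuousAt_ofReal_cpow_const 0 z (Or.inl hz)).tendsto
  rw [Complex.ofReal_zero, Complex.zero_cpow (fun h => by rw [h] at hz; simp at hz)] at h
  exact h.mono_left nhdsWithin_le_nhds

theorem tendsto_ofReal_nhdsGT : Tendsto (fun s : ℝ => (s : ℂ)) (𝓝[>] 0) (𝓝 0) :=
  (Complex.continuous_ofReal.tendsto' 0 0 Complex.ofReal_zero).mono_left nhdsWithin_le_nhds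

theorem IsEdge.tendsto (hα : -1 < α.re) {f : ℝ → ℂ} {A B : ℂ → ℂ} (h : IsEdge α f A B) :
    Tendsto f (𝓝[>] 0) (𝓝 (A 0)) := by
  have hA := h.analytic_left.continuousAt.tendsto.comp tendsto_ofReal_nhdsGT
  have hB := h.analytic_right.continuousAt.tendsto.comp tendsto_ofReal_nhdsGT
  have h2 : 0 < (2 * (α + 1)).re := by simp; linarith
  have hO := h.isBigO.trans_tendsto (tendsto_ofReal_cpow_zero h2)
  have := (hA.add ((tendsto_ofReal_cpow_zero (re_add_one_pos hα)).mul hB)).add hO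
  rw [zero_mul, add_zero, add_zero] at this
  refine this.congr fun s => ?_
  simp only [Function.comp_apply]
  ring

theorem IsEdge.congr {f g : ℝ → ℂ} {A B : ℂ → ℂ} (h : IsEdge α f A B) (hfg : f =ᶠ[𝓝[>] 0] g) :
    IsEdge α g A B :=
  ⟨h.analytic_left, h.analytic_right, h.isBigO.congr'
    (hfg.mono fun s hs => by simp only []; rw [hs]) EventuallyEq.rfl⟩

theorem IsEdge.neg_sub_const {f : ℝ → ℂ} {A B : ℂ → ℂ} (h : IsEdge α f A B) (x : ℂ) :
    IsEdge α (fun s => -f s - x) (fun z => -A z - x) (fun z => -B z) :=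
  ⟨h.analytic_left.neg.sub analyticAt_const, h.analytic_right.neg, h.isBigO.neg_left.congr'
    (Eventually.of_forall fun s => by ring) EventuallyEq.rfl⟩

/-- Quotient rule to first order in w = s^{α+1}. After multiplication by f₁, what remains is w² B₁ C
plus the two given errors, all O(w²), and 1/f₁ is bounded near 0. -/
theorem IsEdge.div (hα : -1 < α.re) {f₁ f₂ : ℝ → ℂ} {A₁ B₁ A₂ B₂ : ℂ → ℂ}
    (h₁ : IsEdge α f₁ A₁ B₁) (h₂ : IsEdge α f₂ A₂ B₂) (h1 : A₁ 0 ≠ 0) :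
    IsEdge α (fun s => f₂ s / f₁ s) (fun z => A₂ z / A₁ z)
      (fun z => (B₂ z * A₁ z - A₂ z * B₁ z) / A₁ z ^ 2) := by
  set w : ℝ → ℂ := fun s => (s : ℂ) ^ (α + 1) with hw
  set C : ℂ → ℂ := fun z => (B₂ z * A₁ z - A₂ z * B₁ z) / A₁ z ^ 2 with hC
  set A : ℂ → ℂ := fun z => A₂ z / A₁ z with hA
  have hCan : AnalyticAt ℂ C 0 :=
    ((h₂.analytic_right.mul h₁.analytic_left).sub (h₂.analytic_left.mul h₁.analytic_right)).div
      (h₁.analytic_left.pow 2) (pow_ne_zero 2 h1)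
  have hAan : AnalyticAt ℂ A 0 := h₂.analytic_left.div h₁.analytic_left h1
  refine ⟨hAan, hCan, ?_⟩
  have hf := h₁.tendsto hα
  have hwt : Tendsto w (𝓝[>] 0) (𝓝 0) := tendsto_ofReal_cpow_zero (re_add_one_pos hα)
  have hBC : (fun s : ℝ => B₁ s * C s) =O[𝓝[>] 0] fun _ => (1 : ℝ) :=
    ((h₁.analytic_right.mul hCan).continuousAt.tendsto.comp tendsto_ofReal_nhdsGT).isBigO_one ℝ
  have hQ : (fun s : ℝ => A s + w s * C s) =O[𝓝[>] 0] fun _ => (1 : ℝ) :=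
    ((hAan.continuousAt.tendsto.comp tendsto_ofReal_nhdsGT).add
      (hwt.mul (hCan.continuousAt.tendsto.comp tendsto_ofReal_nhdsGT))).isBigO_one ℝ
  have hfi : (fun s : ℝ => (f₁ s)⁻¹) =O[𝓝[>] 0] fun _ => (1 : ℝ) := (hf.inv₀ h1).isBigO_one ℝ
  have hww : ∀ s : ℝ, (s : ℂ) ^ (2 * (α + 1)) = w s ^ 2 := fun s => by
    rw [hw]
    exact_mod_cast Complex.cpow_nat_mul (s : ℂ) 2 (α + 1)
  have hw2 : (fun s : ℝ => w s ^ 2) =O[𝓝[>] 0] fun s : ℝ => ‖(s : ℂ) ^ (2 * (α + 1))‖ := by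
    simp only [hww]
    exact (isBigO_refl _ _).norm_right
  have hO1 := (hw2.mul hBC)
  have hO2 := h₁.isBigO.norm_right.mul hQ
  have hO3 := h₂.isBigO.norm_right
  simp only [mul_one] at hO1 hO2
  have hO := (((hO3.sub hO1).sub hO2).mul hfi)
  simp only [mul_one] at hO
  refine hO.of_norm_right.congr' ?_ EventuallyEq.rfl
  have hA1 : ∀ᶠ s : ℝ in 𝓝[>] 0, A₁ (s : ℂ) ≠ 0 :=
    (h₁.analytic_left.continuousAt.tendsto.comp tendsto_ofReal_nhdsGT).eventually_ne h1
  filter_upwards [hf.eventually_ne h1, hA1] with s hs hs1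
  simp only [hA, hC]
  field_simp
  ring

/-- Normalising B to value 1 at 0 divides by d. When d = 0 the whole k = 1 series has to vanish, and
the constant 1 then serves as the factor. -/
theorem IsEdge.hasEdgeExpansion {f : ℝ → ℂ} {A B : ℂ → ℂ} (h : IsEdge α f A B) {c₀ c₁ d : ℂ}
    (h0 : A 0 = c₀) (h1 : deriv A 0 = c₁) (hB : B 0 = d / 4 ^ (α + 1))
    (hd : d = 0 → ∀ᶠ s : ℝ in 𝓝[>] 0, B s = 0) : HasEdgeExpansion α f c₀ c₁ d := by
  have h4 : (4 : ℂ) ^ (α + 1) ≠ 0 := by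
    rw [Ne, Complex.cpow_eq_zero_iff]
    exact fun h => absurd h.1 (by norm_num)
  by_cases hd0 : d = 0
  · refine ⟨A, fun _ => 1, h.analytic_left, analyticAt_const, h0, h1, rfl, ?_⟩
    refine h.isBigO.congr' ?_ EventuallyEq.rfl
    filter_upwards [hd hd0] with s hs
    rw [hs, hd0]
    ring
  · refine ⟨A, fun z => 4 ^ (α + 1) / d * B z, h.analytic_left,
      analyticAt_const.mul h.analytic_right, h0, h1, ?_, ?_⟩
    · simp only [hB]
      field_simp
    · refine h.isBigO.congr' ?_ EventuallyEq.rfl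
      filter_upwards [self_mem_nhdsWithin] with s hs
      have hs0 : 0 < s := hs
      have : (s : ℂ) ^ (α + 1) = ((s : ℂ) / 4) ^ (α + 1) * 4 ^ (α + 1) := by
        have := Complex.mul_cpow_ofReal_nonneg (a := s / 4) (b := 4) (by positivity) (by norm_num)
          (α + 1)
        push_cast at this
        rw [← this]
        congr 1
        ring
      rw [this]
      field_simp

end

/-! ### Recovery of a function from its logarithmic derivative -/

section

variable {α : ℂ}

/-- The weight ρ removes the exponent 0, and every other exponent has real part at least min(1, Re α
+ 1). This makes the logarithmic derivative integrable at 0. -/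
theorem exists_norm_tsum_exponents_mul_le (hα : -1 < α.re) {c : ℂ → ℂ} {t : ℝ} (ht : 0 < t)
    (hc : Summable fun ρ : exponents α => (ρ : ℂ) * c ρ * (t : ℂ) ^ (ρ : ℂ)) :
    ∃ κ M : ℝ, 0 < κ ∧ ∀ s : ℝ, 0 < s → s ≤ t →
      ‖∑' ρ : exponents α, (ρ : ℂ) * c ρ * (s : ℂ) ^ (ρ : ℂ)‖ ≤ M * s ^ κ := by
  have h1 : 0 < α.re + 1 := by linarith
  refine ⟨min 1 (α.re + 1), (t ^ min 1 (α.re + 1))⁻¹ *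
    ∑' ρ : exponents α, ‖(ρ : ℂ) * c ρ * (t : ℂ) ^ (ρ : ℂ)‖, lt_min one_pos h1, fun s hs hst => ?_⟩
  refine (norm_tsum_exponents_le (c := fun ρ => ρ * c ρ) (c' := fun ρ => ρ * c ρ)
    (κ := min 1 (α.re + 1)) hs hst hc fun ρ hρ => ?_).trans_eq ?_
  · by_cases h0 : ρ = 0
    · exact Or.inl (by rw [h0, zero_mul])
    · refine Or.inr ⟨rfl, ?_⟩
      obtain ⟨m, k, rfl⟩ := hρ
      change _ ≤ (expo α k m).re
      rw [expo_re]
      rcases Nat.eq_zero_or_pos k with hk | hk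
      · subst hk
        have hm : 1 ≤ m := Nat.one_le_iff_ne_zero.2 fun hm => h0 (by simp [hm])
        have : (1 : ℝ) ≤ m := by exact_mod_cast hm
        simpa using Or.inl this
      · have hk1 : (1 : ℝ) ≤ k := by exact_mod_cast hk
        have hm : (0 : ℝ) ≤ m := m.cast_nonneg
        refine (min_le_right _ _).trans ?_
        nlinarith
  · rw [Real.div_rpow hs.le ht.le]
    ring

/-- As f stays within 1/2 of 1, the principal logarithm of f is a primitive with limit 0 at the left
end, and the integrand is bounded by a multiple of s^{κ-1}. -/
theorem intervalIntegrable_logDeriv_and_exp {f F : ℝ → ℂ} {r κ M t : ℝ} (ht : 0 < t) (htr : t < r)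
    (hκ : 0 < κ) (hd : ∀ s ∈ Set.Ioo 0 r, HasDerivAt f (F s / s) s)
    (hF : ∀ s ∈ Set.Ioo 0 r, ContinuousAt F s)
    (hM : ∀ s ∈ Set.Ioo 0 r, ‖F s‖ ≤ M * s ^ κ) (h1 : ∀ s ∈ Set.Ioo 0 r, ‖f s - 1‖ < 1 / 2)
    (hlim : Tendsto f (𝓝[>] 0) (𝓝 1)) :
    IntervalIntegrable (fun s : ℝ => F s / s / f s) volume 0 t ∧
      f t = Complex.exp (∫ s in (0 : ℝ)..t, F s / s / f s) := by
  have hnorm : ∀ s ∈ Set.Ioo 0 r, 1 / 2 ≤ ‖f s‖ := by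
    intro s hs
    have h2 := norm_sub_norm_le (1 : ℂ) (1 - f s)
    rw [sub_sub_cancel, norm_one, norm_sub_rev] at h2
    linarith [h1 s hs]
  have hne : ∀ s ∈ Set.Ioo 0 r, f s ≠ 0 := fun s hs h => by
    have := hnorm s hs
    rw [h, norm_zero] at this
    norm_num at this
  have hsub : ∀ s ∈ Set.Ioc 0 t, s ∈ Set.Ioo 0 r := fun s hs => ⟨hs.1, hs.2.trans_lt htr⟩
  have hint : IntervalIntegrable (fun s : ℝ => F s / s / f s) volume 0 t := by
    have hb : IntegrableOn (fun s : ℝ => 2 * M * s ^ (κ - 1)) (Set.Ioc 0 t) := by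
      rw [← intervalIntegrable_iff_integrableOn_Ioc_of_le ht.le]
      exact (intervalIntegral.intervalIntegrable_rpow' (by linarith)).const_mul _
    rw [intervalIntegrable_iff_integrableOn_Ioc_of_le ht.le]
    refine Integrable.mono' hb (ContinuousOn.aestronglyMeasurable (fun s hs => ?_)
      measurableSet_Ioc) ((ae_restrict_iff' measurableSet_Ioc).2 (ae_of_all _ fun s hs => ?_))
    · have hs' := hsub s hs
      exact (((hF s hs').div Complex.continuous_ofReal.continuousAt
        (Complex.ofReal_ne_zero.2 hs.1.ne')).div (hd s hs').continuousAt
        (hne s hs')).continuousWithinAt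
    · have hs' := hsub s hs
      have hfs := hnorm s hs'
      have hs0 : 0 < s := hs.1
      have hfs0 : 0 < ‖f s‖ := by linarith
      rw [norm_div, norm_div, Complex.norm_real, Real.norm_of_nonneg hs0.le,
        Real.rpow_sub_one hs0.ne', div_le_iff₀ hfs0]
      have h3 := hM s hs'
      have h4 : 0 ≤ M * s ^ κ := (norm_nonneg _).trans h3
      calc ‖F s‖ / s ≤ M * s ^ κ / s := by gcongr
        _ = 2 * (M * s ^ κ / s) * (1 / 2) := by ring
        _ ≤ 2 * (M * s ^ κ / s) * ‖f s‖ := by gcongr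
        _ = _ := by ring
  refine ⟨hint, ?_⟩
  have hslit : ∀ s ∈ Set.Ioo 0 r, f s ∈ Complex.slitPlane := fun s hs =>
    Complex.mem_slitPlane_of_norm_lt_one (z := f s - 1) ((h1 s hs).trans (by norm_num)) |> fun h => by
      rwa [add_sub_cancel] at h
  have htm : t ∈ Set.Ioo 0 r := ⟨ht, htr⟩
  have hlog := intervalIntegral.integral_eq_sub_of_hasDerivAt_of_tendsto ht
    (f := fun s => Complex.log (f s)) (f' := fun s => F s / s / f s)
    (fun s hs => (hd s (hsub s ⟨hs.1, hs.2.le⟩)).clog_real (hslit s (hsub s ⟨hs.1, hs.2.le⟩))) hint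
    (fa := Complex.log 1) (fb := Complex.log (f t))
    (hlim.clog (by simp))
    (((hd t htm).continuousAt.clog (hslit t htm)).tendsto.mono_left nhdsWithin_le_nhds)
  rw [hlog, Complex.log_one, sub_zero, Complex.exp_log (hne t htm)]

end

end HardEdge

end

/-! ### The hard edge expansions -/

theorem mainTheorem4 (a μ ξ : ℂ) (hμ : -1 < μ.re) (ha : -1 < a.re) (hμa : -1 < (μ + a).re)
    (hgen : ∀ n : ℕ, μ + a ≠ n) (hlim : HardEdge.LimitTermByTerm a μ ξ) :
    -- near `0` the limit exists, is differentiable and non-zero, and is the exponential of an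
    -- integral of `σ_{III'}`
    (∀ᶠ t : ℝ in 𝓝[>] 0,
      Tendsto (fun N : ℕ => HardEdge.scaledE N a μ ξ t) atTop (𝓝 (HardEdge.EHard a μ ξ t)) ∧
      DifferentiableAt ℝ (HardEdge.EHard a μ ξ) t ∧ HardEdge.EHard a μ ξ t ≠ 0 ∧
      IntervalIntegrable
        (fun s : ℝ => -(HardEdge.sigmaIII a μ ξ s + μ * (μ + a) / 2) / (s : ℂ)) volume 0 t ∧
      HardEdge.EHard a μ ξ t =
        Complex.exp (∫ s in (0 : ℝ)..t,
          -(HardEdge.sigmaIII a μ ξ s + μ * (μ + a) / 2) / (s : ℂ))) ∧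
    -- the expansion of `Ẽ₂^hard`
    HardEdge.HasEdgeExpansion (μ + a) (HardEdge.EHard a μ ξ)
      1 (-(μ / (4 * (a + μ))))
      (Complex.Gamma (μ + 1) * Complex.Gamma (a + 1) /
          (Complex.Gamma (μ + a + 2) ^ 2 * Complex.Gamma (μ + a + 1)) *
        ((1 - ξ) * Complex.exp (Real.pi * Complex.I * μ) -
          Complex.sin (Real.pi * a) / Complex.sin (Real.pi * (μ + a)))) ∧
    -- the expansion of `σ_{III'}`
    HardEdge.HasEdgeExpansion (μ + a) (HardEdge.sigmaIII a μ ξ)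
      (-(μ * (μ + a) / 2)) (μ / (4 * (μ + a)))
      (-(Complex.Gamma (μ + 1) * Complex.Gamma (a + 1) /
          (Complex.Gamma (μ + a + 2) * Complex.Gamma (μ + a + 1) ^ 2) *
        ((1 - ξ) * Complex.exp (Real.pi * Complex.I * μ) -
          Complex.sin (Real.pi * a) / Complex.sin (Real.pi * (μ + a))))) := by
  open HardEdge in
  have hα := not_int_of_not_nat hμa hgen
  obtain ⟨h, h0, hα1, hone, hzero, hev⟩ := exists_hardEdge_coefficients ξ hμ ha hμa hα hlim
  obtain ⟨ε, hε, hev⟩ := mem_nhdsGT_iff_exists_Ioo_subset.1 hev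
  have hε0 : 0 < ε := hε
  set t₀ : ℝ := ε / 2 with ht₀
  have ht₀pos : 0 < t₀ := half_pos hε0
  set f : ℝ → ℂ := fun s => ∑' ρ : exponents (μ + a), h ρ * (s : ℂ) ^ (ρ : ℂ) with hf
  set F : ℝ → ℂ := fun s => ∑' ρ : exponents (μ + a), (ρ : ℂ) * h ρ * (s : ℂ) ^ (ρ : ℂ) with hF
  have hE : ∀ s ∈ Set.Ioo 0 ε, EHard a μ ξ s = f s ∧
      Tendsto (fun N : ℕ => scaledE N a μ ξ s) atTop (𝓝 (EHard a μ ξ s)) := by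
    intro s hs
    obtain ⟨L, hL1, hL2⟩ := hev hs
    have hL : EHard a μ ξ s = L := hL2.limUnder_eq
    exact ⟨hL.trans hL1.tsum_eq.symm, hL ▸ hL2⟩
  have hsum : Summable fun ρ : exponents (μ + a) => h ρ * (t₀ : ℂ) ^ (ρ : ℂ) := by
    obtain ⟨L, hL1, -⟩ := hev (show t₀ ∈ Set.Ioo 0 ε from ⟨ht₀pos, half_lt_self hε0⟩)
    exact hL1.summable
  have hsum' := summable_exponents_mul hμa ht₀pos hsum
  have ht₀2 : 0 < t₀ / 2 := half_pos ht₀pos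
  have hE_eq : f =ᶠ[𝓝[>] 0] EHard a μ ξ :=
    mem_of_superset (Ioo_mem_nhdsGT hε0) fun s hs => (hE s hs).1.symm
  obtain ⟨A₁, B₁, hAB₁, hA₁, hA₁', hB₁, hB₁z⟩ := exists_isEdge hμa hα ht₀pos hsum hone
  -- The series for s d/ds Ẽ₂^hard has coefficients ρ h(ρ): constant term 0, the same linear
  -- coefficient, and leading singular coefficient multiplied by α + 1.
  obtain ⟨A₂, B₂, hAB₂, hA₂, hA₂', hB₂, hB₂z⟩ := exists_isEdge hμa hα ht₀2
    (c := fun ρ => ρ * h ρ) hsum' fun hk => (one_mul _).trans (hone hk)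
  have hA₁1 : A₁ 0 = 1 := hA₁.trans h0
  have hA₂0 : A₂ 0 = 0 := by rw [hA₂, zero_mul]
  have hdf : ∀ s ∈ Set.Ioo 0 (t₀ / 2), HasDerivAt f (F s / s) s := fun s hs =>
    hasDerivAt_tsum_exponents hμa ht₀pos hsum hs.1 hs.2
  have hdE : ∀ s ∈ Set.Ioo 0 (t₀ / 2), HasDerivAt (EHard a μ ξ) (F s / s) s := fun s hs => by
    refine (hdf s hs).congr_of_eventuallyEq ?_
    filter_upwards [Ioo_mem_nhds hs.1 (show s < ε by linarith [hs.2])] with x hx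
    exact (hE x hx).1
  have hlogd : ∀ s ∈ Set.Ioo 0 (t₀ / 2), logDeriv (EHard a μ ξ) s = F s / s / f s := fun s hs => by
    rw [logDeriv_apply, (hdE s hs).deriv, (hE s ⟨hs.1, by linarith [hs.2]⟩).1]
  have hFc : ∀ s ∈ Set.Ioo 0 (t₀ / 2 / 2), ContinuousAt F s := fun s hs =>
    (hasDerivAt_tsum_exponents (c := fun ρ => ρ * h ρ) hμa ht₀2 hsum' hs.1 hs.2).continuousAt
  have hflim : Tendsto f (𝓝[>] 0) (𝓝 1) := hA₁1 ▸ hAB₁.tendsto hμa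
  -- With zero amplitude only natural exponents carry coefficients, which settles the degenerate
  -- case of `IsEdge.hasEdgeExpansion`.
  have hd : edgeConst a μ ξ = 0 → (∀ z, B₁ z = 0) ∧ ∀ z, B₂ z = 0 := fun hX =>
    ⟨hB₁z (hzero hX), hB₂z fun ρ hρ hm => by rw [hzero hX ρ hρ hm, mul_zero]⟩
  have hΓ1 : Complex.Gamma (μ + 1) ≠ 0 := Complex.Gamma_ne_zero_of_re_pos (re_add_one_pos hμ)
  have hΓ2 : Complex.Gamma (a + 1) ≠ 0 := Complex.Gamma_ne_zero_of_re_pos (re_add_one_pos ha)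
  have hΓ3 : Complex.Gamma (μ + a + 1) ≠ 0 := Complex.Gamma_ne_zero_of_re_pos (re_add_one_pos hμa)
  have hα10 : μ + a + 1 ≠ 0 := fun h' => by
    have := re_add_one_pos hμa
    rw [h'] at this
    simp at this
  have hΓ4' : Complex.Gamma (μ + a + 2) = (μ + a + 1) * Complex.Gamma (μ + a + 1) := by
    rw [← Complex.Gamma_add_one _ hα10]
    ring_nf
  have hΓ4 : Complex.Gamma (μ + a + 2) ≠ 0 := hΓ4' ▸ mul_ne_zero hα10 hΓ3
  refine ⟨?_, ?_, ?_⟩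
  · obtain ⟨κ, M, hκ, hM⟩ := exists_norm_tsum_exponents_mul_le hμa ht₀2 hsum'
    obtain ⟨r₁, hr₁, hr₁f⟩ := mem_nhdsGT_iff_exists_Ioo_subset.1
      (hflim.eventually (Metric.ball_mem_nhds (1 : ℂ) (show (0 : ℝ) < 1 / 2 by norm_num)))
    set r : ℝ := min r₁ (t₀ / 2 / 2) with hr
    have hr0 : 0 < r := lt_min hr₁ (half_pos ht₀2)
    have hrt : r ≤ t₀ / 2 / 2 := min_le_right _ _
    have hsub : ∀ s ∈ Set.Ioo 0 r, s ∈ Set.Ioo 0 (t₀ / 2) := fun s hs =>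
      ⟨hs.1, by linarith [hs.2]⟩
    have hf1 : ∀ s ∈ Set.Ioo 0 r, ‖f s - 1‖ < 1 / 2 := fun s hs => by
      have := hr₁f ⟨hs.1, hs.2.trans_le (min_le_left _ _)⟩
      simpa [dist_eq_norm] using this
    filter_upwards [Ioo_mem_nhdsGT hr0] with t ht
    have htε : t ∈ Set.Ioo 0 ε := ⟨ht.1, by linarith [(hsub t ht).2]⟩
    obtain ⟨hi, hexp⟩ := intervalIntegrable_logDeriv_and_exp ht.1 ht.2 hκ
      (fun s hs => hdf s (hsub s hs)) (fun s hs => hFc s ⟨hs.1, hs.2.trans_le hrt⟩)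
      (fun s hs => hM s hs.1 (hsub s hs).2.le) hf1 hflim
    have hcongr : ∀ s ∈ Set.Ioc 0 t, F s / s / f s =
        -(sigmaIII a μ ξ s + μ * (μ + a) / 2) / (s : ℂ) := by
      intro s hs
      have hsc : (s : ℂ) ≠ 0 := Complex.ofReal_ne_zero.2 hs.1.ne'
      rw [sigmaIII, hlogd s (hsub s ⟨hs.1, hs.2.trans_lt ht.2⟩), sub_add_cancel, neg_neg,
        mul_div_cancel_left₀ _ hsc]
    refine ⟨(hE t htε).2, (hdE t (hsub t ht)).differentiableAt, ?_, ?_, ?_⟩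
    · rw [(hE t htε).1, hexp]
      exact Complex.exp_ne_zero _
    · rw [intervalIntegrable_iff_integrableOn_Ioc_of_le ht.1.le] at hi ⊢
      exact hi.congr_fun hcongr measurableSet_Ioc
    · rw [(hE t htε).1, hexp, intervalIntegral.integral_of_le ht.1.le,
        intervalIntegral.integral_of_le ht.1.le, setIntegral_congr_fun measurableSet_Ioc hcongr]
  · refine (hAB₁.congr hE_eq).hasEdgeExpansion hA₁1 hA₁' (hB₁.trans hα1) fun hd0 => ?_
    have hX : edgeConst a μ ξ = 0 := by
      refine (mul_eq_zero.1 hd0).resolve_left (div_ne_zero (mul_ne_zero hΓ1 hΓ2) ?_)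
      exact mul_ne_zero (pow_ne_zero _ hΓ4) hΓ3
    exact Eventually.of_forall fun s => (hd hX).1 s
  · have hσ := (hAB₁.div hμa hAB₂ (by rw [hA₁1]; exact one_ne_zero)).neg_sub_const
      (μ * (μ + a) / 2)
    have hσ_eq : (fun s => -(F s / f s) - μ * (μ + a) / 2) =ᶠ[𝓝[>] 0] sigmaIII a μ ξ := by
      filter_upwards [Ioo_mem_nhdsGT ht₀2] with s hs
      have hsc : (s : ℂ) ≠ 0 := Complex.ofReal_ne_zero.2 hs.1.ne'
      rw [sigmaIII, hlogd s hs]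
      field_simp
    refine (hσ.congr hσ_eq).hasEdgeExpansion ?_ ?_ ?_ fun hd0 => ?_
    · simp [hA₂0]
    · have h1 := hAB₂.analytic_left.differentiableAt.hasDerivAt
      have h2 := hAB₁.analytic_left.differentiableAt.hasDerivAt
      have h3 := ((h1.fun_div h2 (by rw [hA₁1]; exact one_ne_zero)).fun_neg.sub_const
        (μ * (μ + a) / 2)).deriv
      rw [h3, hA₂', hA₁1, hA₂0, add_comm a μ]
      ring
    · simp only [hA₁1, hA₂0, hB₂, hα1, edgeConst]
      -- The factor α + 1 from differentiation combines with Γ(α+2) = (α+1)Γ(α+1), moving the square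
      -- from Γ(α+2) to Γ(α+1).
      rw [hΓ4']
      field_simp
      ring
    · have hX : edgeConst a μ ξ = 0 := by
        refine (mul_eq_zero.1 (neg_eq_zero.1 hd0)).resolve_left
          (div_ne_zero (mul_ne_zero hΓ1 hΓ2) ?_)
        exact mul_ne_zero hΓ4 (pow_ne_zero _ hΓ3)
      refine Eventually.of_forall fun s => ?_
      simp [(hd hX).1, (hd hX).2]
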